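/- **Theorem.** Let $\mathbb K$ be a field of characteristic zero. For $n\ge 1$ let $\mathfrak{gl}(n,\mathbb K)\ltimes\mathfrak{gl}(n,\mathbb K)_{ab}$ be the semidirect product in which $\mathfrak{gl}(n,\mathbb K)$ acts on the abelian Lie algebra $\mathfrak{gl}(n,\mathbb K)_{ab}$ (the same vector space) by the adjoint representation, so that $$\{(X_0,X_1),(Y_0,Y_1)\}=([X_0,Y_0],\,[X_0,Y_1]-[Y_0,X_1]).$$ Write its elements as pairs $(x_0I_n+X_0,\;x_1I_n+X_1)$ with $x_0,x_1\in\mathbb K$ and traceless matrices $X_0,X_1\in\mathfrak{sl}(n,\mathbb K)$. (1) With the bilinear product $$(a_0I_n+A_0,\;a_1I_n+A_1)\cdot(b_0I_n+B_0,\;b_1I_n+B_1)=\Big(a_0b_0I_n+a_0B_0+b_0A_0,\;\big(a_0b_1+a_1b_0+\operatorname{tr}(A_0B_1+A_1B_0)-\tfrac2n\operatorname{tr}(A_0B_0)\big)I_n+a_0B_1+b_0A_1+A_0B_0+B_0A_0\Big)$$ this Lie algebra is a Poisson algebra: the product is commutative and associative, and $\{x,-\}$ is a derivation of it for every $x$.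 (2) For $n=3$ this Poisson algebra is isomorphic to the Poisson algebra $H_E^{\bullet,\bullet}(\mathfrak h)=\bigoplus_{p+q\ \mathrm{even}}H^p(\mathfrak h,\bigwedge^q\mathfrak h)$, where $\mathfrak h$ is the Heisenberg Lie algebra with basis $x,y,z$ whose only non-zero bracket of basis elements is $[x,y]=z$ (up to skew-symmetry). Here, for a finite-dimensional Lie algebra $\mathfrak g$, the space $C=\bigoplus_{p,q}C^{p,q}$, $C^{p,q}=\bigwedge^p\mathfrak g^*\otimes\bigwedge^q\mathfrak g$, has the product $(\phi\otimes v)\vee(\psi\otimes w)=(-1)^{p_2q_1}(\phi\wedge\psi)\otimes(v\wedge w)$ for $\phi\otimes v\in C^{p_1,q_1}$, $\psi\otimes w\in C^{p_2,q_2}$, and the bilinear bracket $\{-,-\}:C^{p_1,q_1}\times C^{p_2,q_2}\to C^{p_1+p_2-1,q_1+q_2-1}$ determined, with $|a|=p+q$ for $a\in C^{p,q}$, by $\{\mathfrak g,\mathfrak g\}=\{\mathfrak g^*,\mathfrak g^*\}=0$, $\{\phi,v\}=\{v,\phi\}=\phi(v)$ for $\phi\in\mathfrak g^*$, $v\in\mathfrak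 g$, $\{a,b\}=-(-1)^{|a||b|}\{b,a\}$ and $\{a\vee b,c\}=a\vee\{b,c\}+(-1)^{|a||b|}b\vee\{a,c\}$. The differential is $d=\{\mu,-\}:C^{p,q}\to C^{p+1,q}$, where $\mu\in C^{2,1}$ is the Lie bracket of $\mathfrak g$. Both $\vee$ and $\{-,-\}$ pass to the even cohomology $H_E^{\bullet,\bullet}(\mathfrak g)$, which is a Poisson algebra with the operations so obtained. (3) Let $\mathrm{GL}(n,\mathbb K)$ act on both factors by conjugation and let $V_0=\mathbb K$ and $V_{Ad}=\mathfrak{sl}(n,\mathbb K)$ be its trivial and adjoint representations. If $n\ge2$, these are irreducible and non-isomorphic, and bases of $\operatorname{Hom}_{\mathrm{GL}(n,\mathbb K)}(V_i\otimes V_j,V_k)$, $i,j,k\in\{0,Ad\}$, are given by: $m^{0,0,0}(x\otimes y)=xy$, $m^{0,Ad,Ad}(x\otimes A)=m^{Ad,0,Ad}(A\otimes x)=xA$, $m^{Ad,Ad,0}(A\otimes B)=\operatorname{tr}(AB)$, $m_1^{Ad,Ad,Ad}(A\otimes B)=[A,B]$, $m_2^{Ad,Ad,Ad}(A\otimes B)=AB+BA-\frac2n\operatorname{tr}(AB)I_n$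 (where $m_2^{Ad,Ad,Ad}=0$ is omitted if $n=2$), and the empty set for the remaining $(i,j,k)$. For all $n\ge 1$ the action is by automorphisms of both the product and the bracket, $$\mathfrak{gl}(n,\mathbb K)\ltimes\mathfrak{gl}(n,\mathbb K)_{ab}=(I_n)_0\oplus\mathfrak{sl}(n)_0\oplus\mathfrak{sl}(n)_{ab}\oplus(I_n)_{ab}$$ is a decomposition into subrepresentations (the multiples of $I_n$ and the traceless matrices in the first and in the abelian factor), and with respect to it and to the isomorphisms $x\mapsto(xI_n,0)$, $A\mapsto(A,0)$, $A\mapsto(0,A)$, $x\mapsto(0,xI_n)$ from $V_0,V_{Ad},V_{Ad},V_0$ onto the summands, the product and the bracket have the tables | $\cdot$ | $(I_n)_0$ | $\mathfrak{sl}(n)_0$ | $\mathfrak{sl}(n)_{ab}$ | $(I_n)_{ab}$ | |---|---|---|---|---| | $(I_n)_0$ | $(I_n)_0$ | $\mathfrak{sl}(n)_0$ | $\mathfrak{sl}(n)_{ab}$ | $(I_n)_{ab}$ | | $\mathfrak{sl}(n)_0$ | $\mathfrak{sl}(n)_0$ | $\mathfrak{sl}(n)_{ab}^{(+)}$ | $(I_n)_{ab}$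 | $0$ | | $\mathfrak{sl}(n)_{ab}$ | $\mathfrak{sl}(n)_{ab}$ | $(I_n)_{ab}$ | $0$ | $0$ | | $(I_n)_{ab}$ | $(I_n)_{ab}$ | $0$ | $0$ | $0$ | | $\{-,-\}$ | $(I_n)_0$ | $\mathfrak{sl}(n)_0$ | $\mathfrak{sl}(n)_{ab}$ | $(I_n)_{ab}$ | |---|---|---|---|---| | $(I_n)_0$ | $0$ | $0$ | $0$ | $0$ | | $\mathfrak{sl}(n)_0$ | $0$ | $\mathfrak{sl}(n)_0^{(-)}$ | $\mathfrak{sl}(n)_{ab}^{(-)}$ | $0$ | | $\mathfrak{sl}(n)_{ab}$ | $0$ | $\mathfrak{sl}(n)_{ab}^{(-)}$ | $0$ | $0$ | | $(I_n)_{ab}$ | $0$ | $0$ | $0$ | $0$ | An entry $\mathfrak A_t$ in row $\mathfrak A_r$ and column $\mathfrak A_s$ means that the operation restricted to $\mathfrak A_r\otimes\mathfrak A_s$ is, under the isomorphisms above, the basis morphism $m^{i,j,k}$ with values in $\mathfrak A_t$; the signs $(-)$ and $(+)$ mean that it is $m_1^{Ad,Ad,Ad}$ and $m_2^{Ad,Ad,Ad}$,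 respectively. -/

import Mathlib

open scoped TensorProduct

universe u v w

noncomputable section

namespace GTables

/-! ### Poisson algebras -/

section Poisson

variable (K : Type u) [Field K] {A : Type v} [AddCommGroup A] [Module K A]

/-- `A`, with the bilinear product `mul` and the bilinear bracket `br`, is a Poisson algebra:
`mul` is commutative and associative, `br` is a Lie bracket, and `br a` derives `mul`. -/
structure IsPoissonAlgebra (mul br : A →ₗ[K] A →ₗ[K] A) : Prop where
  mul_comm : ∀ a b, mul a b = mul b a
  mul_assoc : ∀ a b c, mul (mul a b) c = mul a (mul b c)
  br_self : ∀ a, br a a = 0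
  jacobi : ∀ a b c, br a (br b c) = br (br a b) c + br b (br a c)
  leibniz : ∀ a b c, br a (mul b c) = mul (br a b) c + mul b (br a c)

/-- The bracket of a Lie algebra as a bilinear map. -/
def lieBilin (L : Type v) [LieRing L] [LieAlgebra K L] : L →ₗ[K] L →ₗ[K] L :=
  LinearMap.mk₂ K (fun x y => ⁅x, y⁆) add_lie (fun c x y => smul_lie c x y) lie_add
    (fun c x y => lie_smul c x y)

end Poisson

/-! ### The Lie algebra `𝔤𝔩(n) ⋉ 𝔤𝔩(n)_ab` and its commutative product -/

section GlProduct

variable (K : Type u) [Field K] (n : ℕ)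

/-- The Lie algebra `𝔤𝔩(n, K)`, with the commutator bracket. -/
abbrev Gl : Type u := Matrix (Fin n) (Fin n) K

instance : LieRing (Gl K n) := LieRing.ofAssociativeRing

instance : LieAlgebra K (Gl K n) := LieAlgebra.ofAssociativeAlgebra

/-- The vector space `𝔤𝔩(n, K)`, viewed as an abelian Lie algebra. -/
def GlAb : Type u := Matrix (Fin n) (Fin n) K

instance : AddCommGroup (GlAb K n) := inferInstanceAs (AddCommGroup (Matrix (Fin n) (Fin n) K))

instance : Module K (GlAb K n) := inferInstanceAs (Module K (Matrix (Fin n) (Fin n) K))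

instance : LieRing (GlAb K n) where
  bracket _ _ := 0
  add_lie _ _ _ := (add_zero 0).symm
  lie_add _ _ _ := (add_zero 0).symm
  lie_self _ := rfl
  leibniz_lie _ _ _ := (add_zero 0).symm

instance : LieAlgebra K (GlAb K n) where
  lie_smul c _ _ := (smul_zero c).symm

/-- The identification of a matrix with an element of `𝔤𝔩(n)_ab`. -/
def toAb : Matrix (Fin n) (Fin n) K ≃ₗ[K] GlAb K n := LinearEquiv.refl K _

/-- `𝔤𝔩(n)` acting on `𝔤𝔩(n)_ab` by the adjoint representation, `X ↦ (Y ↦ X Y - Y X)`. -/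
def adAction : Gl K n →ₗ⁅K⁆ LieDerivation K (GlAb K n) (GlAb K n) where
  toFun X :=
    { toLinearMap := (toAb K n).toLinearMap ∘ₗ
        (LinearMap.mulLeft K X - LinearMap.mulRight K X) ∘ₗ (toAb K n).symm.toLinearMap
      leibniz' := fun a b => by
        change (toAb K n) (X * 0 - 0 * X) = 0 - 0
        simp }
  map_add' X Y := by
    ext a
    change (X + Y) * (toAb K n).symm a - (toAb K n).symm a * (X + Y) =
      (X * (toAb K n).symm a - (toAb K n).symm a * X) +
        (Y * (toAb K n).symm a - (toAb K n).symm a * Y)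
    noncomm_ring
  map_smul' c X := by
    ext a
    change (c • X) * (toAb K n).symm a - (toAb K n).symm a * (c • X) =
      c • (X * (toAb K n).symm a - (toAb K n).symm a * X)
    simp [smul_sub]
  map_lie' := by
    intro X Y
    ext a
    rw [LieDerivation.commutator_apply]
    change (X * Y - Y * X) * (toAb K n).symm a - (toAb K n).symm a * (X * Y - Y * X) =
      (X * (Y * (toAb K n).symm a - (toAb K n).symm a * Y)
          - (Y * (toAb K n).symm a - (toAb K n).symm a * Y) * X) -
        (Y * (X * (toAb K n).symm a - (toAb K n).symm a * X)
          - (X * (toAb K n).symm a - (toAb K n).symm a * X) * Y)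
    noncomm_ring

/-- The semidirect product `𝔤𝔩(n) ⋉ 𝔤𝔩(n)_ab`. -/
abbrev GlSemi : Type u := LieAlgebra.SemiDirectSum (GlAb K n) (Gl K n) (adAction K n)

variable {K n}

/-- The element `(X₀, X₁)` of `𝔤𝔩(n) ⋉ 𝔤𝔩(n)_ab`, with `X₀` in the first factor and `X₁` in the
abelian one. -/
def pair (X₀ X₁ : Matrix (Fin n) (Fin n) K) : GlSemi K n := ⟨toAb K n X₁, X₀⟩

theorem pair_add (X₀ X₁ Y₀ Y₁ : Matrix (Fin n) (Fin n) K) :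
    pair (X₀ + Y₀) (X₁ + Y₁) = pair X₀ X₁ + pair Y₀ Y₁ := rfl

theorem pair_smul (c : K) (X₀ X₁ : Matrix (Fin n) (Fin n) K) :
    pair (c • X₀) (c • X₁) = c • pair X₀ X₁ := rfl

/-- The component in the factor `𝔤𝔩(n)`. -/
def comp₀ (x : GlSemi K n) : Matrix (Fin n) (Fin n) K := x.right

/-- The component in the factor `𝔤𝔩(n)_ab`. -/
def comp₁ (x : GlSemi K n) : Matrix (Fin n) (Fin n) K := (toAb K n).symm x.left

/-- The scalar `x` in the decomposition `X = x I_n + X'` with `X'` traceless. -/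
def scalarPart (X : Matrix (Fin n) (Fin n) K) : K := X.trace / n

/-- The traceless matrix `X'` in the decomposition `X = x I_n + X'`. -/
def slPart (X : Matrix (Fin n) (Fin n) K) : Matrix (Fin n) (Fin n) K := X - scalarPart X • 1

/-- The right-hand side of the formula for the product of `(a₀ I_n + A₀, a₁ I_n + A₁)` and
`(b₀ I_n + B₀, b₁ I_n + B₁)`. -/
def prodFormula (a₀ a₁ b₀ b₁ : K) (A₀ A₁ B₀ B₁ : Matrix (Fin n) (Fin n) K) : GlSemi K n :=
  pair ((a₀ * b₀) • 1 + a₀ • B₀ + b₀ • A₀)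
    ((a₀ * b₁ + a₁ * b₀ + (A₀ * B₁ + A₁ * B₀).trace - 2 / (n : K) * (A₀ * B₀).trace) • 1
      + a₀ • B₁ + b₀ • A₁ + A₀ * B₀ + B₀ * A₀)

theorem scalarPart_add (X Y : Matrix (Fin n) (Fin n) K) :
    scalarPart (X + Y) = scalarPart X + scalarPart Y := by
  simp [scalarPart, Matrix.trace_add, add_div]

theorem scalarPart_smul (c : K) (X : Matrix (Fin n) (Fin n) K) :
    scalarPart (c • X) = c * scalarPart X := by
  simp [scalarPart, Matrix.trace_smul, mul_div_assoc]

theorem slPart_add (X Y : Matrix (Fin n) (Fin n) K) : slPart (X + Y) = slPart X + slPart Y := by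
  simp only [slPart, scalarPart_add, add_smul]; abel

theorem slPart_smul (c : K) (X : Matrix (Fin n) (Fin n) K) : slPart (c • X) = c • slPart X := by
  simp only [slPart, scalarPart_smul, mul_smul, smul_sub]

/-- The product on `𝔤𝔩(n) ⋉ 𝔤𝔩(n)_ab`, as a function. -/
def glMulFun (x y : GlSemi K n) : GlSemi K n :=
  prodFormula (scalarPart (comp₀ x)) (scalarPart (comp₁ x))
    (scalarPart (comp₀ y)) (scalarPart (comp₁ y))
    (slPart (comp₀ x)) (slPart (comp₁ x)) (slPart (comp₀ y)) (slPart (comp₁ y))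

variable (K n)

/-- The product on `𝔤𝔩(n) ⋉ 𝔤𝔩(n)_ab`, as a bilinear map. -/
def glMul : GlSemi K n →ₗ[K] GlSemi K n →ₗ[K] GlSemi K n :=
  LinearMap.mk₂ K glMulFun
    (fun x x' y => by
      have h0 : comp₀ (x + x') = comp₀ x + comp₀ x' := rfl
      have h1 : comp₁ (x + x') = comp₁ x + comp₁ x' := rfl
      unfold glMulFun prodFormula
      rw [← pair_add]
      congr 1
      · simp only [h0, scalarPart_add, slPart_add, add_mul, add_smul, smul_add]
        abel
      · simp only [h0, h1, scalarPart_add, slPart_add, add_mul, mul_add, add_smul, sub_smul,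
          Matrix.trace_add, smul_add]
        abel)
    (fun c x y => by
      have h0 : comp₀ (c • x) = c • comp₀ x := rfl
      have h1 : comp₁ (c • x) = c • comp₁ x := rfl
      unfold glMulFun prodFormula
      rw [← pair_smul]
      congr 1
      · simp only [h0, scalarPart_smul, slPart_smul]
        module
      · simp only [h0, h1, scalarPart_smul, slPart_smul, Matrix.smul_mul, Matrix.mul_smul,
          Matrix.trace_add, Matrix.trace_smul, smul_eq_mul]
        module)
    (fun x y y' => by
      have h0 : comp₀ (y + y') = comp₀ y + comp₀ y' := rfl
      have h1 : comp₁ (y + y') = comp₁ y + comp₁ y' := rfl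
      unfold glMulFun prodFormula
      rw [← pair_add]
      congr 1
      · simp only [h0, scalarPart_add, slPart_add, mul_add, add_smul, smul_add]
        abel
      · simp only [h0, h1, scalarPart_add, slPart_add, add_mul, mul_add, add_smul, sub_smul,
          Matrix.trace_add, smul_add]
        abel)
    (fun c x y => by
      have h0 : comp₀ (c • y) = c • comp₀ y := rfl
      have h1 : comp₁ (c • y) = c • comp₁ y := rfl
      unfold glMulFun prodFormula
      rw [← pair_smul]
      congr 1
      · simp only [h0, scalarPart_smul, slPart_smul]
        module
      · simp only [h0, h1, scalarPart_smul, slPart_smul, Matrix.smul_mul, Matrix.mul_smul,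
          Matrix.trace_add, Matrix.trace_smul, smul_eq_mul]
        module)

end GlProduct

/-! ### Labelings of `Rep(G)` and `G`-tables -/

section GTable

variable (K : Type u) [Field K] (G : Type v) [Group G]

/-- The data of a partial labeling of `Rep(G)`: representations `V i` and, for all `i, j, k`,
morphisms `m i j k q : V i ⊗ V j → V k` of representations. -/
structure RepLabeling where
  /-- the index set of the chosen representations -/
  I : Type
  /-- the chosen representations -/
  V : I → Type u
  [addCommGroup : ∀ i, AddCommGroup (V i)]
  [module : ∀ i, Module K (V i)]
  /-- the action of `G` -/
  ρ : ∀ i, Representation K G (V i)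
  /-- the number of chosen morphisms -/
  d : I → I → I → ℕ
  /-- the chosen morphisms -/
  m : ∀ i j k, Fin (d i j k) → Representation.IntertwiningMap ((ρ i).tprod (ρ j)) (ρ k)

attribute [instance] RepLabeling.addCommGroup RepLabeling.module

variable {K G}

/-- The data form a partial labeling: the `V i` are finite dimensional, irreducible and pairwise
non-isomorphic, and the `m i j k q` form a basis of `Hom_G(V i ⊗ V j, V k)`. -/
structure RepLabeling.IsPartialLabeling (Λ : RepLabeling K G) : Prop where
  finite : ∀ i, FiniteDimensional K (Λ.V i)
  irreducible : ∀ i, (Λ.ρ i).IsIrreducible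
  eq_of_equiv : ∀ i j, Nonempty ((Λ.ρ i).Equiv (Λ.ρ j)) → i = j
  linearIndependent : ∀ i j k, LinearIndependent K (Λ.m i j k)
  span_eq_top : ∀ i j k, Submodule.span K (Set.range (Λ.m i j k)) = ⊤

/-- The scalars `c` are the `G`-table of the algebra `(A, mul)`, on which `G` acts by `ρA`, with
respect to the labeling `Λ` and the morphisms `τ r : V (ε r) → A`: `G` acts by algebra
automorphisms, `A` is the direct sum of the images of the injective morphisms `τ r`, and
`μ_{r,s} = ∑_t ∑_q c r s t q • τ_t ∘ m_q ∘ (τ_r ⊗ τ_s)⁻¹`. -/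
structure IsGTable (Λ : RepLabeling K G) {A : Type w} [AddCommGroup A] [Module K A]
    (ρA : Representation K G A) (mul : A →ₗ[K] A →ₗ[K] A)
    {R : Type} [Fintype R] [DecidableEq R] (ε : R → Λ.I)
    (τ : ∀ r, Representation.IntertwiningMap (Λ.ρ (ε r)) ρA)
    (c : ∀ r s t, Fin (Λ.d (ε r) (ε s) (ε t)) → K) : Prop where
  map_mul : ∀ g a b, ρA g (mul a b) = mul (ρA g a) (ρA g b)
  injective : ∀ r, Function.Injective (τ r)
  isInternal : DirectSum.IsInternal fun r => LinearMap.range (τ r).toLinearMap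
  table : ∀ r s (x : Λ.V (ε r)) (y : Λ.V (ε s)),
    mul (τ r x) (τ s y) = ∑ t, ∑ q, c r s t q • τ t (Λ.m (ε r) (ε s) (ε t) q (x ⊗ₜ[K] y))

end GTable

/-! ### The partial labeling of `Rep(GL(n))` and the two tables -/

section GLTable

variable (K : Type u) [Field K] (n : ℕ)

/-- The space `𝔰𝔩(n, K)` of traceless matrices. -/
abbrev slSub : Submodule K (Matrix (Fin n) (Fin n) K) :=
  LinearMap.ker (Matrix.traceLinearMap (Fin n) K K)

/-- The space `𝔰𝔩(n, K)` of traceless matrices, as a type. -/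
abbrev Sl : Type u := slSub K n

variable {K n}

theorem trace_conj (g : GL (Fin n) K) (X : Matrix (Fin n) (Fin n) K) :
    ((g : Matrix (Fin n) (Fin n) K) * X * (↑g⁻¹ : Matrix (Fin n) (Fin n) K)).trace = X.trace := by
  rw [Matrix.trace_mul_comm, ← mul_assoc, Units.inv_mul, one_mul]

theorem conj_mul (g : GL (Fin n) K) (X Y : Matrix (Fin n) (Fin n) K) :
    (g : Matrix (Fin n) (Fin n) K) * (X * Y) * (↑g⁻¹ : Matrix (Fin n) (Fin n) K) =
      ((g : Matrix (Fin n) (Fin n) K) * X * (↑g⁻¹ : Matrix (Fin n) (Fin n) K)) *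
        ((g : Matrix (Fin n) (Fin n) K) * Y * (↑g⁻¹ : Matrix (Fin n) (Fin n) K)) := by
  have h : (↑g⁻¹ : Matrix (Fin n) (Fin n) K) * (g : Matrix (Fin n) (Fin n) K) = 1 :=
    Units.inv_mul g
  calc _ = (g : Matrix (Fin n) (Fin n) K) * X * 1 * Y * (↑g⁻¹ : Matrix (Fin n) (Fin n) K) := by
        noncomm_ring
    _ = _ := by rw [← h]; noncomm_ring

theorem mem_sl {X : Matrix (Fin n) (Fin n) K} :
    X ∈ slSub K n ↔ X.trace = 0 := Iff.rfl

/-- `[A, B]`, for traceless `A` and `B`. -/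
def slComm (A B : Sl K n) : Sl K n := ⟨A.1 * B.1 - B.1 * A.1, by
  rw [mem_sl, Matrix.trace_sub, Matrix.trace_mul_comm, sub_self]⟩

/-- `A B + B A - (2/n) tr(A B) I_n`, for traceless `A` and `B` and `n ≠ 0` in `K`. -/
def slAnti [CharZero K] (A B : Sl K n) : Sl K n :=
  ⟨A.1 * B.1 + B.1 * A.1 - (2 / (n : K) * (A.1 * B.1).trace) • 1, by
    rw [mem_sl, Matrix.trace_sub, Matrix.trace_add, Matrix.trace_mul_comm B.1 A.1,
      Matrix.trace_smul, Matrix.trace_one, Fintype.card_fin, smul_eq_mul]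
    rcases Nat.eq_zero_or_pos n with rfl | h
    · simp [Matrix.trace]
    · have : (n : K) ≠ 0 := by exact_mod_cast h.ne'
      field_simp
      ring⟩

variable (K n)

/-- `GL(n)` acting on matrices by conjugation. -/
def conjRep : Representation K (GL (Fin n) K) (Matrix (Fin n) (Fin n) K) where
  toFun g := LinearMap.mulRight K (↑g⁻¹ : Matrix (Fin n) (Fin n) K) ∘ₗ
    LinearMap.mulLeft K (g : Matrix (Fin n) (Fin n) K)
  map_one' := by ext1 X; simp
  map_mul' g h := by ext1 X; simp [mul_assoc]

/-- The adjoint representation of `GL(n)` on traceless matrices. -/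
def adRep : Representation K (GL (Fin n) K) (Sl K n) where
  toFun g := (conjRep K n g).restrict (p := slSub K n) (q := slSub K n)
    (fun X hX => (trace_conj g X).trans hX)
  map_one' := by
    ext1 X
    exact Subtype.ext (congrArg (fun f => f X.1) (map_one (conjRep K n)))
  map_mul' g h := by
    ext1 X
    exact Subtype.ext (congrArg (fun f => f X.1) (map_mul (conjRep K n) g h))

/-- `GL(n)` acting on both factors of `𝔤𝔩(n) ⋉ 𝔤𝔩(n)_ab` by conjugation. -/
def semiRep : Representation K (GL (Fin n) K) (GlSemi K n) where
  toFun g :=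
    { toFun := fun x => pair (conjRep K n g (comp₀ x)) (conjRep K n g (comp₁ x))
      map_add' := fun x y => by
        have h0 : comp₀ (x + y) = comp₀ x + comp₀ y := rfl
        have h1 : comp₁ (x + y) = comp₁ x + comp₁ y := rfl
        rw [h0, h1, map_add, map_add]; rfl
      map_smul' := fun c x => by
        have h0 : comp₀ (c • x) = c • comp₀ x := rfl
        have h1 : comp₁ (c • x) = c • comp₁ x := rfl
        rw [h0, h1, map_smul, map_smul]; rfl }
  map_one' := by
    ext1 x
    change pair (conjRep K n 1 (comp₀ x)) (conjRep K n 1 (comp₁ x)) = x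
    rw [map_one]; rfl
  map_mul' g h := by
    ext1 x
    change pair (conjRep K n (g * h) (comp₀ x)) (conjRep K n (g * h) (comp₁ x)) = _
    rw [map_mul]; rfl

/-- The two labels: the trivial and the adjoint representation. -/
inductive GLIrr : Type
  | triv
  | ad

/-- The two underlying spaces, `K` and `𝔰𝔩(n)`. -/
def glV : GLIrr → Type u
  | .triv => K
  | .ad => Sl K n

instance (i : GLIrr) : AddCommGroup (glV K n i) :=
  match i with
  | .triv => inferInstanceAs (AddCommGroup K)
  | .ad => inferInstanceAs (AddCommGroup (Sl K n))

instance (i : GLIrr) : Module K (glV K n i) :=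
  match i with
  | .triv => inferInstanceAs (Module K K)
  | .ad => inferInstanceAs (Module K (Sl K n))

/-- The two representations. -/
def glRho : ∀ i : GLIrr, Representation K (GL (Fin n) K) (glV K n i)
  | .triv => Representation.trivial K (GL (Fin n) K) K
  | .ad => adRep K n

/-- The number of basis morphisms `V i ⊗ V j → V k`. -/
def glD : GLIrr → GLIrr → GLIrr → ℕ
  | .triv, .triv, .triv => 1
  | .triv, .ad, .ad => 1
  | .ad, .triv, .ad => 1
  | .ad, .ad, .triv => 1
  | .ad, .ad, .ad => if n = 2 then 1 else 2
  | _, _, _ => 0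

/-- A morphism `V ⊗ W → U` of representations from an equivariant bilinear map. -/
def mkMor {G : Type v} [Group G] {V W U : Type u} [AddCommGroup V] [Module K V]
    [AddCommGroup W] [Module K W] [AddCommGroup U] [Module K U]
    (ρ : Representation K G V) (σ : Representation K G W) (π : Representation K G U)
    (f : V →ₗ[K] W →ₗ[K] U) (hf : ∀ g x y, f (ρ g x) (σ g y) = π g (f x y)) :
    Representation.IntertwiningMap (ρ.tprod σ) π where
  toLinearMap := TensorProduct.lift f
  isIntertwining' g := TensorProduct.ext' fun x y => by
    simpa using hf g x y

/-- `m^{0,0,0}(x ⊗ y) = x y`. -/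
def mTTT : Representation.IntertwiningMap
    ((Representation.trivial K (GL (Fin n) K) K).tprod (Representation.trivial K (GL (Fin n) K) K))
    (Representation.trivial K (GL (Fin n) K) K) :=
  mkMor K _ _ _ (LinearMap.mul K K) (fun _ _ _ => rfl)

/-- `m^{0,Ad,Ad}(x ⊗ A) = x A`. -/
def mTAA : Representation.IntertwiningMap
    ((Representation.trivial K (GL (Fin n) K) K).tprod (adRep K n)) (adRep K n) :=
  mkMor K _ _ _ (LinearMap.lsmul K (Sl K n)) (fun g x A => ((adRep K n g).map_smul x A).symm)

/-- `m^{Ad,0,Ad}(A ⊗ x) = x A`. -/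
def mATA : Representation.IntertwiningMap
    ((adRep K n).tprod (Representation.trivial K (GL (Fin n) K) K)) (adRep K n) :=
  mkMor K _ _ _ (LinearMap.lsmul K (Sl K n)).flip
    (fun g A x => ((adRep K n g).map_smul x A).symm)

/-- `m^{Ad,Ad,0}(A ⊗ B) = tr(A B)`. -/
def mAAT : Representation.IntertwiningMap
    ((adRep K n).tprod (adRep K n)) (Representation.trivial K (GL (Fin n) K) K) :=
  mkMor K _ _ _
    (LinearMap.mk₂ K (fun A B : Sl K n => (A.1 * B.1).trace)
      (fun A A' B => by simp [add_mul, Matrix.trace_add])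
      (fun c A B => by simp [Matrix.trace_smul])
      (fun A B B' => by simp [mul_add, Matrix.trace_add])
      (fun c A B => by simp [Matrix.trace_smul]))
    (fun g A B => (congrArg Matrix.trace (conj_mul g A.1 B.1).symm).trans
      (trace_conj g (A.1 * B.1)))

/-- `m₁^{Ad,Ad,Ad}(A ⊗ B) = [A, B]`. -/
def mAAA₁ : Representation.IntertwiningMap
    ((adRep K n).tprod (adRep K n)) (adRep K n) :=
  mkMor K _ _ _
    (LinearMap.mk₂ K slComm
      (fun A A' B => Subtype.ext (by simp [slComm]; noncomm_ring))
      (fun c A B => Subtype.ext (by simp [slComm, smul_sub]))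
      (fun A B B' => Subtype.ext (by simp [slComm]; noncomm_ring))
      (fun c A B => Subtype.ext (by simp [slComm, smul_sub])))
    (fun g A B => Subtype.ext (by
      change (g : Matrix (Fin n) (Fin n) K) * A.1 * (↑g⁻¹ : Matrix (Fin n) (Fin n) K) *
          ((g : Matrix (Fin n) (Fin n) K) * B.1 * (↑g⁻¹ : Matrix (Fin n) (Fin n) K)) -
          (g : Matrix (Fin n) (Fin n) K) * B.1 * (↑g⁻¹ : Matrix (Fin n) (Fin n) K) *
          ((g : Matrix (Fin n) (Fin n) K) * A.1 * (↑g⁻¹ : Matrix (Fin n) (Fin n) K)) =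
        (g : Matrix (Fin n) (Fin n) K) * (A.1 * B.1 - B.1 * A.1) *
          (↑g⁻¹ : Matrix (Fin n) (Fin n) K)
      rw [← conj_mul, ← conj_mul, mul_sub, sub_mul]))

/-- `m₂^{Ad,Ad,Ad}(A ⊗ B) = A B + B A - (2/n) tr(A B) I_n`. -/
def mAAA₂ [CharZero K] : Representation.IntertwiningMap
    ((adRep K n).tprod (adRep K n)) (adRep K n) :=
  mkMor K _ _ _
    (LinearMap.mk₂ K slAnti
      (fun A A' B => Subtype.ext (by
        simp only [slAnti, Submodule.coe_add, add_mul, mul_add, Matrix.trace_add, add_smul]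
        abel))
      (fun c A B => Subtype.ext (by
        simp only [slAnti, Submodule.coe_smul, Matrix.smul_mul, Matrix.mul_smul,
          Matrix.trace_smul, smul_eq_mul]
        module))
      (fun A B B' => Subtype.ext (by
        simp only [slAnti, Submodule.coe_add, add_mul, mul_add, Matrix.trace_add, add_smul]
        abel))
      (fun c A B => Subtype.ext (by
        simp only [slAnti, Submodule.coe_smul, Matrix.smul_mul, Matrix.mul_smul,
          Matrix.trace_smul, smul_eq_mul]
        module)))
    (fun g A B => Subtype.ext (by
      change (g : Matrix (Fin n) (Fin n) K) * A.1 * (↑g⁻¹ : Matrix (Fin n) (Fin n) K) *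
          ((g : Matrix (Fin n) (Fin n) K) * B.1 * (↑g⁻¹ : Matrix (Fin n) (Fin n) K)) +
          (g : Matrix (Fin n) (Fin n) K) * B.1 * (↑g⁻¹ : Matrix (Fin n) (Fin n) K) *
          ((g : Matrix (Fin n) (Fin n) K) * A.1 * (↑g⁻¹ : Matrix (Fin n) (Fin n) K)) -
          (2 / (n : K) * ((g : Matrix (Fin n) (Fin n) K) * A.1 *
            (↑g⁻¹ : Matrix (Fin n) (Fin n) K) *
          ((g : Matrix (Fin n) (Fin n) K) * B.1 *
            (↑g⁻¹ : Matrix (Fin n) (Fin n) K))).trace) • 1 =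
        (g : Matrix (Fin n) (Fin n) K) *
          (A.1 * B.1 + B.1 * A.1 - (2 / (n : K) * (A.1 * B.1).trace) • 1) *
          (↑g⁻¹ : Matrix (Fin n) (Fin n) K)
      have h : (g : Matrix (Fin n) (Fin n) K) * (↑g⁻¹ : Matrix (Fin n) (Fin n) K) = 1 :=
        Units.mul_inv g
      rw [← conj_mul, ← conj_mul, trace_conj, mul_sub, sub_mul, mul_add, add_mul,
        Matrix.mul_smul, Matrix.smul_mul, mul_one, h]))

/-- The chosen basis morphisms; on `Ad ⊗ Ad → Ad` the first is `m₁`, the second (for `n ≠ 2`)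
is `m₂`. -/
def glM [CharZero K] : ∀ i j k : GLIrr, Fin (glD n i j k) →
    Representation.IntertwiningMap ((glRho K n i).tprod (glRho K n j)) (glRho K n k)
  | .triv, .triv, .triv, _ => mTTT K n
  | .triv, .ad, .ad, _ => mTAA K n
  | .ad, .triv, .ad, _ => mATA K n
  | .ad, .ad, .triv, _ => mAAT K n
  | .ad, .ad, .ad, q => if q.val = 0 then mAAA₁ K n else mAAA₂ K n
  | .triv, .triv, .ad, q => q.elim0
  | .triv, .ad, .triv, q => q.elim0
  | .ad, .triv, .triv, q => q.elim0

/-- The partial labeling of `Rep(GL(n))` by the trivial and the adjoint representation. -/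
def glLabeling [CharZero K] : RepLabeling K (GL (Fin n) K) where
  I := GLIrr
  V := glV K n
  ρ := glRho K n
  d := glD n
  m := glM K n

/-- The four summands `(I_n)₀`, `𝔰𝔩(n)₀`, `𝔰𝔩(n)_ab`, `(I_n)_ab` of `𝔤𝔩(n) ⋉ 𝔤𝔩(n)_ab`. -/
inductive Piece : Type
  | I0
  | sl0
  | slAb
  | IAb
  deriving DecidableEq

instance : Fintype Piece where
  elems := {.I0, .sl0, .slAb, .IAb}
  complete r := by cases r <;> decide

/-- The isomorphism class of each summand. -/
def pieceType : Piece → GLIrr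
  | .I0 => .triv
  | .sl0 => .ad
  | .slAb => .ad
  | .IAb => .triv

theorem conj_smul_one (g : GL (Fin n) K) (c : K) :
    conjRep K n g (c • (1 : Matrix (Fin n) (Fin n) K)) = c • 1 := by
  change (g : Matrix (Fin n) (Fin n) K) * (c • (1 : Matrix (Fin n) (Fin n) K)) *
    (↑g⁻¹ : Matrix (Fin n) (Fin n) K) = _
  have h : (g : Matrix (Fin n) (Fin n) K) * (↑g⁻¹ : Matrix (Fin n) (Fin n) K) = 1 :=
    Units.mul_inv g
  rw [Matrix.mul_smul, Matrix.smul_mul, mul_one, h]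

/-- `x ↦ (x I_n, 0)`. -/
def embI0 : K →ₗ[K] GlSemi K n where
  toFun x := pair (x • 1) 0
  map_add' x y := by rw [add_smul, ← pair_add, add_zero]
  map_smul' c x := by rw [RingHom.id_apply, ← pair_smul, smul_zero, smul_eq_mul, mul_smul]

/-- `A ↦ (A, 0)`. -/
def embSl0 : Sl K n →ₗ[K] GlSemi K n where
  toFun A := pair A.1 0
  map_add' A B := by rw [Submodule.coe_add, ← pair_add, add_zero]
  map_smul' c A := by rw [RingHom.id_apply, ← pair_smul, smul_zero, Submodule.coe_smul]

/-- `A ↦ (0, A)`. -/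
def embSlAb : Sl K n →ₗ[K] GlSemi K n where
  toFun A := pair 0 A.1
  map_add' A B := by rw [Submodule.coe_add, ← pair_add, add_zero]
  map_smul' c A := by rw [RingHom.id_apply, ← pair_smul, smul_zero, Submodule.coe_smul]

/-- `x ↦ (0, x I_n)`. -/
def embIAb : K →ₗ[K] GlSemi K n where
  toFun x := pair 0 (x • 1)
  map_add' x y := by rw [add_smul, ← pair_add, add_zero]
  map_smul' c x := by rw [RingHom.id_apply, ← pair_smul, smul_zero, smul_eq_mul, mul_smul]

/-- The morphisms onto the summands: `x ↦ (x I_n, 0)`, `A ↦ (A, 0)`, `A ↦ (0, A)`,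
`x ↦ (0, x I_n)`. -/
def pieceMap : ∀ r : Piece,
    Representation.IntertwiningMap (glRho K n (pieceType r)) (semiRep K n)
  | .I0 => ⟨embI0 K n, fun g => LinearMap.ext fun x : K => by
      change pair (x • 1) 0 = pair (conjRep K n g (x • 1)) (conjRep K n g 0)
      rw [conj_smul_one, map_zero]⟩
  | .sl0 => ⟨embSl0 K n, fun g => LinearMap.ext fun A : Sl K n => by
      change pair (conjRep K n g A.1) 0 = pair (conjRep K n g A.1) (conjRep K n g 0)
      rw [map_zero]⟩
  | .slAb => ⟨embSlAb K n, fun g => LinearMap.ext fun A : Sl K n => by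
      change pair 0 (conjRep K n g A.1) = pair (conjRep K n g 0) (conjRep K n g A.1)
      rw [map_zero]⟩
  | .IAb => ⟨embIAb K n, fun g => LinearMap.ext fun x : K => by
      change pair 0 (x • 1) = pair (conjRep K n g 0) (conjRep K n g (x • 1))
      rw [conj_smul_one, map_zero]⟩

/-- The coefficients of the table of the commutative product (row, column, summand of the entry,
index of the basis morphism). The index `1` on `Ad ⊗ Ad → Ad` stands for `m₂`. -/
def mulTable : ∀ r s t : Piece,
    Fin (glD n (pieceType r) (pieceType s) (pieceType t)) → K
  | .I0, .I0, .I0, _ => 1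
  | .I0, .sl0, .sl0, _ => 1
  | .I0, .slAb, .slAb, _ => 1
  | .I0, .IAb, .IAb, _ => 1
  | .sl0, .I0, .sl0, _ => 1
  | .sl0, .sl0, .slAb, q => if q.val = 1 then 1 else 0
  | .sl0, .slAb, .IAb, _ => 1
  | .slAb, .I0, .slAb, _ => 1
  | .slAb, .sl0, .IAb, _ => 1
  | .IAb, .I0, .IAb, _ => 1
  | _, _, _, _ => 0

/-- The coefficients of the table of the Lie bracket. The index `0` on `Ad ⊗ Ad → Ad` stands for
`m₁`. -/
def brTable : ∀ r s t : Piece,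
    Fin (glD n (pieceType r) (pieceType s) (pieceType t)) → K
  | .sl0, .sl0, .sl0, q => if q.val = 0 then 1 else 0
  | .sl0, .slAb, .slAb, q => if q.val = 0 then 1 else 0
  | .slAb, .sl0, .slAb, q => if q.val = 0 then 1 else 0
  | _, _, _, _ => 0

end GLTable

/-! ### The even cohomology of a Lie algebra with coefficients in its exterior algebra -/

section Cohomology

variable (K : Type u) [Field K] (𝔤 : Type v) [LieRing 𝔤] [LieAlgebra K 𝔤]

/-- `C = ⨁_{p,q} ⋀^p 𝔤* ⊗ ⋀^q 𝔤`. Its multiplication is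
`(φ ⊗ v) ∨ (ψ ⊗ w) = (-1)^(q₁ p₂) (φ ∧ ψ) ⊗ (v ∧ w)`, for `v ∈ ⋀^q₁ 𝔤` and `ψ ∈ ⋀^p₂ 𝔤*`. -/
abbrev Cochain : Type (max u v) :=
  GradedTensorProduct K (fun p : ℕ => ⋀[K]^p (Module.Dual K 𝔤)) (fun q : ℕ => ⋀[K]^q 𝔤)

/-- The product `∨` as a bilinear map. -/
def cup : Cochain K 𝔤 →ₗ[K] Cochain K 𝔤 →ₗ[K] Cochain K 𝔤 := LinearMap.mul K (Cochain K 𝔤)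

/-- The subspace `C^{p,q} = ⋀^p 𝔤* ⊗ ⋀^q 𝔤` of `C`. -/
def cochainDeg (p q : ℕ) : Submodule K (Cochain K 𝔤) :=
  Submodule.span K {x | ∃ φ ∈ ⋀[K]^p (Module.Dual K 𝔤), ∃ v ∈ ⋀[K]^q 𝔤, x = φ ᵍ⊗ₜ[K] v}

/-- The sum of all `C^{p,q}` with `p + q` even. -/
def evenCochain : Submodule K (Cochain K 𝔤) :=
  ⨆ (p : ℕ) (q : ℕ) (_ : Even (p + q)), cochainDeg K 𝔤 p q

variable {K 𝔤}

/-- `f ⊗ g` acting on `C`, without signs. -/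
def cochainMap
    (f : ExteriorAlgebra K (Module.Dual K 𝔤) →ₗ[K] ExteriorAlgebra K (Module.Dual K 𝔤))
    (g : ExteriorAlgebra K 𝔤 →ₗ[K] ExteriorAlgebra K 𝔤) : Cochain K 𝔤 →ₗ[K] Cochain K 𝔤 :=
  (GradedTensorProduct.of K (fun p : ℕ => ⋀[K]^p (Module.Dual K 𝔤))
      (fun q : ℕ => ⋀[K]^q 𝔤)).toLinearMap ∘ₗ TensorProduct.map f g ∘ₗ
    (GradedTensorProduct.of K (fun p : ℕ => ⋀[K]^p (Module.Dual K 𝔤))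
      (fun q : ℕ => ⋀[K]^q 𝔤)).symm.toLinearMap

/-- The interior product `{v, -}` with `v ∈ 𝔤`: the odd derivation of `C` that sends `ψ ∈ 𝔤*` to
`ψ v` and kills `𝔤`. -/
def contractVec (v : 𝔤) : Cochain K 𝔤 →ₗ[K] Cochain K 𝔤 :=
  cochainMap (CliffordAlgebra.contractLeft (Module.Dual.eval K 𝔤 v)) LinearMap.id

/-- The interior product `{φ, -}` with `φ ∈ 𝔤*`: the odd derivation of `C` that sends `w ∈ 𝔤` to
`φ w` and kills `𝔤*`. -/
def contractForm (φ : Module.Dual K 𝔤) : Cochain K 𝔤 →ₗ[K] Cochain K 𝔤 :=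
  cochainMap CliffordAlgebra.involute.toLinearMap (CliffordAlgebra.contractLeft φ)

/-- The interior product with `φ ∈ 𝔤*` from the right (factors of `𝔤` are removed after moving
them to the far right). -/
def contractFormRight (φ : Module.Dual K 𝔤) : Cochain K 𝔤 →ₗ[K] Cochain K 𝔤 :=
  cochainMap LinearMap.id (CliffordAlgebra.contractRight.flip φ)

/-- The interior product with `v ∈ 𝔤` from the right (factors of `𝔤*` are removed after moving
them to the far right). -/
def contractVecRight (v : 𝔤) : Cochain K 𝔤 →ₗ[K] Cochain K 𝔤 :=
  cochainMap (CliffordAlgebra.contractRight.flip (Module.Dual.eval K 𝔤 v))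
    CliffordAlgebra.involute.toLinearMap

variable {m : ℕ} (e : Module.Basis (Fin m) K 𝔤)

/-- The bracket `{-,-} : C^{p₁,q₁} × C^{p₂,q₂} → C^{p₁+p₂-1,q₁+q₂-1}`, written in a basis `e` of `𝔤`
(it does not depend on the basis). It is the bilinear map determined by `{𝔤, 𝔤} = {𝔤*, 𝔤*} = 0`,
`{φ, v} = {v, φ} = φ v`, `{a, b} = -(-1)^(|a||b|) {b, a}` and
`{a ∨ b, c} = a ∨ {b, c} + (-1)^(|a||b|) b ∨ {a, c}`, where `|a| = p + q` on `C^{p,q}`. Iterating the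
last rule, a product `u₁ ∨ ⋯ ∨ u_k` of elements of `𝔤` and `𝔤*` has
`{u₁ ∨ ⋯ ∨ u_k, b} = ∑_i (-1)^(k-i) (u₁ ∨ ⋯ û_i ⋯ ∨ u_k) ∨ {u_i, b}`. -/
def bigBracket : Cochain K 𝔤 →ₗ[K] Cochain K 𝔤 →ₗ[K] Cochain K 𝔤 :=
  ∑ i, ((cup K 𝔤).compl₁₂ (contractFormRight (e.coord i)) (contractVec (e i)) +
    (cup K 𝔤).compl₁₂ (contractVecRight (e i)) (contractForm (e.coord i)))

/-- The Lie bracket of `𝔤` as an element `μ = ∑_{i<j} (eⁱ ∧ eʲ) ⊗ [e_i, e_j]` of `C^{2,1}`. -/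
def lieElement : Cochain K 𝔤 :=
  ∑ i, ∑ j ∈ Finset.Ioi i,
    (ExteriorAlgebra.ι K (e.coord i) * ExteriorAlgebra.ι K (e.coord j)) ᵍ⊗ₜ[K]
      ExteriorAlgebra.ι K ⁅e i, e j⁆

/-- The Chevalley-Eilenberg differential `d = {μ, -} : C^{p,q} → C^{p+1,q}`. -/
def ceDiff : Cochain K 𝔤 →ₗ[K] Cochain K 𝔤 := bigBracket e (lieElement e)

/-- The cocycles of even total degree. -/
def evenCocycles : Submodule K (Cochain K 𝔤) := LinearMap.ker (ceDiff e) ⊓ evenCochain K 𝔤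

/-- The even cohomology `H_E(𝔤) = ⨁_{p+q even} H^p(𝔤, ⋀^q 𝔤)`: even cocycles modulo coboundaries.
Since `d` has bidegree `(1, 0)`, this quotient is the direct sum of its bihomogeneous parts. -/
abbrev EvenCohomology : Type (max u v) :=
  (evenCocycles e) ⧸ (LinearMap.range (ceDiff e)).comap (evenCocycles e).subtype

/-- The class of an even cocycle. -/
abbrev cohomClass (a : evenCocycles e) : EvenCohomology e := Submodule.Quotient.mk a

/-- The operation `opH` on `H_E(𝔤)` is the one inherited from the operation `op` on cochains: even
cocycles are closed under `op`, and `opH [a] [b] = [op a b]`. Such an `opH` is unique. -/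
def IsInherited (op : Cochain K 𝔤 →ₗ[K] Cochain K 𝔤 →ₗ[K] Cochain K 𝔤)
    (opH : EvenCohomology e →ₗ[K] EvenCohomology e →ₗ[K] EvenCohomology e) : Prop :=
  ∀ a b : evenCocycles e, ∃ c : evenCocycles e,
    (c : Cochain K 𝔤) = op a b ∧ opH (cohomClass e a) (cohomClass e b) = cohomClass e c

end Cohomology

end GTables

end

/-! Give $(I_n)_0,\mathfrak{sl}_0,\mathfrak{sl}_{ab},(I_n)_{ab}$ the degrees 0, 1, 2, 3. The product
then preserves degree, the bracket lowers it by 1, and in this form both are built from matrix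
products and traces of traceless matrices. Associativity comes down to the total symmetry of
$\operatorname{tr}((AB+BA)C)$, and the Leibniz rule to the fact that commutators derive matrix
products and have trace zero (`glMul_assoc`, `glMul_leibniz`). The tables are the same computation,
done summand by summand.

For the labeling, a morphism $V_i\otimes V_j\to V_k$ becomes an invariant multilinear form on all
matrices: project onto traceless matrices and pair values in $\mathfrak{sl}(n)$ with a further
matrix by the trace form. An invariant $k$-linear form with $k\le n$ is determined by its $k!$
values on the tuples $(E_{f(i),f(\sigma i)})_i$ for one injective $f$
(`multilinear_eq_zero_of_perm`). Transvections and permutations reduce any row indices to $f$, and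
diagonal matrices kill all column indices except permutations of $f$. The trace monomials, one for
each permutation, are dual to these values, so they span. This leaves only bilinear maps
$\mathfrak{sl}(2)\times\mathfrak{sl}(2)\to\mathfrak{sl}(2)$, where $k=3>n$; they are found from
weights on $E,F,H$. Transvections also give the irreducibility of $\mathfrak{sl}(n)$.

For the Heisenberg algebra, $C$ is a Grassmann algebra on the six generators $x^*,y^*,z^*,x,y,z$,
and $\mu$ is a cubic monomial. The even cohomology has dimensions 1, 8, 8, 1 in total degrees 0, 2,
4, 6, twice the degrees above. Explicit linear maps `lift` from the matrix algebra to even cocycles,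
`proj` back, and a homotopy `hom` satisfy $\mathrm{proj}\,d=0$, $d\,\mathrm{lift}=0$,
$\mathrm{proj}\,\mathrm{lift}=1$ and, on even cochains,
$1=\mathrm{lift}\,\mathrm{proj}+d\,\mathrm{hom}+\mathrm{hom}\,d$. Hence `proj` induces a linear
isomorphism on cohomology. Since $d$ derives both $\vee$ and the bracket (`d_mul`, `d_br`), the
operations on classes are known once they are known on lifts. All identities of this kind are
checked on the 64 monomials or on the 18 matrix units, by integer arithmetic on binary trees with
denominators cleared. -/

noncomputable section

namespace GTables

/-! ### The Poisson structure on the semidirect product -/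

section GlPoisson

variable {K : Type u} [Field K] {n : ℕ}

theorem pair_comp (x : GlSemi K n) : pair (comp₀ x) (comp₁ x) = x := rfl

theorem glSemi_ext {x y : GlSemi K n} (h₀ : comp₀ x = comp₀ y) (h₁ : comp₁ x = comp₁ y) : x = y := by
  rw [← pair_comp x, ← pair_comp y, h₀, h₁]

theorem lie_pair (X₀ X₁ Y₀ Y₁ : Matrix (Fin n) (Fin n) K) :
    ⁅pair X₀ X₁, pair Y₀ Y₁⁆ =
      pair (X₀ * Y₀ - Y₀ * X₀) ((X₀ * Y₁ - Y₁ * X₀) - (Y₀ * X₁ - X₁ * Y₀)) := by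
  refine glSemi_ext rfl ?_
  change (0 + (X₀ * Y₁ - Y₁ * X₀)) - (Y₀ * X₁ - X₁ * Y₀) = _
  rw [zero_add]
  rfl

theorem glMul_apply (x y : GlSemi K n) : glMul K n x y = glMulFun x y := rfl

theorem scalarPart_decomp [CharZero K] (hn : n ≠ 0) (a : K) {A : Matrix (Fin n) (Fin n) K}
    (hA : A.trace = 0) : scalarPart (a • 1 + A) = a := by
  have : (n : K) ≠ 0 := by exact_mod_cast hn
  simp [scalarPart, Matrix.trace_add, Matrix.trace_smul, hA, this]

theorem slPart_decomp [CharZero K] (hn : n ≠ 0) (a : K) {A : Matrix (Fin n) (Fin n) K}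
    (hA : A.trace = 0) : slPart (a • 1 + A) = A := by
  simp [slPart, scalarPart_decomp hn a hA]

theorem decomp (X : Matrix (Fin n) (Fin n) K) : scalarPart X • 1 + slPart X = X := by
  simp [slPart]

theorem trace_slPart [CharZero K] (X : Matrix (Fin n) (Fin n) K) : (slPart X).trace = 0 := by
  rcases eq_or_ne n 0 with rfl | hn
  · simp [Matrix.trace]
  · have : (n : K) ≠ 0 := by exact_mod_cast hn
    simp [slPart, scalarPart, Matrix.trace_sub, Matrix.trace_smul, this]

instance subsingleton_glSemi_zero : Subsingleton (GlSemi K 0) :=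
  ⟨fun _ _ => glSemi_ext (Subsingleton.elim _ _) (Subsingleton.elim _ _)⟩

theorem glMul_pair [CharZero K] (a₀ a₁ b₀ b₁ : K) (A₀ A₁ B₀ B₁ : Matrix (Fin n) (Fin n) K)
    (hA₀ : A₀.trace = 0) (hA₁ : A₁.trace = 0) (hB₀ : B₀.trace = 0) (hB₁ : B₁.trace = 0) :
    glMul K n (pair (a₀ • 1 + A₀) (a₁ • 1 + A₁)) (pair (b₀ • 1 + B₀) (b₁ • 1 + B₁)) =
      pair ((a₀ * b₀) • 1 + a₀ • B₀ + b₀ • A₀)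
        ((a₀ * b₁ + a₁ * b₀ + (A₀ * B₁ + A₁ * B₀).trace - 2 / (n : K) * (A₀ * B₀).trace) • 1
          + a₀ • B₁ + b₀ • A₁ + A₀ * B₀ + B₀ * A₀) := by
  -- For $n=0$ the scalar part is not determined by the matrix, but the whole algebra is zero.
  rcases eq_or_ne n 0 with rfl | hn
  · exact Subsingleton.elim _ _
  · change glMulFun _ _ = _
    have h₀ (X Y : Matrix (Fin n) (Fin n) K) : comp₀ (pair X Y) = X := rfl
    have h₁ (X Y : Matrix (Fin n) (Fin n) K) : comp₁ (pair X Y) = Y := rfl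
    simp only [glMulFun, h₀, h₁, scalarPart_decomp hn _ hA₀, scalarPart_decomp hn _ hA₁,
      scalarPart_decomp hn _ hB₀, scalarPart_decomp hn _ hB₁, slPart_decomp hn _ hA₀,
      slPart_decomp hn _ hA₁, slPart_decomp hn _ hB₀, slPart_decomp hn _ hB₁, prodFormula]

theorem exists_decomp [CharZero K] (x : GlSemi K n) : ∃ (a₀ a₁ : K) (A₀ A₁ : Matrix (Fin n) (Fin n) K),
    A₀.trace = 0 ∧ A₁.trace = 0 ∧ x = pair (a₀ • 1 + A₀) (a₁ • 1 + A₁) :=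
  ⟨scalarPart (comp₀ x), scalarPart (comp₁ x), slPart (comp₀ x), slPart (comp₁ x),
    trace_slPart _, trace_slPart _, by rw [decomp, decomp, pair_comp]⟩

/-- The product written as a sum of a scalar and a traceless matrix in both factors. -/
theorem glMul_pair_decomp [CharZero K] (a₀ a₁ b₀ b₁ : K) (A₀ A₁ B₀ B₁ : Matrix (Fin n) (Fin n) K)
    (hA₀ : A₀.trace = 0) (hA₁ : A₁.trace = 0) (hB₀ : B₀.trace = 0) (hB₁ : B₁.trace = 0) :
    glMul K n (pair (a₀ • 1 + A₀) (a₁ • 1 + A₁)) (pair (b₀ • 1 + B₀) (b₁ • 1 + B₁)) =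
      pair ((a₀ * b₀) • 1 + (a₀ • B₀ + b₀ • A₀))
        ((a₀ * b₁ + a₁ * b₀ + ((A₀ * B₁).trace + (A₁ * B₀).trace)) • 1
          + (a₀ • B₁ + b₀ • A₁ + (A₀ * B₀ + B₀ * A₀ - (2 / (n : K) * (A₀ * B₀).trace) • 1))) := by
  rw [glMul_pair _ _ _ _ _ _ _ _ hA₀ hA₁ hB₀ hB₁, Matrix.trace_add]
  congr 1 <;> module

theorem trace_anti [CharZero K] (A B : Matrix (Fin n) (Fin n) K) :
    (A * B + B * A - (2 / (n : K) * (A * B).trace) • 1).trace = 0 := by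
  rw [Matrix.trace_sub, Matrix.trace_add, Matrix.trace_mul_comm B A, Matrix.trace_smul,
    Matrix.trace_one, Fintype.card_fin, smul_eq_mul]
  rcases eq_or_ne n 0 with rfl | hn
  · simp [Matrix.trace]
  · have : (n : K) ≠ 0 := by exact_mod_cast hn
    field_simp
    ring

theorem glMul_comm [CharZero K] (x y : GlSemi K n) : glMul K n x y = glMul K n y x := by
  obtain ⟨a₀, a₁, A₀, A₁, hA₀, hA₁, rfl⟩ := exists_decomp x
  obtain ⟨b₀, b₁, B₀, B₁, hB₀, hB₁, rfl⟩ := exists_decomp y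
  rw [glMul_pair_decomp _ _ _ _ _ _ _ _ hA₀ hA₁ hB₀ hB₁,
    glMul_pair_decomp _ _ _ _ _ _ _ _ hB₀ hB₁ hA₀ hA₁, Matrix.trace_mul_comm B₀ A₁,
    Matrix.trace_mul_comm B₁ A₀, Matrix.trace_mul_comm B₀ A₀]
  congr 1 <;> module

/-- The only contribution that is not formal is the trace of three traceless matrices: both
bracketings give $\operatorname{tr}(A_0B_0C_0)+\operatorname{tr}(A_0C_0B_0)$, by cyclicity. The
correction $\tfrac2n\operatorname{tr}(AB)I$ does not contribute there, being paired with a traceless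
matrix. -/
theorem glMul_assoc [CharZero K] (x y z : GlSemi K n) :
    glMul K n (glMul K n x y) z = glMul K n x (glMul K n y z) := by
  obtain ⟨a₀, a₁, A₀, A₁, hA₀, hA₁, rfl⟩ := exists_decomp x
  obtain ⟨b₀, b₁, B₀, B₁, hB₀, hB₁, rfl⟩ := exists_decomp y
  obtain ⟨c₀, c₁, C₀, C₁, hC₀, hC₁, rfl⟩ := exists_decomp z
  have h₁ := trace_anti A₀ B₀
  have h₂ := trace_anti B₀ C₀
  rw [glMul_pair_decomp _ _ _ _ _ _ _ _ hA₀ hA₁ hB₀ hB₁,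
    glMul_pair_decomp _ _ _ _ _ _ _ _ hB₀ hB₁ hC₀ hC₁,
    glMul_pair_decomp _ _ _ _ _ _ _ _ (by simp [Matrix.trace_smul, hA₀, hB₀])
      (by rw [Matrix.trace_add, h₁]; simp [Matrix.trace_smul, hA₁, hB₁]) hC₀ hC₁,
    glMul_pair_decomp _ _ _ _ _ _ _ _ hA₀ hA₁ (by simp [Matrix.trace_smul, hC₀, hB₀])
      (by rw [Matrix.trace_add, h₂]; simp [Matrix.trace_smul, hC₁, hB₁])]
  have e₁ : (B₀ * A₀ * C₀).trace = (A₀ * C₀ * B₀).trace := by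
    rw [mul_assoc, Matrix.trace_mul_comm]
  have e₂ : (A₀ * (B₀ * C₀)).trace = (A₀ * B₀ * C₀).trace := by rw [mul_assoc]
  have e₃ : (A₀ * (C₀ * B₀)).trace = (A₀ * C₀ * B₀).trace := by rw [mul_assoc]
  congr 1
  · module
  · simp only [add_mul, mul_add, sub_mul, mul_sub, Matrix.smul_mul, Matrix.mul_smul, one_mul,
      mul_one, Matrix.trace_add, Matrix.trace_sub, Matrix.trace_smul, smul_eq_mul, e₁, e₂, e₃,
      hA₀, hC₀]
    module

/-- Scalar matrices are central. The zero scalars are kept so that the result again has the shape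
scalar plus traceless that `glMul_pair_decomp` takes as input. -/
theorem lie_pair_decomp (a₀ a₁ b₀ b₁ : K) (A₀ A₁ B₀ B₁ : Matrix (Fin n) (Fin n) K) :
    ⁅pair (a₀ • 1 + A₀) (a₁ • 1 + A₁), pair (b₀ • 1 + B₀) (b₁ • 1 + B₁)⁆ =
      pair ((0 : K) • 1 + (A₀ * B₀ - B₀ * A₀))
        ((0 : K) • 1 + ((A₀ * B₁ - B₁ * A₀) - (B₀ * A₁ - A₁ * B₀))) := by
  rw [lie_pair]
  congr 1 <;>
  · simp only [add_mul, mul_add, Matrix.smul_mul, Matrix.mul_smul, one_mul, mul_one]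
    module

theorem trace_comm (A B : Matrix (Fin n) (Fin n) K) : (A * B - B * A).trace = 0 := by
  rw [Matrix.trace_sub, Matrix.trace_mul_comm, sub_self]

/-- Taking commutators with a fixed matrix derives every matrix product, and the trace of a
commutator vanishes, so each term of the product formula obeys the Leibniz rule separately. -/
theorem glMul_leibniz [CharZero K] (x y z : GlSemi K n) :
    ⁅x, glMul K n y z⁆ = glMul K n ⁅x, y⁆ z + glMul K n y ⁅x, z⁆ := by
  obtain ⟨a₀, a₁, A₀, A₁, hA₀, hA₁, rfl⟩ := exists_decomp x
  obtain ⟨b₀, b₁, B₀, B₁, hB₀, hB₁, rfl⟩ := exists_decomp y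
  obtain ⟨c₀, c₁, C₀, C₁, hC₀, hC₁, rfl⟩ := exists_decomp z
  -- Cyclic rotations that bring the factor coming from `x` to the front of every trace, so that
  -- equal traces become syntactically equal.
  have e₁ (A X Y : Matrix (Fin n) (Fin n) K) : (X * (Y * A)).trace = (A * (X * Y)).trace := by
    rw [← mul_assoc, Matrix.trace_mul_comm]
  have e₂ (A X Y : Matrix (Fin n) (Fin n) K) : (X * (A * Y)).trace = (A * (Y * X)).trace := by
    rw [Matrix.trace_mul_comm, mul_assoc]
  rw [glMul_pair_decomp _ _ _ _ _ _ _ _ hB₀ hB₁ hC₀ hC₁, lie_pair_decomp, lie_pair_decomp,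
    lie_pair_decomp,
    glMul_pair_decomp _ _ _ _ _ _ _ _ (trace_comm _ _)
      (by rw [Matrix.trace_sub, trace_comm, trace_comm, sub_zero]) hC₀ hC₁,
    glMul_pair_decomp _ _ _ _ _ _ _ _ hB₀ hB₁ (trace_comm _ _)
      (by rw [Matrix.trace_sub, trace_comm, trace_comm, sub_zero]), ← pair_add]
  congr 1
  · simp only [mul_add, add_mul, Matrix.smul_mul, Matrix.mul_smul]
    module
  · simp only [add_mul, mul_add, sub_mul, mul_sub, Matrix.smul_mul, Matrix.mul_smul, one_mul,
      mul_one, Matrix.trace_sub, mul_assoc, e₁ A₀, e₂ A₀,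
      e₁ A₁, e₂ A₁]
    module

theorem isPoissonAlgebra_glMul [CharZero K] :
    IsPoissonAlgebra K (glMul K n) (lieBilin K (GlSemi K n)) where
  mul_comm := glMul_comm
  mul_assoc := glMul_assoc
  br_self := lie_self
  jacobi := leibniz_lie
  leibniz := glMul_leibniz

end GlPoisson

/-! ### The two tables -/

section Tables

variable {K : Type u} [Field K] {n : ℕ}

theorem conjRep_mul (g : GL (Fin n) K) (X Y : Matrix (Fin n) (Fin n) K) :
    conjRep K n g (X * Y) = conjRep K n g X * conjRep K n g Y := conj_mul g X Y

theorem trace_conjRep (g : GL (Fin n) K) (X : Matrix (Fin n) (Fin n) K) :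
    (conjRep K n g X).trace = X.trace := trace_conj g X

theorem conjRep_one (g : GL (Fin n) K) : conjRep K n g 1 = 1 := by
  simpa using conj_smul_one K n g 1

theorem semiRep_pair (g : GL (Fin n) K) (X Y : Matrix (Fin n) (Fin n) K) :
    semiRep K n g (pair X Y) = pair (conjRep K n g X) (conjRep K n g Y) := rfl

theorem semiRep_glMul [CharZero K] (g : GL (Fin n) K) (x y : GlSemi K n) :
    semiRep K n g (glMul K n x y) = glMul K n (semiRep K n g x) (semiRep K n g y) := by
  obtain ⟨a₀, a₁, A₀, A₁, hA₀, hA₁, rfl⟩ := exists_decomp x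
  obtain ⟨b₀, b₁, B₀, B₁, hB₀, hB₁, rfl⟩ := exists_decomp y
  rw [glMul_pair _ _ _ _ _ _ _ _ hA₀ hA₁ hB₀ hB₁]
  simp only [semiRep_pair, map_add, map_smul, conjRep_mul, conjRep_one]
  rw [glMul_pair _ _ _ _ _ _ _ _ (by rwa [trace_conjRep]) (by rwa [trace_conjRep])
    (by rwa [trace_conjRep]) (by rwa [trace_conjRep])]
  simp only [← conjRep_mul, trace_conjRep, ← map_add]

theorem semiRep_lie (g : GL (Fin n) K) (x y : GlSemi K n) :
    semiRep K n g ⁅x, y⁆ = ⁅semiRep K n g x, semiRep K n g y⁆ := by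
  rw [← pair_comp x, ← pair_comp y, lie_pair]
  simp only [semiRep_pair, lie_pair, map_sub, conjRep_mul]

theorem Piece.sum_univ {M : Type*} [AddCommMonoid M] (f : Piece → M) :
    ∑ r, f r = f .I0 + f .sl0 + f .slAb + f .IAb := by
  change ∑ r ∈ {Piece.I0, Piece.sl0, Piece.slAb, Piece.IAb}, f r = _
  rw [Finset.sum_insert (by decide), Finset.sum_insert (by decide), Finset.sum_insert (by decide),
    Finset.sum_singleton, add_assoc, add_assoc]

theorem pair_zero : pair (0 : Matrix (Fin n) (Fin n) K) 0 = 0 := rfl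

theorem pair_eq_zero {X Y : Matrix (Fin n) (Fin n) K} : pair X Y = 0 ↔ X = 0 ∧ Y = 0 :=
  ⟨fun h => ⟨congrArg comp₀ h, congrArg comp₁ h⟩, fun h => by rw [h.1, h.2, pair_zero]⟩

theorem smul_one_add_eq_zero [CharZero K] (hn : n ≠ 0) {a : K} {A : Matrix (Fin n) (Fin n) K}
    (hA : A.trace = 0) : a • 1 + A = 0 ↔ a = 0 ∧ A = 0 := by
  refine ⟨fun h => ?_, fun h => by simp [h.1, h.2]⟩
  have ha : a = 0 := by rw [← scalarPart_decomp hn a hA, h]; simp [scalarPart]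
  exact ⟨ha, by simpa [ha] using h⟩

/-- Independence of all four summands at once; it gives both the injectivity of each embedding and
the directness of the sum. -/
theorem pieceMap_sum_eq_zero [CharZero K] (hn : n ≠ 0) (x y : K) (A B : Sl K n)
    (h : embI0 K n x + embSl0 K n A + embSlAb K n B + embIAb K n y = 0) :
    x = 0 ∧ A = 0 ∧ B = 0 ∧ y = 0 := by
  have h' : pair (x • 1 + A.1) (y • 1 + B.1) = 0 := by
    rw [← h]
    change _ = pair (x • 1 + A.1 + 0 + 0) (0 + 0 + B.1 + y • 1)
    congr 1 <;> abel
  obtain ⟨h₀, h₁⟩ := pair_eq_zero.mp h'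
  obtain ⟨hx, hA⟩ := (smul_one_add_eq_zero hn A.2).mp h₀
  obtain ⟨hy, hB⟩ := (smul_one_add_eq_zero hn B.2).mp h₁
  exact ⟨hx, Subtype.ext hA, Subtype.ext hB, hy⟩

theorem pieceMap_injective [CharZero K] (hn : n ≠ 0) (r : Piece) :
    Function.Injective (pieceMap K n r) := by
  refine (injective_iff_map_eq_zero _).mpr fun x hx => ?_
  cases r
  · refine (pieceMap_sum_eq_zero (K := K) hn x 0 0 0 ?_).1
    simp only [map_zero, add_zero]; exact hx
  · refine (pieceMap_sum_eq_zero (K := K) hn 0 0 x 0 ?_).2.1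
    simp only [map_zero, add_zero, zero_add]; exact hx
  · refine (pieceMap_sum_eq_zero (K := K) hn 0 0 0 x ?_).2.2.1
    simp only [map_zero, add_zero, zero_add]; exact hx
  · refine (pieceMap_sum_eq_zero (K := K) hn 0 x 0 0 ?_).2.2.2
    simp only [map_zero, add_zero, zero_add]; exact hx

theorem isInternal_pieceMap [CharZero K] (hn : n ≠ 0) :
    DirectSum.IsInternal fun r => LinearMap.range (pieceMap K n r).toLinearMap := by
  have hsum (z : DirectSum Piece fun r => LinearMap.range (pieceMap K n r).toLinearMap) :
      DirectSum.coeAddMonoidHom (fun r => LinearMap.range (pieceMap K n r).toLinearMap) z =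
        (z .I0 : GlSemi K n) + z .sl0 + z .slAb + z .IAb := by
    classical
    rw [DirectSum.coeAddMonoidHom_eq_dfinsuppSum, DFinsupp.sum_eq_sum_fintype _ (fun _ => rfl),
      Piece.sum_univ]
    rfl
  constructor
  · refine (injective_iff_map_eq_zero _).mpr fun z hz => ?_
    rw [hsum] at hz
    obtain ⟨x, hx⟩ := (z .I0).2
    obtain ⟨A, hA⟩ := (z .sl0).2
    obtain ⟨B, hB⟩ := (z .slAb).2
    obtain ⟨y, hy⟩ := (z .IAb).2
    rw [← hx, ← hA, ← hB, ← hy] at hz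
    obtain ⟨hx', hA', hB', hy'⟩ := pieceMap_sum_eq_zero (K := K) hn x y A B hz
    refine DFinsupp.ext fun r => Subtype.ext ?_
    cases r
    · exact hx.symm.trans (by rw [show x = 0 from hx', map_zero]; rfl)
    · exact hA.symm.trans (by rw [show A = 0 from hA', map_zero]; rfl)
    · exact hB.symm.trans (by rw [show B = 0 from hB', map_zero]; rfl)
    · exact hy.symm.trans (by rw [show y = 0 from hy', map_zero]; rfl)
  · intro x
    obtain ⟨a₀, a₁, A₀, A₁, hA₀, hA₁, rfl⟩ := exists_decomp x
    refine ⟨DirectSum.of _ Piece.I0 ⟨_, a₀, rfl⟩ + DirectSum.of _ Piece.sl0 ⟨_, ⟨A₀, hA₀⟩, rfl⟩ +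
      DirectSum.of _ Piece.slAb ⟨_, ⟨A₁, hA₁⟩, rfl⟩ + DirectSum.of _ Piece.IAb ⟨_, a₁, rfl⟩, ?_⟩
    simp only [map_add, DirectSum.coeAddMonoidHom_of]
    change pair (a₀ • 1 + A₀ + 0 + 0) (0 + 0 + A₁ + a₁ • 1) = _
    congr 1 <;> abel

theorem sum_fin_eq_one {M : Type*} [AddCommMonoid M] {d : ℕ} (h : d = 1) (f : Fin d → M) :
    ∑ q, f q = f ⟨0, by omega⟩ := by
  subst h; simp

/-- This is the polarised Cayley–Hamilton theorem: the square of a traceless $2\times2$ matrix is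
scalar. The entries are compared directly. -/
theorem slAnti_two [CharZero K] (A B : Sl K 2) : slAnti A B = 0 := by
  obtain ⟨A, hA⟩ := A
  obtain ⟨B, hB⟩ := B
  rw [mem_sl, Matrix.trace_fin_two] at hA hB
  have hA' : A 1 1 = - A 0 0 := by linear_combination hA
  have hB' : B 1 1 = - B 0 0 := by linear_combination hB
  refine Subtype.ext (Matrix.ext fun i j => ?_)
  fin_cases i <;> fin_cases j <;>
    simp [slAnti, Matrix.mul_apply, Matrix.trace_fin_two, hA', hB'] <;> ring

theorem glMul_embI0 [CharZero K] (a : K) (x : GlSemi K n) :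
    glMul K n (embI0 K n a) x = a • x := by
  obtain ⟨b₀, b₁, B₀, B₁, hB₀, hB₁, rfl⟩ := exists_decomp x
  have h := glMul_pair a 0 b₀ b₁ 0 0 B₀ B₁ (Matrix.trace_zero ..) (Matrix.trace_zero ..) hB₀ hB₁
  rw [add_zero, zero_smul, add_zero] at h
  refine h.trans ?_
  rw [← pair_smul]
  congr 1
  · module
  · simp only [zero_mul, add_zero, mul_zero, Matrix.trace_zero, sub_zero]
    module

theorem glMul_embSl0_embSl0 [CharZero K] (A B : Sl K n) :
    glMul K n (embSl0 K n A) (embSl0 K n B) = embSlAb K n (slAnti A B) := by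
  have h := glMul_pair 0 0 0 0 A.1 0 B.1 0 A.2 (Matrix.trace_zero ..) B.2 (Matrix.trace_zero ..)
  simp only [zero_smul, zero_add, mul_zero, add_zero, zero_mul, Matrix.trace_zero, zero_sub] at h
  refine h.trans (congrArg (pair 0) ?_)
  simp only [slAnti]
  module

theorem glMul_embSl0_embSlAb [CharZero K] (A B : Sl K n) :
    glMul K n (embSl0 K n A) (embSlAb K n B) = embIAb K n (A.1 * B.1).trace := by
  have h := glMul_pair 0 0 0 0 A.1 0 0 B.1 A.2 (Matrix.trace_zero ..) (Matrix.trace_zero ..) B.2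
  simp only [zero_smul, zero_add, mul_zero, add_zero, zero_mul, Matrix.trace_zero, sub_zero] at h
  exact h

theorem glMul_embSl0_embIAb [CharZero K] (A : Sl K n) (b : K) :
    glMul K n (embSl0 K n A) (embIAb K n b) = 0 := by
  have h := glMul_pair 0 0 0 b A.1 0 0 0 A.2 (Matrix.trace_zero ..) (Matrix.trace_zero ..)
    (Matrix.trace_zero ..)
  simp only [zero_smul, zero_add, mul_zero, add_zero, zero_mul, Matrix.trace_zero, sub_zero,
    smul_zero] at h
  exact h

theorem glMul_ab_ab [CharZero K] (X Y : Matrix (Fin n) (Fin n) K) :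
    glMul K n (pair 0 X) (pair 0 Y) = 0 := by
  have h := glMul_pair 0 (scalarPart X) 0 (scalarPart Y) 0 (slPart X) 0 (slPart Y)
    (Matrix.trace_zero ..) (trace_slPart X) (Matrix.trace_zero ..) (trace_slPart Y)
  simp only [decomp] at h
  simp only [zero_smul, mul_zero, add_zero, zero_mul, Matrix.trace_zero, sub_zero] at h
  exact h

theorem lie_embI0 (a : K) (x : GlSemi K n) : ⁅embI0 K n a, x⁆ = 0 := by
  change ⁅pair (a • 1) 0, pair (comp₀ x) (comp₁ x)⁆ = 0
  rw [lie_pair]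
  simp [pair_zero]

theorem lie_embIAb (a : K) (x : GlSemi K n) : ⁅embIAb K n a, x⁆ = 0 := by
  change ⁅pair 0 (a • 1), pair (comp₀ x) (comp₁ x)⁆ = 0
  rw [lie_pair]
  simp [pair_zero]

theorem lie_embSl0_embSl0 (A B : Sl K n) :
    ⁅embSl0 K n A, embSl0 K n B⁆ = embSl0 K n (slComm A B) := by
  refine (lie_pair _ _ _ _).trans ?_
  simp [embSl0, slComm]

theorem lie_embSl0_embSlAb (A B : Sl K n) :
    ⁅embSl0 K n A, embSlAb K n B⁆ = embSlAb K n (slComm A B) := by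
  refine (lie_pair _ _ _ _).trans ?_
  simp [embSlAb, slComm]

theorem lie_embSlAb_embSl0 (A B : Sl K n) :
    ⁅embSlAb K n A, embSl0 K n B⁆ = embSlAb K n (slComm A B) := by
  refine (lie_pair _ _ _ _).trans ?_
  simp [embSlAb, slComm]

theorem lie_embSlAb_embSlAb (A B : Sl K n) : ⁅embSlAb K n A, embSlAb K n B⁆ = 0 := by
  refine (lie_pair _ _ _ _).trans ?_
  simp [pair_zero]

variable {r s : Piece} {c : ∀ t : Piece, Fin (glD n (pieceType r) (pieceType s) (pieceType t)) → K}

theorem table_of_zero [CharZero K] (h : ∀ t q, c t q = 0) {z : GlSemi K n} (hz : z = 0)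
    (w : glV K n (pieceType r) ⊗[K] glV K n (pieceType s)) :
    z = ∑ t, ∑ q, c t q • pieceMap K n t (glM K n (pieceType r) (pieceType s) (pieceType t) q w) := by
  rw [hz]
  exact (Finset.sum_eq_zero fun t _ => Finset.sum_eq_zero fun q _ => by rw [h t q, zero_smul]).symm

theorem table_of_single [CharZero K] (t : Piece) (h : ∀ t', t' ≠ t → ∀ q, c t' q = 0)
    {z : GlSemi K n} (w : glV K n (pieceType r) ⊗[K] glV K n (pieceType s))
    (hz : z = ∑ q, c t q •
      pieceMap K n t (glM K n (pieceType r) (pieceType s) (pieceType t) q w)) :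
    z = ∑ t, ∑ q, c t q • pieceMap K n t (glM K n (pieceType r) (pieceType s) (pieceType t) q w) := by
  rw [hz, eq_comm]
  exact Finset.sum_eq_single t
    (fun t' _ ht' => Finset.sum_eq_zero fun q _ => by rw [h t' ht' q, zero_smul])
    (fun h => absurd (Finset.mem_univ _) h)

theorem table_of_unique [CharZero K] (t : Piece) (h : ∀ t', t' ≠ t → ∀ q, c t' q = 0)
    (hd : glD n (pieceType r) (pieceType s) (pieceType t) = 1) (ht : ∀ q, c t q = 1)
    {z : GlSemi K n} (w : glV K n (pieceType r) ⊗[K] glV K n (pieceType s))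
    (hz : z = pieceMap K n t (glM K n (pieceType r) (pieceType s) (pieceType t) ⟨0, by omega⟩ w)) :
    z = ∑ t, ∑ q, c t q • pieceMap K n t (glM K n (pieceType r) (pieceType s) (pieceType t) q w) := by
  refine table_of_single t h w ?_
  rw [sum_fin_eq_one hd, ht, one_smul, hz]

/-- The hypothesis `h₀` covers an index `m` beyond the list of basis morphisms. This happens for
$m_2$ when $n=2$, where the entry $\mathfrak{sl}(n)_{ab}^{(+)}$ is represented by an empty sum and
the product does vanish. -/
theorem sum_indicator {M : Type*} [AddCommGroup M] [Module K M] {d m : ℕ} (f : Fin d → M) {z : M}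
    (h₀ : d ≤ m → z = 0) (h : ∀ h : m < d, z = f ⟨m, h⟩) :
    z = ∑ q, (if q.val = m then (1 : K) else 0) • f q := by
  rcases lt_or_ge m d with hd | hd
  · rw [Finset.sum_eq_single ⟨m, hd⟩, if_pos rfl, one_smul, h hd]
    · intro q _ hq
      rw [if_neg fun h => hq (Fin.ext h), zero_smul]
    · exact fun h => absurd (Finset.mem_univ _) h
  · rw [h₀ hd]
    exact (Finset.sum_eq_zero fun q _ => by
      rw [if_neg fun h => by omega, zero_smul]).symm

theorem glD_ad_pos : 0 < glD n .ad .ad .ad := by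
  rw [glD]; split <;> decide

theorem embSlAb_slAnti_eq_zero [CharZero K] (h : glD n .ad .ad .ad ≤ 1) (A B : Sl K n) :
    embSlAb K n (slAnti A B) = 0 := by
  obtain rfl : n = 2 := by
    by_contra hn
    rw [glD, if_neg hn] at h
    omega
  rw [slAnti_two, map_zero]

theorem glMul_pieceMap [CharZero K] (r s : Piece) (x : glV K n (pieceType r))
    (y : glV K n (pieceType s)) :
    glMul K n (pieceMap K n r x) (pieceMap K n s y) = ∑ t, ∑ q, mulTable K n r s t q •
      pieceMap K n t (glM K n (pieceType r) (pieceType s) (pieceType t) q (x ⊗ₜ[K] y)) := by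
  cases r <;> cases s
  · exact table_of_unique .I0 (fun t ht q => by cases t <;> first | rfl | exact absurd rfl ht)
      rfl (fun _ => rfl) _ ((glMul_embI0 (K := K) x _).trans ((embI0 K n).map_smul x y).symm)
  · exact table_of_unique .sl0 (fun t ht q => by cases t <;> first | rfl | exact absurd rfl ht)
      rfl (fun _ => rfl) _ ((glMul_embI0 (K := K) x _).trans ((embSl0 K n).map_smul x y).symm)
  · exact table_of_unique .slAb (fun t ht q => by cases t <;> first | rfl | exact absurd rfl ht)
      rfl (fun _ => rfl) _ ((glMul_embI0 (K := K) x _).trans ((embSlAb K n).map_smul x y).symm)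
  · exact table_of_unique .IAb (fun t ht q => by cases t <;> first | rfl | exact absurd rfl ht)
      rfl (fun _ => rfl) _ ((glMul_embI0 (K := K) x _).trans ((embIAb K n).map_smul x y).symm)
  · exact table_of_unique .sl0 (fun t ht q => by cases t <;> first | rfl | exact absurd rfl ht)
      rfl (fun _ => rfl) _ (((glMul_comm _ _).trans (glMul_embI0 (K := K) y _)).trans ((embSl0 K n).map_smul y x).symm)
  · exact table_of_single .slAb (fun t ht q => by cases t <;> first | rfl | exact absurd rfl ht)
      _ ((glMul_embSl0_embSl0 x y).trans (sum_indicator _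
        (fun h => embSlAb_slAnti_eq_zero h x y) (fun _ => rfl)))
  · exact table_of_unique .IAb (fun t ht q => by cases t <;> first | rfl | exact absurd rfl ht)
      rfl (fun _ => rfl) _ (glMul_embSl0_embSlAb x y)
  · exact table_of_zero (fun t q => by cases t <;> rfl) (glMul_embSl0_embIAb (K := K) x y) _
  · exact table_of_unique .slAb (fun t ht q => by cases t <;> first | rfl | exact absurd rfl ht)
      rfl (fun _ => rfl) _ (((glMul_comm _ _).trans (glMul_embI0 (K := K) y _)).trans ((embSlAb K n).map_smul y x).symm)
  · exact table_of_unique .IAb (fun t ht q => by cases t <;> first | rfl | exact absurd rfl ht)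
      rfl (fun _ => rfl) _ (((glMul_comm _ _).trans (glMul_embSl0_embSlAb y x)).trans
        (congrArg (embIAb K n) (Matrix.trace_mul_comm y.1 x.1)))
  · exact table_of_zero (fun t q => by cases t <;> rfl) (glMul_ab_ab _ _) _
  · exact table_of_zero (fun t q => by cases t <;> rfl) (glMul_ab_ab _ _) _
  · exact table_of_unique .IAb (fun t ht q => by cases t <;> first | rfl | exact absurd rfl ht)
      rfl (fun _ => rfl) _ (((glMul_comm _ _).trans (glMul_embI0 (K := K) y _)).trans
        (((embIAb K n).map_smul y x).symm.trans (congrArg (embIAb K n) (mul_comm (G := K) y x))))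
  · exact table_of_zero (fun t q => by cases t <;> rfl) ((glMul_comm _ _).trans (glMul_embSl0_embIAb (K := K) y x)) _
  · exact table_of_zero (fun t q => by cases t <;> rfl) (glMul_ab_ab _ _) _
  · exact table_of_zero (fun t q => by cases t <;> rfl) (glMul_ab_ab _ _) _

theorem lie_pieceMap [CharZero K] (r s : Piece) (x : glV K n (pieceType r))
    (y : glV K n (pieceType s)) :
    ⁅pieceMap K n r x, pieceMap K n s y⁆ = ∑ t, ∑ q, brTable K n r s t q •
      pieceMap K n t (glM K n (pieceType r) (pieceType s) (pieceType t) q (x ⊗ₜ[K] y)) := by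
  have skew {a b : GlSemi K n} (h : ⁅b, a⁆ = 0) : ⁅a, b⁆ = 0 := by rw [← lie_skew, h, neg_zero]
  cases r <;> cases s
  · exact table_of_zero (fun t q => by cases t <;> rfl) (lie_embI0 (K := K) x _) _
  · exact table_of_zero (fun t q => by cases t <;> rfl) (lie_embI0 (K := K) x _) _
  · exact table_of_zero (fun t q => by cases t <;> rfl) (lie_embI0 (K := K) x _) _
  · exact table_of_zero (fun t q => by cases t <;> rfl) (lie_embI0 (K := K) x _) _
  · exact table_of_zero (fun t q => by cases t <;> rfl) (skew (lie_embI0 (K := K) y _)) _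
  · exact table_of_single .sl0 (fun t ht q => by cases t <;> first | rfl | exact absurd rfl ht)
      _ ((lie_embSl0_embSl0 x y).trans (sum_indicator _
        (fun h => absurd glD_ad_pos h.not_gt) (fun _ => rfl)))
  · exact table_of_single .slAb (fun t ht q => by cases t <;> first | rfl | exact absurd rfl ht)
      _ ((lie_embSl0_embSlAb x y).trans (sum_indicator _
        (fun h => absurd glD_ad_pos h.not_gt) (fun _ => rfl)))
  · exact table_of_zero (fun t q => by cases t <;> rfl) (skew (lie_embIAb (K := K) y _)) _
  · exact table_of_zero (fun t q => by cases t <;> rfl) (skew (lie_embI0 (K := K) y _)) _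
  · exact table_of_single .slAb (fun t ht q => by cases t <;> first | rfl | exact absurd rfl ht)
      _ ((lie_embSlAb_embSl0 x y).trans (sum_indicator _
        (fun h => absurd glD_ad_pos h.not_gt) (fun _ => rfl)))
  · exact table_of_zero (fun t q => by cases t <;> rfl) (lie_embSlAb_embSlAb x y) _
  · exact table_of_zero (fun t q => by cases t <;> rfl) (skew (lie_embIAb (K := K) y _)) _
  · exact table_of_zero (fun t q => by cases t <;> rfl) (lie_embIAb (K := K) x _) _
  · exact table_of_zero (fun t q => by cases t <;> rfl) (lie_embIAb (K := K) x _) _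
  · exact table_of_zero (fun t q => by cases t <;> rfl) (lie_embIAb (K := K) x _) _
  · exact table_of_zero (fun t q => by cases t <;> rfl) (lie_embIAb (K := K) x _) _

theorem isGTable_glMul [CharZero K] (hn : n ≠ 0) :
    IsGTable (glLabeling K n) (semiRep K n) (glMul K n) pieceType (pieceMap K n)
      (mulTable K n) where
  map_mul := semiRep_glMul
  injective := pieceMap_injective hn
  isInternal := isInternal_pieceMap hn
  table := glMul_pieceMap

theorem isGTable_lieBilin [CharZero K] (hn : n ≠ 0) :
    IsGTable (glLabeling K n) (semiRep K n) (lieBilin K (GlSemi K n)) pieceType (pieceMap K n)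
      (brTable K n) where
  map_mul := semiRep_lie
  injective := pieceMap_injective hn
  isInternal := isInternal_pieceMap hn
  table := lie_pieceMap

end Tables

/-! ### Invariant multilinear forms on matrices -/

section Invariants

variable {K : Type u} [Field K] {n k : ℕ}

/-- The invertible matrix `1 + c E_{ij}`. -/
def transvectionGL {i j : Fin n} (h : i ≠ j) (c : K) : GL (Fin n) K where
  val := Matrix.transvection i j c
  inv := Matrix.transvection i j (-c)
  val_inv := by rw [Matrix.transvection_mul_transvection_same _ _ h]; simp
  inv_val := by rw [Matrix.transvection_mul_transvection_same _ _ h]; simp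

/-- The matrix that sends the standard vector `e_a` to `e_{σ a}`. -/
def permGL (K : Type u) [Field K] (σ : Equiv.Perm (Fin n)) : GL (Fin n) K where
  val := σ⁻¹.permMatrix K
  inv := σ.permMatrix K
  val_inv := by rw [← Matrix.permMatrix_mul, mul_inv_cancel, Matrix.permMatrix_one]
  inv_val := by rw [← Matrix.permMatrix_mul, inv_mul_cancel, Matrix.permMatrix_one]

/-- The invertible diagonal matrix with the nonzero entries `d`. -/
def diagonalGL {d : Fin n → K} (hd : ∀ i, d i ≠ 0) : GL (Fin n) K where
  val := Matrix.diagonal d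
  inv := Matrix.diagonal fun i => (d i)⁻¹
  val_inv := by simp [hd]
  inv_val := by simp [hd]

theorem conjRep_apply (g : GL (Fin n) K) (X : Matrix (Fin n) (Fin n) K) :
    conjRep K n g X = g.1 * X * (g⁻¹).1 := rfl

theorem permGL_mulVec (σ : Equiv.Perm (Fin n)) (a : Fin n) :
    (permGL K σ).1.mulVec (Pi.single a 1) = Pi.single (σ a) 1 := by
  change (σ⁻¹.permMatrix K).mulVec _ = _
  rw [Matrix.permMatrix_mulVec]
  ext i
  simp [Pi.single_apply, Equiv.symm_apply_eq]

theorem transvectionGL_mulVec {i j : Fin n} (h : i ≠ j) (a : Fin n) :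
    (transvectionGL (K := K) h 1).1.mulVec (Pi.single a 1) =
      if a = j then Pi.single j 1 + Pi.single i 1 else Pi.single a 1 := by
  change (Matrix.transvection i j (1 : K)).mulVec _ = _
  rw [Matrix.transvection, Matrix.add_mulVec, Matrix.one_mulVec, Matrix.single_mulVec]
  split_ifs with ha
  · subst ha; ext b; simp [Function.update_apply, Pi.single_apply]
  · ext b; simp [Pi.single_apply, Ne.symm ha]

theorem conjRep_diagonalGL_single {d : Fin n → K} (hd : ∀ i, d i ≠ 0) (a b : Fin n) :
    conjRep K n (diagonalGL hd) (Matrix.single a b 1) =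
      (d a * (d b)⁻¹) • Matrix.single a b 1 := by
  change Matrix.diagonal d * Matrix.single a b 1 * Matrix.diagonal (fun i => (d i)⁻¹) = _
  ext i j
  simp only [Matrix.mul_diagonal, Matrix.diagonal_mul, Matrix.smul_apply, Matrix.single_apply,
    smul_eq_mul]
  split_ifs with h
  · rw [h.1, h.2]; ring
  · simp

/-- An invariant multilinear form on matrices that vanishes on all matrices with prescribed
one-dimensional images spanned by distinct standard vectors is zero. -/
theorem multilinear_eq_zero_of_invariant
    (U : MultilinearMap K (fun _ : Fin k => Matrix (Fin n) (Fin n) K) K)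
    (hU : ∀ g m, U (fun i => conjRep K n g (m i)) = U m)
    {f : Fin k → Fin n} (hf : Function.Injective f)
    (h : ∀ b : Fin k → Fin n, U (fun i => Matrix.single (f i) (b i) 1) = 0) : U = 0 := by
  -- Rank one matrices satisfy $g(v\xi)g^{-1}=(gv)(\xi g^{-1})$. Since all row vectors $\xi$ are
  -- allowed, the vanishing depends only on the columns $v_i$ and can be transported by any $g$.
  have act (g : GL (Fin n) K) {v : Fin k → Fin n → K}
      (hv : ∀ ξ : Fin k → Fin n → K, U (fun i => Matrix.vecMulVec (v i) (ξ i)) = 0)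
      (ξ : Fin k → Fin n → K) :
      U (fun i => Matrix.vecMulVec (g.1.mulVec (v i)) (ξ i)) = 0 := by
    rw [← hv fun i => Matrix.vecMul (ξ i) g.1,
      ← hU g fun i => Matrix.vecMulVec (v i) (Matrix.vecMul (ξ i) g.1)]
    congr 1
    ext1 i
    rw [conjRep_apply, Matrix.mul_vecMulVec, Matrix.vecMulVec_mul, Matrix.vecMul_vecMul,
      Units.mul_inv, Matrix.vecMul_one]
  have base (ξ : Fin k → Fin n → K) :
      U (fun i => Matrix.vecMulVec (Pi.single (f i) 1) (ξ i)) = 0 := by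
    have h0 : U.compLinearMap
        (fun i => vecMulVecBilin K K (Pi.single (f i) (1 : K) : Fin n → K)) = 0 := by
      refine Module.Basis.ext_multilinear (fun _ => Pi.basisFun K (Fin n)) fun b => ?_
      simpa [vecMulVecBilin, Matrix.single_eq_single_vecMulVec_single] using h b
    simpa [vecMulVecBilin] using congrArg (fun V => V ξ) h0
  -- Induction on the number of coincidences among the column labels `a`.
  have main (m : ℕ) : ∀ a : Fin k → Fin n, k - (Finset.univ.image a).card = m →
      ∀ ξ : Fin k → Fin n → K, U (fun i => Matrix.vecMulVec (Pi.single (a i) 1) (ξ i)) = 0 := by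
    induction m with
    | zero =>
      intro a ha ξ
      have hinj : Function.Injective a := by
        have hc : (Finset.univ.image a).card = (Finset.univ : Finset (Fin k)).card :=
          le_antisymm Finset.card_image_le (by rw [Finset.card_fin]; omega)
        simpa using Finset.card_image_iff.mp hc
      -- Any two injective labelings differ by a permutation matrix.
      obtain ⟨σ, hσ⟩ := Equiv.Perm.exists_extending_pair f a hf hinj
      simpa only [permGL_mulVec, hσ] using act (permGL K σ) base ξ
    | succ m ih =>
      intro a ha ξ
      have hninj : ¬ Function.Injective a := fun hinj => by
        rw [Finset.card_image_of_injective _ hinj, Finset.card_fin] at ha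
        omega
      obtain ⟨i, j, hij, hne⟩ : ∃ i j, a i = a j ∧ i ≠ j := by
        simpa [Function.Injective] using hninj
      have hkn : k ≤ n := by simpa using Fintype.card_le_of_injective f hf
      -- A repeated value leaves an unused index `x`, because $k\le n$. Relabeling position `i` by
      -- `x` removes one coincidence.
      obtain ⟨x, hx⟩ : ∃ x, x ∉ Finset.univ.image a := by
        by_contra! hall
        have := Finset.card_le_card (fun x _ => hall x : (Finset.univ : Finset (Fin n)) ⊆ _)
        rw [Finset.card_fin] at this
        omega
      have hxa (l : Fin k) : a l ≠ x := fun hl => hx (by rw [← hl]; simp)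
      have himg : Finset.univ.image (Function.update a i x) =
          insert x (Finset.univ.image a) := by
        ext y
        simp only [Finset.mem_image, Finset.mem_univ, true_and, Finset.mem_insert]
        constructor
        · rintro ⟨l, rfl⟩
          by_cases hl : l = i
          · simp [hl]
          · exact Or.inr ⟨l, by simp [hl]⟩
        · rintro (rfl | ⟨l, rfl⟩)
          · exact ⟨i, by simp⟩
          · by_cases hl : l = i
            · exact ⟨j, by simp [hne.symm, hl, hij]⟩
            · exact ⟨l, by simp [hl]⟩
      have hP := ih (Function.update a i x)
        (by rw [himg, Finset.card_insert_of_notMem hx]; omega)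
      -- The transvection sends $e_x$ to $e_x+e_{a_i}$ and fixes the other standard vectors that
      -- occur. By linearity in position `i` the value is the sum of the relabeled one, which is
      -- zero, and the wanted one.
      have h1 := act (transvectionGL (hxa i) 1) hP ξ
      have h2 : (fun l => Matrix.vecMulVec ((transvectionGL (K := K) (hxa i) 1).1.mulVec
          (Pi.single (Function.update a i x l) 1)) (ξ l)) =
          Function.update (fun l => Matrix.vecMulVec (Pi.single (a l) 1) (ξ l)) i
            (Matrix.vecMulVec (Pi.single x 1) (ξ i) + Matrix.vecMulVec (Pi.single (a i) 1) (ξ i)) := by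
        ext1 l
        rw [transvectionGL_mulVec]
        by_cases hl : l = i
        · subst hl; simp [Matrix.add_vecMulVec]
        · simp [hl, hxa]
      rw [h2, MultilinearMap.map_update_add] at h1
      have h3 := hP ξ
      have h4 : (fun l => Matrix.vecMulVec (Pi.single (Function.update a i x l) 1) (ξ l)) =
          Function.update (fun l => Matrix.vecMulVec (Pi.single (a l) (1 : K)) (ξ l)) i
            (Matrix.vecMulVec (Pi.single x 1) (ξ i)) := by
        ext1 l
        by_cases hl : l = i
        · subst hl; simp
        · simp [hl]
      rw [h4] at h3
      rwa [h3, zero_add, Function.update_eq_self] at h1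
  refine Module.Basis.ext_multilinear (fun _ => Matrix.stdBasis K (Fin n) (Fin n)) fun b => ?_
  have hb (i : Fin k) : Matrix.stdBasis K (Fin n) (Fin n) (b i) =
      Matrix.vecMulVec (Pi.single (b i).1 1) (Pi.single (b i).2 1) := by
    rw [← Matrix.single_eq_single_vecMulVec_single]
    exact Matrix.stdBasis_eq_single K (b i).1 (b i).2
  simp only [hb, zero_apply]
  exact main _ (fun i => (b i).1) rfl (fun i => Pi.single (b i).2 1)

/-- A monomial of matrix units on which an invariant multilinear form is nonzero has weight zero. -/
theorem exists_perm_of_apply_single_ne_zero [CharZero K]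
    (U : MultilinearMap K (fun _ : Fin k => Matrix (Fin n) (Fin n) K) K)
    (hU : ∀ g m, U (fun i => conjRep K n g (m i)) = U m)
    {f : Fin k → Fin n} (hf : Function.Injective f) {b : Fin k → Fin n}
    (h : U (fun i => Matrix.single (f i) (b i) 1) ≠ 0) :
    ∃ σ : Equiv.Perm (Fin k), ∀ i, b i = f (σ i) := by
  -- The diagonal matrix with entry 2 at `x` and 1 elsewhere multiplies the value by
  -- $2^{\#\{f=x\}-\#\{b=x\}}$. In characteristic zero a nonzero invariant value forces the exponent
  -- to vanish, so `f` and `b` take each value equally often.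
  have count (x : Fin n) : (Finset.univ.filter fun i => f i = x).card =
      (Finset.univ.filter fun i => b i = x).card := by
    have hd (i : Fin n) : (if i = x then (2 : K) else 1) ≠ 0 := by split_ifs <;> norm_num
    have h1 := hU (diagonalGL hd) (fun i => Matrix.single (f i) (b i) 1)
    simp only [conjRep_diagonalGL_single] at h1
    rw [MultilinearMap.map_smul_univ, smul_eq_mul, mul_eq_right₀ h, Finset.prod_mul_distrib,
      Finset.prod_inv_distrib, mul_inv_eq_one₀ (Finset.prod_ne_zero_iff.mpr fun i _ => hd _)] at h1
    simp only [Finset.prod_ite, Finset.prod_const, one_pow, mul_one] at h1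
    have h2 : (2 : ℕ) ^ (Finset.univ.filter fun i => f i = x).card =
        2 ^ (Finset.univ.filter fun i => b i = x).card := by exact_mod_cast h1
    exact Nat.pow_right_injective le_rfl h2
  have ex (i : Fin k) : ∃ j, b j = f i := by
    have : 0 < (Finset.univ.filter fun j => b j = f i).card := by
      rw [← count]
      exact Finset.card_pos.mpr ⟨i, by simp⟩
    obtain ⟨j, hj⟩ := Finset.card_pos.mp this
    exact ⟨j, by simpa using hj⟩
  choose τ hτ using ex
  have hτi : Function.Injective τ := fun i j hij => hf (by rw [← hτ, ← hτ, hij])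
  let e := Equiv.ofBijective τ (Finite.injective_iff_bijective.mp hτi)
  refine ⟨e.symm, fun i => ?_⟩
  rw [← hτ]
  exact congrArg b (e.apply_symm_apply i).symm

end Invariants

/-! ### Invariant forms of degree at most three are trace polynomials -/

section InvariantForms

variable {K : Type u} [Field K] {n : ℕ}

/-- An invariant multilinear form that vanishes on the permutations of distinct matrix units is
zero. -/
theorem multilinear_eq_zero_of_perm [CharZero K] {k : ℕ}
    (U : MultilinearMap K (fun _ : Fin k => Matrix (Fin n) (Fin n) K) K)
    (hU : ∀ g m, U (fun i => conjRep K n g (m i)) = U m)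
    {f : Fin k → Fin n} (hf : Function.Injective f)
    (h : ∀ σ : Equiv.Perm (Fin k), U (fun i => Matrix.single (f i) (f (σ i)) 1) = 0) : U = 0 := by
  refine multilinear_eq_zero_of_invariant U hU hf fun b => ?_
  by_contra hb
  obtain ⟨σ, hσ⟩ := exists_perm_of_apply_single_ne_zero U hU hf hb
  exact hb (by simpa only [hσ] using h σ)

theorem exists_eq_mul_trace [CharZero K] (hn : 1 ≤ n) (T : Matrix (Fin n) (Fin n) K →ₗ[K] K)
    (hT : ∀ g A, T (conjRep K n g A) = T A) : ∃ c, ∀ A, T A = c * A.trace := by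
  refine ⟨T (Matrix.single ⟨0, hn⟩ ⟨0, hn⟩ 1), fun A => ?_⟩
  let U : MultilinearMap K (fun _ : Fin 1 => Matrix (Fin n) (Fin n) K) K :=
    MultilinearMap.mk' (fun m => T (m 0) - T (Matrix.single ⟨0, hn⟩ ⟨0, hn⟩ 1) * (m 0).trace)
      (fun m i x y => by fin_cases i; simp; ring) (fun m i c x => by fin_cases i; simp; ring)
  have hU : U = 0 := by
    refine multilinear_eq_zero_of_perm U (fun g m => ?_)
      (Function.injective_of_subsingleton fun _ : Fin 1 => (⟨0, hn⟩ : Fin n)) fun σ => ?_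
    · change T _ - _ = T _ - _
      rw [hT, trace_conjRep]
    · simp [U]
  exact sub_eq_zero.mp (congrArg (fun V => V fun _ => A) hU)

theorem exists_eq_trace_bilinear [CharZero K] (hn : 2 ≤ n)
    (T : Matrix (Fin n) (Fin n) K →ₗ[K] Matrix (Fin n) (Fin n) K →ₗ[K] K)
    (hT : ∀ g A B, T (conjRep K n g A) (conjRep K n g B) = T A B) :
    ∃ c₀ c₁, ∀ A B, T A B = c₀ * (A.trace * B.trace) + c₁ * (A * B).trace := by
  let f := Fin.castLE hn
  have hf : Function.Injective f := Fin.castLE_injective hn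
  let E (i j : Fin 2) : Matrix (Fin n) (Fin n) K := Matrix.single (f i) (f j) 1
  refine ⟨T (E 0 0) (E 1 1), T (E 0 1) (E 1 0), fun A B => ?_⟩
  let U : MultilinearMap K (fun _ : Fin 2 => Matrix (Fin n) (Fin n) K) K :=
    MultilinearMap.mk' (fun m => T (m 0) (m 1) -
        (T (E 0 0) (E 1 1) * ((m 0).trace * (m 1).trace) +
          T (E 0 1) (E 1 0) * (m 0 * m 1).trace))
      (fun m i x y => by fin_cases i <;> simp [add_mul, mul_add] <;> ring)
      (fun m i c x => by fin_cases i <;> simp <;> ring)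
  have hU : U = 0 := by
    refine multilinear_eq_zero_of_perm U (fun g m => ?_) hf fun σ => ?_
    · change T _ _ - _ = T _ _ - _
      simp only [hT, ← conjRep_mul, trace_conjRep]
    · have key : ∀ p q : Fin 2, p ≠ q → p = 0 ∧ q = 1 ∨ p = 1 ∧ q = 0 := by decide
      rcases key _ _ (σ.injective.ne (show (0 : Fin 2) ≠ 1 by decide)) with h | h <;>
      simp [U, h.1, h.2, hf.eq_iff, E]
  exact sub_eq_zero.mp (congrArg (fun V => V ![A, B]) hU)

/-- The six trace monomials correspond to the cycle types of the six permutations of three letters.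
On the tuple $(E_{f(i),f(\sigma i)})_i$ the monomial of $\sigma$ is 1 and the others are 0, so the
values of `T` there are the coefficients, and the difference vanishes by
`multilinear_eq_zero_of_perm`. Three distinct indices are needed, hence $n\ge3$. -/
theorem exists_eq_trace_trilinear [CharZero K] (hn : 3 ≤ n)
    (T : Matrix (Fin n) (Fin n) K →ₗ[K] Matrix (Fin n) (Fin n) K →ₗ[K]
      Matrix (Fin n) (Fin n) K →ₗ[K] K)
    (hT : ∀ g A B C, T (conjRep K n g A) (conjRep K n g B) (conjRep K n g C) = T A B C) :
    ∃ c : Fin 6 → K, ∀ A B C, T A B C =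
      c 0 * (A.trace * B.trace * C.trace) + c 1 * ((A * B).trace * C.trace) +
      c 2 * ((A * C).trace * B.trace) + c 3 * ((B * C).trace * A.trace) +
      c 4 * (A * B * C).trace + c 5 * (A * C * B).trace := by
  let f := Fin.castLE hn
  have hf : Function.Injective f := Fin.castLE_injective hn
  let E (i j : Fin 3) : Matrix (Fin n) (Fin n) K := Matrix.single (f i) (f j) 1
  let c : Fin 6 → K := ![T (E 0 0) (E 1 1) (E 2 2), T (E 0 1) (E 1 0) (E 2 2),
    T (E 0 2) (E 1 1) (E 2 0), T (E 0 0) (E 1 2) (E 2 1), T (E 0 1) (E 1 2) (E 2 0),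
    T (E 0 2) (E 1 0) (E 2 1)]
  refine ⟨c, fun A B C => ?_⟩
  let U : MultilinearMap K (fun _ : Fin 3 => Matrix (Fin n) (Fin n) K) K :=
    MultilinearMap.mk' (fun m => T (m 0) (m 1) (m 2) -
        (c 0 * ((m 0).trace * (m 1).trace * (m 2).trace) +
          c 1 * ((m 0 * m 1).trace * (m 2).trace) +
          c 2 * ((m 0 * m 2).trace * (m 1).trace) + c 3 * ((m 1 * m 2).trace * (m 0).trace) +
          c 4 * (m 0 * m 1 * m 2).trace + c 5 * (m 0 * m 2 * m 1).trace))
      (fun m i x y => by fin_cases i <;> simp [add_mul, mul_add] <;> ring)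
      (fun m i c x => by fin_cases i <;> simp <;> ring)
  have hU : U = 0 := by
    refine multilinear_eq_zero_of_perm U (fun g m => ?_) hf fun σ => ?_
    · change T _ _ _ - _ = T _ _ _ - _
      simp only [hT, ← conjRep_mul, trace_conjRep]
    · have key : ∀ p q r : Fin 3, p ≠ q → p ≠ r → q ≠ r →
          p = 0 ∧ q = 1 ∧ r = 2 ∨ p = 0 ∧ q = 2 ∧ r = 1 ∨ p = 1 ∧ q = 0 ∧ r = 2 ∨
          p = 1 ∧ q = 2 ∧ r = 0 ∨ p = 2 ∧ q = 0 ∧ r = 1 ∨ p = 2 ∧ q = 1 ∧ r = 0 := by decide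
      rcases key _ _ _ (σ.injective.ne (show (0 : Fin 3) ≠ 1 by decide))
        (σ.injective.ne (show (0 : Fin 3) ≠ 2 by decide))
        (σ.injective.ne (show (1 : Fin 3) ≠ 2 by decide)) with h | h | h | h | h | h <;>
      simp [U, h.1, h.2.1, h.2.2, hf.eq_iff, c, E]
  exact sub_eq_zero.mp (congrArg (fun V => V ![A, B, C]) hU)

end InvariantForms

/-! ### Equivariant maps between copies of the trivial and the adjoint representation -/

section SlHoms

variable {K : Type u} [Field K] {n : ℕ}

theorem coe_adRep (g : GL (Fin n) K) (A : Sl K n) :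
    (adRep K n g A).1 = conjRep K n g A.1 := rfl

/-- The projection of all matrices onto the traceless ones. -/
def slProj (K : Type u) [Field K] [CharZero K] (n : ℕ) : Matrix (Fin n) (Fin n) K →ₗ[K] Sl K n where
  toFun X := ⟨slPart X, trace_slPart X⟩
  map_add' X Y := Subtype.ext (slPart_add X Y)
  map_smul' c X := Subtype.ext (slPart_smul c X)

theorem slProj_coe [CharZero K] (A : Sl K n) : slProj K n A.1 = A :=
  Subtype.ext (by
    change A.1 - (A.1.trace / n) • 1 = A.1
    rw [mem_sl.mp A.2, zero_div, zero_smul, sub_zero])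

theorem slProj_conjRep [CharZero K] (g : GL (Fin n) K) (X : Matrix (Fin n) (Fin n) K) :
    slProj K n (conjRep K n g X) = adRep K n g (slProj K n X) :=
  Subtype.ext (by
    change conjRep K n g X - scalarPart (conjRep K n g X) • 1 =
      conjRep K n g (X - scalarPart X • 1)
    rw [map_sub, map_smul, conjRep_one, scalarPart, trace_conjRep, scalarPart])

theorem trace_conjRep_mul_conjRep (g : GL (Fin n) K) (A B : Matrix (Fin n) (Fin n) K) :
    (conjRep K n g A * conjRep K n g B).trace = (A * B).trace := by
  rw [← conjRep_mul, trace_conjRep]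

/-- The linear form `C ↦ tr (A C)`. -/
def traceMul : Matrix (Fin n) (Fin n) K →ₗ[K] Matrix (Fin n) (Fin n) K →ₗ[K] K :=
  (LinearMap.mul K (Matrix (Fin n) (Fin n) K)).compr₂ (Matrix.traceLinearMap (Fin n) K K)

theorem traceMul_apply (A B : Matrix (Fin n) (Fin n) K) : traceMul A B = (A * B).trace := rfl

theorem eq_of_trace_mul_eq {A B : Matrix (Fin n) (Fin n) K}
    (h : ∀ C : Matrix (Fin n) (Fin n) K, (A * C).trace = (B * C).trace) : A = B :=
  Matrix.ext_iff_trace_mul_right.mpr h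

theorem smul_one_of_trace_mul {A : Matrix (Fin n) (Fin n) K} {c : K}
    (h : ∀ C, (A * C).trace = c * C.trace) : A = c • 1 :=
  eq_of_trace_mul_eq fun C => by rw [h, Matrix.smul_mul, one_mul, Matrix.trace_smul, smul_eq_mul]

/-- The linear form $C\mapsto\operatorname{tr}(AC)$ is invariant, hence a multiple of the trace. So
$A$ is scalar, and being traceless it is zero. -/
theorem sl_eq_zero_of_invariant [CharZero K] (hn : 1 ≤ n) {A : Sl K n}
    (hA : ∀ g, adRep K n g A = A) : A = 0 := by
  obtain ⟨c, hc⟩ := exists_eq_mul_trace hn (traceMul A.1) fun g C => by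
    rw [traceMul_apply, traceMul_apply]
    conv_lhs => rw [← hA g, coe_adRep, trace_conjRep_mul_conjRep]
  have h := smul_one_of_trace_mul hc
  have hn' : (n : K) ≠ 0 := by exact_mod_cast (by omega : n ≠ 0)
  have htr : A.1.trace = 0 := A.2
  rw [h] at htr
  have hc0 : c = 0 := by simpa [Matrix.trace_smul, hn'] using htr
  exact Subtype.ext (by rw [h, hc0, zero_smul]; rfl)

theorem sl_dual_eq_zero_of_invariant [CharZero K] (hn : 1 ≤ n) (φ : Sl K n →ₗ[K] K)
    (hφ : ∀ g A, φ (adRep K n g A) = φ A) : φ = 0 := by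
  obtain ⟨c, hc⟩ := exists_eq_mul_trace hn (φ ∘ₗ slProj K n) fun g C => by
    rw [LinearMap.comp_apply, slProj_conjRep, hφ]; rfl
  ext A
  have h := hc A.1
  rw [LinearMap.comp_apply, slProj_coe, mem_sl.mp A.2, mul_zero] at h
  exact h

theorem sl_form_eq_of_invariant [CharZero K] (hn : 2 ≤ n) (φ : Sl K n →ₗ[K] Sl K n →ₗ[K] K)
    (hφ : ∀ g A B, φ (adRep K n g A) (adRep K n g B) = φ A B) :
    ∃ c : K, ∀ A B, φ A B = c * (A.1 * B.1).trace := by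
  obtain ⟨c₀, c₁, hc⟩ := exists_eq_trace_bilinear hn
    (φ.compl₁₂ (slProj K n) (slProj K n)) fun g A B => by
      simp only [LinearMap.compl₁₂_apply, slProj_conjRep, hφ]
  refine ⟨c₁, fun A B => ?_⟩
  have h := hc A.1 B.1
  rwa [LinearMap.compl₁₂_apply, slProj_coe, slProj_coe, mem_sl.mp A.2, zero_mul, mul_zero,
    zero_add] at h

/-- Pairing $\varphi(A)$ with a matrix by the trace form gives an invariant bilinear form. Its
$\operatorname{tr}A\operatorname{tr}C$ part vanishes on traceless $A$, and nondegeneracy of the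
trace form recovers $\varphi$. -/
theorem sl_end_eq_of_equivariant [CharZero K] (hn : 2 ≤ n) (φ : Sl K n →ₗ[K] Sl K n)
    (hφ : ∀ g A, φ (adRep K n g A) = adRep K n g (φ A)) : ∃ c : K, ∀ A, φ A = c • A := by
  obtain ⟨c₀, c₁, hc⟩ := exists_eq_trace_bilinear hn
    (traceMul ∘ₗ (slSub K n).subtype ∘ₗ φ ∘ₗ slProj K n) fun g A B => by
      change ((φ (slProj K n (conjRep K n g A))).1 * conjRep K n g B).trace =
        ((φ (slProj K n A)).1 * B).trace
      rw [slProj_conjRep, hφ, coe_adRep, trace_conjRep_mul_conjRep]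
  refine ⟨c₁, fun A => Subtype.ext (eq_of_trace_mul_eq fun C => ?_)⟩
  have h := hc A.1 C
  change ((φ (slProj K n A.1)).1 * C).trace = _ at h
  rw [slProj_coe, mem_sl.mp A.2, zero_mul, mul_zero, zero_add] at h
  rw [h, Submodule.coe_smul, Matrix.smul_mul, Matrix.trace_smul, smul_eq_mul]

/-- Among the six trace monomials, those with a factor $\operatorname{tr}A$ or $\operatorname{tr}B$
drop out. What remains is $\varphi(A,B)=c_1\operatorname{tr}(AB)I+c_4AB+c_5BA$. Splitting into
antisymmetric and symmetric parts gives the coefficients of $m_1$ and $m_2$. -/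
theorem sl_bilin_eq_of_equivariant [CharZero K] (hn : 3 ≤ n)
    (φ : Sl K n →ₗ[K] Sl K n →ₗ[K] Sl K n)
    (hφ : ∀ g A B, φ (adRep K n g A) (adRep K n g B) = adRep K n g (φ A B)) :
    ∃ a b : K, ∀ A B, φ A B = a • slComm A B + b • slAnti A B := by
  obtain ⟨c, hc⟩ := exists_eq_trace_trilinear hn
    ((φ.compl₁₂ (slProj K n) (slProj K n)).compr₂ (traceMul ∘ₗ (slSub K n).subtype))
    fun g A B C => by
      change ((φ (slProj K n (conjRep K n g A)) (slProj K n (conjRep K n g B))).1 *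
        conjRep K n g C).trace = ((φ (slProj K n A) (slProj K n B)).1 * C).trace
      rw [slProj_conjRep, slProj_conjRep, hφ, coe_adRep, trace_conjRep_mul_conjRep]
  have h (A B : Sl K n) : (φ A B).1 =
      (c 1 * (A.1 * B.1).trace) • 1 + c 4 • (A.1 * B.1) + c 5 • (B.1 * A.1) := by
    refine eq_of_trace_mul_eq fun C => ?_
    have h := hc A.1 B.1 C
    change ((φ (slProj K n A.1) (slProj K n B.1)).1 * C).trace = _ at h
    rw [slProj_coe, slProj_coe, mem_sl.mp A.2, mem_sl.mp B.2] at h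
    rw [h, mul_assoc A.1 C, Matrix.trace_mul_comm A.1 (C * B.1), mul_assoc C,
      Matrix.trace_mul_comm C]
    simp only [add_mul, Matrix.smul_mul, one_mul, Matrix.trace_add, Matrix.trace_smul, smul_eq_mul]
    ring
  have hn' : (n : K) ≠ 0 := by exact_mod_cast (by omega : n ≠ 0)
  refine ⟨(c 4 - c 5) / 2, (c 4 + c 5) / 2, fun A B => Subtype.ext ?_⟩
  have htr : (φ A B).1.trace = 0 := (φ A B).2
  rw [h] at htr ⊢
  rw [Matrix.trace_add, Matrix.trace_add, Matrix.trace_smul, Matrix.trace_smul, Matrix.trace_smul,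
    Matrix.trace_one, Fintype.card_fin, Matrix.trace_mul_comm B.1] at htr
  simp only [smul_eq_mul] at htr
  -- The value is traceless, which fixes the multiple of the identity: it is the correction term of
  -- $m_2$.
  have h1 : c 1 * (A.1 * B.1).trace = - (c 4 + c 5) / 2 * (2 / n * (A.1 * B.1).trace) := by
    field_simp
    linear_combination htr
  rw [h1]
  simp only [slComm, slAnti, Submodule.coe_add, Submodule.coe_smul]
  module

end SlHoms

/-! ### The adjoint representation of $\mathrm{GL}(2)$ -/

section SlTwo

variable {K : Type u} [Field K]

/-- The element `[[a, b], [c, -a]]` of `𝔰𝔩(2)`. -/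
def slTwo (a b c : K) : Sl K 2 :=
  ⟨!![a, b; c, -a], by rw [mem_sl, Matrix.trace_fin_two_of, add_neg_cancel]⟩

theorem slTwo_eq (A : Sl K 2) : A = slTwo (A.1 0 0) (A.1 0 1) (A.1 1 0) := by
  have h : A.1 0 0 + A.1 1 1 = 0 := by rw [← Matrix.trace_fin_two]; exact A.2
  refine Subtype.ext (Matrix.ext fun i j => ?_)
  fin_cases i <;> fin_cases j <;> simp [slTwo]
  linear_combination h

theorem slTwo_inj {a b c a' b' c' : K} :
    slTwo a b c = slTwo a' b' c' ↔ a = a' ∧ b = b' ∧ c = c' := by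
  refine ⟨fun h => ?_, by rintro ⟨rfl, rfl, rfl⟩; rfl⟩
  have h' := congrArg Subtype.val h
  exact ⟨by simpa [slTwo] using congrFun (congrFun h' 0) 0,
    by simpa [slTwo] using congrFun (congrFun h' 0) 1,
    by simpa [slTwo] using congrFun (congrFun h' 1) 0⟩

theorem slTwo_add (a b c a' b' c' : K) :
    slTwo a b c + slTwo a' b' c' = slTwo (a + a') (b + b') (c + c') := by
  refine Subtype.ext (Matrix.ext fun i j => ?_)
  fin_cases i <;> fin_cases j <;> simp [slTwo]; ring

theorem smul_slTwo (t a b c : K) : t • slTwo a b c = slTwo (t * a) (t * b) (t * c) := by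
  refine Subtype.ext (Matrix.ext fun i j => ?_)
  fin_cases i <;> fin_cases j <;> simp [slTwo]

theorem adRep_diagonal_slTwo [CharZero K] (a b c : K) (h : ∀ i, (![2, 1] : Fin 2 → K) i ≠ 0) :
    adRep K 2 (diagonalGL h) (slTwo a b c) = slTwo a (2 * b) (c / 2) := by
  refine Subtype.ext ?_
  change Matrix.diagonal ![2, 1] * !![a, b; c, -a] * Matrix.diagonal _ = !![a, _; _, -a]
  ext i j
  fin_cases i <;> fin_cases j <;> simp [Matrix.mul_diagonal, Matrix.diagonal_mul] <;> field_simp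

theorem adRep_swap_slTwo (a b c : K) :
    adRep K 2 (permGL K (Equiv.swap 0 1)) (slTwo a b c) = slTwo (-a) c b := by
  refine Subtype.ext ?_
  change (Equiv.swap (0 : Fin 2) 1)⁻¹.permMatrix K * !![a, b; c, -a] *
    (Equiv.swap (0 : Fin 2) 1).permMatrix K = !![-a, c; b, - -a]
  have h : (Equiv.swap (0 : Fin 2) 1).permMatrix K = !![0, 1; 1, 0] := by
    ext i j
    fin_cases i <;> fin_cases j <;> simp [Equiv.Perm.permMatrix, PEquiv.toMatrix_apply]
  rw [Equiv.swap_inv, h]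
  ext i j
  fin_cases i <;> fin_cases j <;> simp [Matrix.mul_apply]

theorem adRep_transvection_slTwo (a b c : K) :
    adRep K 2 (transvectionGL (show (0 : Fin 2) ≠ 1 by decide) 1) (slTwo a b c) =
      slTwo (a + c) (b - 2 * a - c) c := by
  refine Subtype.ext ?_
  change Matrix.transvection 0 1 1 * !![a, b; c, -a] * Matrix.transvection 0 1 (-1) =
    !![a + c, _; c, -(a + c)]
  ext i j
  fin_cases i <;> fin_cases j <;>
    simp [Matrix.transvection, Matrix.mul_apply, Matrix.add_apply] <;> ring

/-- Three matrices exceed the size 2, so the trilinear argument is unavailable. Instead, invariance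
under one diagonal matrix, the swap and one transvection determines $\varphi$ on the basis $E,F,H$
up to one scalar. -/
theorem sl_two_bilin_eq_of_equivariant [CharZero K] (φ : Sl K 2 →ₗ[K] Sl K 2 →ₗ[K] Sl K 2)
    (hφ : ∀ g A B, φ (adRep K 2 g A) (adRep K 2 g B) = adRep K 2 g (φ A B)) :
    ∃ a : K, ∀ A B, φ A B = a • slComm A B := by
  have h2 : ∀ i, (![2, 1] : Fin 2 → K) i ≠ 0 := by
    intro i; fin_cases i <;> simp
  let E : Sl K 2 := slTwo 0 1 0
  let F : Sl K 2 := slTwo 0 0 1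
  let H : Sl K 2 := slTwo 1 0 0
  have tE : adRep K 2 (diagonalGL h2) E = (2 : K) • E := by
    simp [E, adRep_diagonal_slTwo, smul_slTwo]
  have tF : adRep K 2 (diagonalGL h2) F = (1 / 2 : K) • F := by
    simp [F, adRep_diagonal_slTwo, smul_slTwo]
  have tH : adRep K 2 (diagonalGL h2) H = H := by
    simp [H, adRep_diagonal_slTwo]
  have sE : adRep K 2 (permGL K (Equiv.swap 0 1)) E = F := by simp [E, F, adRep_swap_slTwo]
  have sF : adRep K 2 (permGL K (Equiv.swap 0 1)) F = E := by simp [E, F, adRep_swap_slTwo]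
  have sH : adRep K 2 (permGL K (Equiv.swap 0 1)) H = (-1 : K) • H := by
    simp [H, adRep_swap_slTwo, smul_slTwo]
  have uF : adRep K 2 (transvectionGL (show (0 : Fin 2) ≠ 1 by decide) 1) F =
      F + H + (-1 : K) • E := by
    simp [E, F, H, adRep_transvection_slTwo, smul_slTwo, slTwo_add]
  have uH : adRep K 2 (transvectionGL (show (0 : Fin 2) ≠ 1 by decide) 1) H =
      H + (-2 : K) • E := by
    simp [E, H, adRep_transvection_slTwo, smul_slTwo, slTwo_add]
  -- Under $\operatorname{diag}(2,1)$ the vectors $E,H,F$ have the distinct weights $2,1,1/2$. So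
  -- $\varphi(H,E)$ and $\varphi(E,H)$ are multiples of $E$, $\varphi(H,H)$ and $\varphi(E,F)$ are
  -- multiples of $H$, and $\varphi(E,E)$, of weight 4, is zero.
  have weight {X : Sl K 2} {t : K} (hX : adRep K 2 (diagonalGL h2) X = t • X) :
      X.1 0 0 = t * X.1 0 0 ∧ 2 * X.1 0 1 = t * X.1 0 1 ∧ X.1 1 0 / 2 = t * X.1 1 0 := by
    rw [slTwo_eq X, adRep_diagonal_slTwo, smul_slTwo, slTwo_inj] at hX
    simpa using hX
  have hHH := hφ (diagonalGL h2) H H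
  have hEE := hφ (diagonalGL h2) E E
  have hHE := hφ (diagonalGL h2) H E
  have hEH := hφ (diagonalGL h2) E H
  have hEF := hφ (diagonalGL h2) E F
  simp only [tE, tF, tH, map_smul, LinearMap.smul_apply, smul_smul] at hHH hEE hHE hEH hEF
  have wHE := weight hHE.symm
  have wEH := weight hEH.symm
  have wEE := weight hEE.symm
  have wHH := weight (t := 1) (by rw [one_smul, ← hHH])
  have wEF := weight hEF.symm
  obtain ⟨l, hl⟩ : ∃ l : K, φ H E = l • E := by
    refine ⟨(φ H E).1 0 1, ?_⟩
    rw [slTwo_eq (φ H E), smul_slTwo, slTwo_inj]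
    refine ⟨?_, by simp [slTwo], ?_⟩
    · linear_combination -wHE.1
    · linear_combination (-2 / 3 : K) * wHE.2.2
  obtain ⟨l', hl'⟩ : ∃ l : K, φ E H = l • E := by
    refine ⟨(φ E H).1 0 1, ?_⟩
    rw [slTwo_eq (φ E H), smul_slTwo, slTwo_inj]
    refine ⟨?_, by simp [slTwo], ?_⟩
    · linear_combination -wEH.1
    · linear_combination (-2 / 3 : K) * wEH.2.2
  have hEE0 : φ E E = 0 := by
    rw [slTwo_eq (φ E E), ← zero_smul K H, smul_slTwo, slTwo_inj]
    refine ⟨?_, ?_, ?_⟩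
    · linear_combination (-1 / 3 : K) * wEE.1
    · linear_combination (-1 / 2 : K) * wEE.2.1
    · linear_combination (-2 / 7 : K) * wEE.2.2
  obtain ⟨m, hm⟩ : ∃ l : K, φ H H = l • H := by
    refine ⟨(φ H H).1 0 0, ?_⟩
    rw [slTwo_eq (φ H H), smul_slTwo, slTwo_inj]
    refine ⟨by simp [slTwo], ?_, ?_⟩
    · linear_combination wHH.2.1
    · linear_combination (-2 : K) * wHH.2.2
  obtain ⟨c, hc⟩ : ∃ l : K, φ E F = l • H := by
    refine ⟨(φ E F).1 0 0, ?_⟩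
    rw [slTwo_eq (φ E F), smul_slTwo, slTwo_inj]
    refine ⟨by simp [slTwo], ?_, ?_⟩
    · linear_combination wEF.2.1
    · linear_combination (-2 : K) * wEF.2.2
  have sHH := hφ (permGL K (Equiv.swap 0 1)) H H
  have sEE := hφ (permGL K (Equiv.swap 0 1)) E E
  have sHE := hφ (permGL K (Equiv.swap 0 1)) H E
  have sEH := hφ (permGL K (Equiv.swap 0 1)) E H
  have sEF := hφ (permGL K (Equiv.swap 0 1)) E F
  simp only [sE, sF, sH, hm, hEE0, hl, hl', hc, map_smul, LinearMap.smul_apply, map_zero]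
    at sHH sEE sHE sEH sEF
  have hFH : φ F H = (-l') • F := by
    rw [neg_eq_neg_one_mul, mul_smul, ← sEH, smul_smul, neg_one_mul, neg_neg, one_smul]
  have hHF : φ H F = (-l) • F := by
    rw [neg_eq_neg_one_mul, mul_smul, ← sHE, smul_smul, neg_one_mul, neg_neg, one_smul]
  -- The swap maps $H$ to $-H$, so $\varphi(H,H)=mH$ is both fixed and negated.
  have hm0 : m = 0 := by
    simp only [H, smul_slTwo, slTwo_inj] at sHH
    linear_combination (1 / 2 : K) * sHH.1
  -- The transvection mixes the weight vectors. Its action on $(H,H)$ gives $l'=-l$, from the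
  -- coefficient of $E$, and on $(H,F)$ it gives $c=l/2$, from the coefficient of $H$.
  have u1 := hφ (transvectionGL (show (0 : Fin 2) ≠ 1 by decide) 1) H H
  have u2 := hφ (transvectionGL (show (0 : Fin 2) ≠ 1 by decide) 1) H F
  simp only [uF, uH, hm, hEE0, hl, hl', hc, hHF, hm0, map_smul, map_add, LinearMap.add_apply,
    LinearMap.smul_apply, map_zero, zero_smul, smul_zero, add_zero, zero_add, smul_smul] at u1 u2
  simp only [E, F, H, smul_slTwo, slTwo_add, ← zero_smul K (slTwo (0 : K) 0 0), slTwo_inj] at u1 u2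
  have hll : l' = -l := by linear_combination (-1 / 2 : K) * u1.2.1
  have hcl : c = l / 2 := by linear_combination (-1 / 2 : K) * u2.1
  refine ⟨l / 2, fun A B => ?_⟩
  have dec (X : Sl K 2) : X = X.1 0 0 • H + X.1 0 1 • E + X.1 1 0 • F := by
    conv_lhs => rw [slTwo_eq X]
    simp [E, F, H, smul_slTwo, slTwo_add]
  conv_lhs => rw [dec A, dec B]
  simp only [map_smul, map_add, LinearMap.add_apply, LinearMap.smul_apply, hm, hEE0, hl, hl', hc,
    hHF, hFH, sEE, sEF, hm0, hll, hcl]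
  have hA : A.1 1 1 = - A.1 0 0 := by
    rw [eq_neg_iff_add_eq_zero, add_comm, ← Matrix.trace_fin_two]; exact A.2
  have hB : B.1 1 1 = - B.1 0 0 := by
    rw [eq_neg_iff_add_eq_zero, add_comm, ← Matrix.trace_fin_two]; exact B.2
  refine Subtype.ext (Matrix.ext fun i j => ?_)
  fin_cases i <;> fin_cases j <;>
    simp [E, F, H, slTwo, slComm, Matrix.mul_apply, hA, hB] <;> ring

end SlTwo

/-! ### Irreducibility of the adjoint representation -/

section SlIrreducible

variable {K : Type u} [Field K] {n : ℕ}

theorem conjRep_permGL_single (σ : Equiv.Perm (Fin n)) (i j : Fin n) :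
    conjRep K n (permGL K σ) (Matrix.single i j 1) = Matrix.single (σ i) (σ j) 1 := by
  change σ⁻¹.permMatrix K * _ * σ.permMatrix K = _
  rw [Matrix.single_eq_single_vecMulVec_single, Matrix.mul_vecMulVec, Matrix.vecMulVec_mul,
    Matrix.permMatrix_mulVec, Matrix.vecMul_permMatrix, Matrix.single_eq_single_vecMulVec_single]
  congr 1 <;> ext l <;> simp [Pi.single_apply, Equiv.symm_apply_eq]

theorem conjRep_transvectionGL {i j : Fin n} (h : i ≠ j) (c : K) (A : Matrix (Fin n) (Fin n) K) :
    conjRep K n (transvectionGL h c) A =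
      A + c • (Matrix.single i j 1 * A - A * Matrix.single i j 1) -
        (c * c * A j i) • Matrix.single i j 1 := by
  change Matrix.transvection i j c * A * Matrix.transvection i j (-c) = _
  have hs (d : K) : Matrix.single i j d = d • Matrix.single i j 1 := by simp
  have he : Matrix.single i j 1 * A * Matrix.single i j 1 = A j i • Matrix.single i j (1 : K) := by
    rw [Matrix.single_mul_mul_single]; simp
  rw [Matrix.transvection, Matrix.transvection, hs c, hs (-c)]
  simp only [add_mul, mul_add, one_mul, mul_one, Matrix.smul_mul, Matrix.mul_smul, he]
  module

variable {W : Submodule K (Matrix (Fin n) (Fin n) K)}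

/-- Conjugation by $1+cE_{ij}$ is a quadratic polynomial in $c$ with leading coefficient
$-A_{ji}E_{ij}$. A nonzero off-diagonal entry is therefore isolated by a second difference. If $A$
is diagonal, the quadratic term vanishes and the first difference is $(A_{jj}-A_{ii})E_{ij}$; a
nonzero traceless diagonal matrix has two distinct diagonal entries. -/
theorem exists_single_mem [CharZero K] (hW : ∀ g, ∀ A ∈ W, conjRep K n g A ∈ W)
    {A : Matrix (Fin n) (Fin n) K} (hA : A ∈ W) (htr : A.trace = 0) (h0 : A ≠ 0) :
    ∃ i j, i ≠ j ∧ Matrix.single i j 1 ∈ W := by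
  by_cases hoff : ∃ i j, i ≠ j ∧ A j i ≠ 0
  · obtain ⟨i, j, hij, hne⟩ := hoff
    refine ⟨i, j, hij, (W.smul_mem_iff (mul_ne_zero two_ne_zero hne)).mp ?_⟩
    have h₁ := hW (transvectionGL hij 1) A hA
    have h₂ := hW (transvectionGL hij (-1)) A hA
    rw [conjRep_transvectionGL] at h₁ h₂
    have h₃ := W.sub_mem (W.smul_mem 2 hA) (W.add_mem h₁ h₂)
    convert! h₃ using 1
    module
  · push Not at hoff
    obtain ⟨i, j, hij⟩ : ∃ i j, A i i ≠ A j j := by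
      by_contra! hall
      apply h0
      ext i j
      by_cases hij : i = j
      · subst hij
        have hn : (n : K) ≠ 0 := by
          have := i.pos
          exact_mod_cast this.ne'
        have h : A.trace = n * A i i := by
          simp [Matrix.trace, fun j => hall j i]
        rw [htr] at h
        simpa [hn] using h.symm
      · exact hoff j i (Ne.symm hij)
    have hne : i ≠ j := fun h => hij (by rw [h])
    refine ⟨i, j, hne, (W.smul_mem_iff (sub_ne_zero.mpr hij.symm)).mp ?_⟩
    have h₁ := W.sub_mem (hW (transvectionGL hne 1) A hA) hA
    rw [conjRep_transvectionGL, hoff i j hne] at h₁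
    convert! h₁ using 1
    have hd : A = Matrix.diagonal fun i => A i i := by
      ext k l
      by_cases hkl : k = l
      · subst hkl; simp
      · rw [Matrix.diagonal_apply_ne _ hkl, hoff l k (Ne.symm hkl)]
    have e₁ : Matrix.single i j 1 * A = A j j • Matrix.single i j 1 := by
      rw [hd]; ext k l
      simp only [Matrix.mul_diagonal, Matrix.smul_apply, Matrix.single_apply, Matrix.diagonal_apply_eq]
      split_ifs with h <;> simp [h]
    have e₂ : A * Matrix.single i j 1 = A i i • Matrix.single i j 1 := by
      rw [hd]; ext k l
      simp only [Matrix.diagonal_mul, Matrix.smul_apply, Matrix.single_apply, Matrix.diagonal_apply_eq]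
      split_ifs with h <;> simp [h]
    rw [e₁, e₂]
    module

theorem single_mem_of_single_mem (hW : ∀ g, ∀ A ∈ W, conjRep K n g A ∈ W) {i j : Fin n}
    (hij : i ≠ j) (h : Matrix.single i j 1 ∈ W) {k l : Fin n} (hkl : k ≠ l) :
    Matrix.single k l 1 ∈ W := by
  have inj {a b : Fin n} (hab : a ≠ b) : Function.Injective ![a, b] := by
    intro p q hpq
    fin_cases p <;> fin_cases q <;> simp_all
  obtain ⟨σ, hσ⟩ := Equiv.Perm.exists_extending_pair ![i, j] ![k, l] (inj hij) (inj hkl)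
  have h₀ : σ i = k := hσ 0
  have h₁ : σ j = l := hσ 1
  rw [← h₀, ← h₁, ← conjRep_permGL_single]
  exact hW _ _ h

/-- Conjugating $E_{lk}$ by $1+E_{kl}$ gives $E_{lk}+E_{kk}-E_{ll}-E_{kl}$, in which the
off-diagonal units already lie in `W`. -/
theorem single_sub_single_mem (hW : ∀ g, ∀ A ∈ W, conjRep K n g A ∈ W)
    (h : ∀ k l, k ≠ l → Matrix.single k l 1 ∈ W) (k l : Fin n) :
    Matrix.single k k 1 - Matrix.single l l 1 ∈ W := by
  rcases eq_or_ne k l with rfl | hkl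
  · rw [sub_self]; exact W.zero_mem
  have h₁ := hW (transvectionGL hkl 1) _ (h l k hkl.symm)
  rw [conjRep_transvectionGL] at h₁
  have h₂ := W.add_mem (W.sub_mem h₁ (h l k hkl.symm)) (h k l hkl)
  convert! h₂ using 1
  simp only [one_smul, mul_one, Matrix.single_mul_single_same, Matrix.single_apply_same]
  abel

theorem mem_of_trace_eq_zero (hW : ∀ g, ∀ A ∈ W, conjRep K n g A ∈ W)
    (h : ∀ k l, k ≠ l → Matrix.single k l 1 ∈ W) {A : Matrix (Fin n) (Fin n) K}
    (hA : A.trace = 0) : A ∈ W := by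
  rcases Nat.eq_zero_or_pos n with rfl | hn
  · rw [Subsingleton.elim A 0]; exact W.zero_mem
  have key : A = ∑ i, ∑ j, A i j • (Matrix.single i j 1 -
      if i = j then Matrix.single ⟨0, hn⟩ ⟨0, hn⟩ 1 else 0) := by
    simp only [smul_sub, Finset.sum_sub_distrib, smul_ite, smul_zero, Finset.sum_ite_eq,
      Finset.mem_univ, if_true, ← Finset.sum_smul]
    rw [show ∑ i, A i i = 0 from hA, zero_smul, sub_zero]
    conv_lhs => rw [Matrix.matrix_eq_sum_single A]
    simp
  rw [key]
  refine W.sum_mem fun i _ => W.sum_mem fun j _ => W.smul_mem _ ?_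
  split_ifs with hij
  · subst hij; exact single_sub_single_mem hW h i _
  · rw [sub_zero]; exact h i j hij

theorem isIrreducible_of_forall {G : Type v} [Group G] {V : Type w} [AddCommGroup V] [Module K V]
    [Nontrivial V] (ρ : Representation K G V)
    (h : ∀ W : Submodule K V, (∀ g, ∀ v ∈ W, ρ g v ∈ W) → W = ⊥ ∨ W = ⊤) : ρ.IsIrreducible where
  exists_pair_ne := ⟨⊥, ⊤, fun h => bot_ne_top (α := Submodule K V)
    (congrArg Subrepresentation.toSubmodule h)⟩
  eq_bot_or_eq_top W := (h W.toSubmodule fun g _ hv => W.apply_mem_toSubmodule g hv).imp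
    (fun h => Subrepresentation.toSubmodule_injective h)
    (fun h => Subrepresentation.toSubmodule_injective h)

/-- The matrix unit `E_{ij}` as a traceless matrix. -/
def slSingle (K : Type u) [Field K] {i j : Fin n} (h : i ≠ j) : Sl K n :=
  ⟨Matrix.single i j 1, Matrix.trace_single_eq_of_ne _ _ _ h⟩

theorem slSingle_ne_zero {i j : Fin n} (h : i ≠ j) : slSingle K h ≠ 0 := fun h0 => by
  have := congrFun (congrFun (congrArg Subtype.val h0) i) j
  simp [slSingle] at this

theorem nontrivial_sl (hn : 2 ≤ n) : Nontrivial (Sl K n) :=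
  ⟨slSingle K (i := ⟨0, by omega⟩) (j := ⟨1, by omega⟩) (by simp), 0, slSingle_ne_zero _⟩

theorem isIrreducible_adRep [CharZero K] (hn : 2 ≤ n) : (adRep K n).IsIrreducible := by
  have := nontrivial_sl (K := K) hn
  refine isIrreducible_of_forall _ fun W hW => ?_
  by_cases h : W = ⊥
  · exact Or.inl h
  obtain ⟨A, hA, h0⟩ := W.ne_bot_iff.mp h
  have hW' : ∀ g, ∀ B ∈ W.map (slSub K n).subtype, conjRep K n g B ∈ W.map (slSub K n).subtype := by
    rintro g _ ⟨B, hB, rfl⟩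
    exact ⟨adRep K n g B, hW g B hB, rfl⟩
  obtain ⟨i, j, hij, hmem⟩ := exists_single_mem hW' ⟨A, hA, rfl⟩ A.2 fun h => h0 (Subtype.ext h)
  refine Or.inr (eq_top_iff.mpr fun B _ => ?_)
  obtain ⟨B', hB', hBB⟩ := mem_of_trace_eq_zero hW'
    (fun k l hkl => single_mem_of_single_mem hW' hij hmem hkl) (show B.1.trace = 0 from B.2)
  rwa [← Subtype.ext hBB]

theorem isIrreducible_trivial {G : Type v} [Group G] :
    (Representation.trivial K G K).IsIrreducible :=
  isIrreducible_of_forall _ fun W _ => eq_bot_or_eq_top W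

end SlIrreducible

/-! ### The bases of morphisms -/

section Labeling

variable {K : Type u} [Field K] {n : ℕ}

theorem linearIndependent_of_eq_one {M : Type*} [AddCommGroup M] [Module K M] {d : ℕ} (hd : d = 1)
    (f : Fin d → M) (h : f ⟨0, by omega⟩ ≠ 0) : LinearIndependent K f := by
  subst hd
  exact LinearIndependent.of_subsingleton 0 h

theorem linearIndependent_of_eq_two {M : Type*} [AddCommGroup M] [Module K M] {d : ℕ} (hd : d = 2)
    (f : Fin d → M)
    (h : ∀ a b : K, a • f ⟨0, by omega⟩ + b • f ⟨1, by omega⟩ = 0 → a = 0 ∧ b = 0) :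
    LinearIndependent K f := by
  subst hd
  have : f = ![f 0, f 1] := by ext i; fin_cases i <;> rfl
  rw [this]
  exact LinearIndependent.pair_iff.mpr h

theorem span_range_eq_top_of_eq_one {M : Type*} [AddCommGroup M] [Module K M] {d : ℕ} (hd : d = 1)
    (f : Fin d → M) (h : ∀ x, ∃ a : K, x = a • f ⟨0, by omega⟩) :
    Submodule.span K (Set.range f) = ⊤ :=
  eq_top_iff.mpr fun x _ => by
    obtain ⟨a, rfl⟩ := h x
    exact Submodule.smul_mem _ _ (Submodule.subset_span ⟨_, rfl⟩)

theorem span_range_eq_top_of_eq_two {M : Type*} [AddCommGroup M] [Module K M] {d : ℕ} (hd : d = 2)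
    (f : Fin d → M) (h : ∀ x, ∃ a b : K, x = a • f ⟨0, by omega⟩ + b • f ⟨1, by omega⟩) :
    Submodule.span K (Set.range f) = ⊤ :=
  eq_top_iff.mpr fun x _ => by
    obtain ⟨a, b, rfl⟩ := h x
    exact Submodule.add_mem _ (Submodule.smul_mem _ _ (Submodule.subset_span ⟨_, rfl⟩))
      (Submodule.smul_mem _ _ (Submodule.subset_span ⟨_, rfl⟩))

section Hom

variable {G : Type v} [Group G] {V₁ V₂ V₃ : Type u} [AddCommGroup V₁] [Module K V₁]
  [AddCommGroup V₂] [Module K V₂] [AddCommGroup V₃] [Module K V₃]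
  {ρ : Representation K G V₁} {σ : Representation K G V₂} {π : Representation K G V₃}

theorem intertwiningMap_tprod_ext {φ ψ : Representation.IntertwiningMap (ρ.tprod σ) π}
    (h : ∀ x y, φ (x ⊗ₜ[K] y) = ψ (x ⊗ₜ[K] y)) : φ = ψ :=
  Representation.IntertwiningMap.ext (TensorProduct.ext' h)

/-- The bilinear map underlying a morphism `V₁ ⊗ V₂ → V₃`. -/
def homBilin (φ : Representation.IntertwiningMap (ρ.tprod σ) π) : V₁ →ₗ[K] V₂ →ₗ[K] V₃ :=
  TensorProduct.curry φ.toLinearMap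

theorem homBilin_equivariant (φ : Representation.IntertwiningMap (ρ.tprod σ) π) (g : G) (x : V₁)
    (y : V₂) : homBilin φ (ρ g x) (σ g y) = π g (homBilin φ x y) :=
  LinearMap.congr_fun (φ.isIntertwining' g) (x ⊗ₜ[K] y)

end Hom

/-- The trivial representation of `GL(n)`. -/
abbrev trivRep (K : Type u) [Field K] (n : ℕ) : Representation K (GL (Fin n) K) K :=
  Representation.trivial K (GL (Fin n) K) K

open Representation (IntertwiningMap)

theorem hom_triv_triv_triv (φ : IntertwiningMap ((trivRep K n).tprod (trivRep K n)) (trivRep K n)) :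
    ∃ a : K, φ = a • mTTT K n := by
  refine ⟨homBilin φ 1 1, intertwiningMap_tprod_ext fun x y => ?_⟩
  change homBilin φ x y = homBilin φ 1 1 * (x * y)
  have h := LinearMap.map_smul₂ (homBilin φ) x 1 y
  have h' := (homBilin φ 1).map_smul y 1
  rw [smul_eq_mul, mul_one, smul_eq_mul] at h h'
  rw [h, h']
  ring

theorem hom_triv_triv_ad [CharZero K] (hn : 2 ≤ n)
    (φ : IntertwiningMap ((trivRep K n).tprod (trivRep K n)) (adRep K n)) : φ = 0 := by
  refine intertwiningMap_tprod_ext fun x y => ?_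
  change homBilin φ x y = 0
  exact sl_eq_zero_of_invariant (by omega) fun g => (homBilin_equivariant φ g x y).symm

theorem hom_triv_ad_triv [CharZero K] (hn : 2 ≤ n)
    (φ : IntertwiningMap ((trivRep K n).tprod (adRep K n)) (trivRep K n)) : φ = 0 := by
  refine intertwiningMap_tprod_ext fun x A => ?_
  change homBilin φ x A = 0
  rw [sl_dual_eq_zero_of_invariant (by omega) (homBilin φ x) fun g => homBilin_equivariant φ g x]
  rfl

theorem hom_ad_triv_triv [CharZero K] (hn : 2 ≤ n)
    (φ : IntertwiningMap ((adRep K n).tprod (trivRep K n)) (trivRep K n)) : φ = 0 := by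
  refine intertwiningMap_tprod_ext fun A x => ?_
  change (homBilin φ).flip x A = 0
  rw [sl_dual_eq_zero_of_invariant (by omega) ((homBilin φ).flip x)
    fun g A => homBilin_equivariant φ g A x]
  rfl

theorem hom_triv_ad_ad [CharZero K] (hn : 2 ≤ n)
    (φ : IntertwiningMap ((trivRep K n).tprod (adRep K n)) (adRep K n)) :
    ∃ a : K, φ = a • mTAA K n := by
  obtain ⟨c, hc⟩ := sl_end_eq_of_equivariant hn (homBilin φ 1)
    fun g => homBilin_equivariant φ g 1
  refine ⟨c, intertwiningMap_tprod_ext fun x A => ?_⟩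
  change homBilin φ x A = c • x • A
  conv_lhs => rw [← mul_one x, ← smul_eq_mul, map_smul, LinearMap.smul_apply, hc]
  exact smul_comm _ _ _

theorem hom_ad_triv_ad [CharZero K] (hn : 2 ≤ n)
    (φ : IntertwiningMap ((adRep K n).tprod (trivRep K n)) (adRep K n)) :
    ∃ a : K, φ = a • mATA K n := by
  obtain ⟨c, hc⟩ := sl_end_eq_of_equivariant hn ((homBilin φ).flip 1)
    fun g A => homBilin_equivariant φ g A 1
  refine ⟨c, intertwiningMap_tprod_ext fun A x => ?_⟩
  change (homBilin φ).flip x A = c • x • A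
  conv_lhs => rw [← mul_one x, ← smul_eq_mul, map_smul, LinearMap.smul_apply, hc]
  exact smul_comm _ _ _

theorem hom_ad_ad_triv [CharZero K] (hn : 2 ≤ n)
    (φ : IntertwiningMap ((adRep K n).tprod (adRep K n)) (trivRep K n)) :
    ∃ a : K, φ = a • mAAT K n := by
  obtain ⟨c, hc⟩ := sl_form_eq_of_invariant hn (homBilin φ) (homBilin_equivariant φ)
  exact ⟨c, intertwiningMap_tprod_ext hc⟩

theorem hom_ad_ad_ad [CharZero K] (hn : 3 ≤ n)
    (φ : IntertwiningMap ((adRep K n).tprod (adRep K n)) (adRep K n)) :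
    ∃ a b : K, φ = a • mAAA₁ K n + b • mAAA₂ K n := by
  obtain ⟨a, b, h⟩ := sl_bilin_eq_of_equivariant hn (homBilin φ) (homBilin_equivariant φ)
  exact ⟨a, b, intertwiningMap_tprod_ext h⟩

theorem hom_ad_ad_ad_two [CharZero K]
    (φ : IntertwiningMap ((adRep K 2).tprod (adRep K 2)) (adRep K 2)) :
    ∃ a : K, φ = a • mAAA₁ K 2 := by
  obtain ⟨a, h⟩ := sl_two_bilin_eq_of_equivariant (homBilin φ) (homBilin_equivariant φ)
  exact ⟨a, intertwiningMap_tprod_ext h⟩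

theorem mTTT_ne_zero : mTTT K n ≠ 0 := fun h => by
  have : (1 : K) * 1 = 0 := congrArg (fun φ => φ ((1 : K) ⊗ₜ[K] (1 : K))) h
  simp at this

theorem mTAA_ne_zero (hn : 2 ≤ n) : mTAA K n ≠ 0 := fun h => by
  have := nontrivial_sl (K := K) hn
  obtain ⟨A, hA⟩ := exists_ne (0 : Sl K n)
  have : (1 : K) • A = 0 := congrArg (fun φ => φ ((1 : K) ⊗ₜ[K] A)) h
  exact hA (by simpa using this)

theorem mATA_ne_zero (hn : 2 ≤ n) : mATA K n ≠ 0 := fun h => by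
  have := nontrivial_sl (K := K) hn
  obtain ⟨A, hA⟩ := exists_ne (0 : Sl K n)
  have : (1 : K) • A = 0 := congrArg (fun φ => φ (A ⊗ₜ[K] (1 : K))) h
  exact hA (by simpa using this)

theorem mAAT_ne_zero (hn : 2 ≤ n) : mAAT K n ≠ 0 := fun h => by
  have hij : (⟨0, by omega⟩ : Fin n) ≠ ⟨1, by omega⟩ := by simp
  have : ((slSingle K hij).1 * (slSingle K hij.symm).1).trace = 0 :=
    congrArg (fun φ => φ (slSingle K hij ⊗ₜ[K] slSingle K hij.symm)) h
  simp [slSingle] at this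

theorem mAAA₁_ne_zero (hn : 2 ≤ n) : mAAA₁ K n ≠ 0 := fun h => by
  have hij : (⟨0, by omega⟩ : Fin n) ≠ ⟨1, by omega⟩ := by simp
  have : slComm (slSingle K hij) (slSingle K hij.symm) = 0 :=
    congrArg (fun φ => φ (slSingle K hij ⊗ₜ[K] slSingle K hij.symm)) h
  have := congrFun (congrFun (congrArg Subtype.val this) ⟨0, by omega⟩) ⟨0, by omega⟩
  simp [slSingle, slComm] at this

theorem mAAA_independent [CharZero K] (hn : 3 ≤ n) (a b : K)
    (h : a • mAAA₁ K n + b • mAAA₂ K n = 0) : a = 0 ∧ b = 0 := by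
  have h01 : (⟨0, by omega⟩ : Fin n) ≠ ⟨1, by omega⟩ := by simp
  have h12 : (⟨1, by omega⟩ : Fin n) ≠ ⟨2, by omega⟩ := by simp
  have h20 : (⟨2, by omega⟩ : Fin n) ≠ ⟨0, by omega⟩ := by simp
  -- With $A=E_{01}$, $B=E_{12}$ one has $AB=E_{02}$ and $BA=0$, so the entry at $(0,2)$ is $a+b$.
  -- Exchanging $A$ and $B$ gives $-a+b$.
  have h₁ : a • slComm (slSingle K h01) (slSingle K h12) +
      b • slAnti (slSingle K h01) (slSingle K h12) = 0 :=
    congrArg (fun φ => φ (slSingle K h01 ⊗ₜ[K] slSingle K h12)) h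
  have h₂ : a • slComm (slSingle K h12) (slSingle K h01) +
      b • slAnti (slSingle K h12) (slSingle K h01) = 0 :=
    congrArg (fun φ => φ (slSingle K h12 ⊗ₜ[K] slSingle K h01)) h
  have e₁ := congrFun (congrFun (congrArg Subtype.val h₁) ⟨0, by omega⟩) ⟨2, by omega⟩
  have e₂ := congrFun (congrFun (congrArg Subtype.val h₂) ⟨0, by omega⟩) ⟨2, by omega⟩
  simp [slSingle, slComm, slAnti, Matrix.single_mul_single_of_ne] at e₁ e₂
  exact ⟨by linear_combination (1 / 2 : K) * (e₁ - e₂), by linear_combination (1 / 2 : K) * (e₁ + e₂)⟩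

theorem isPartialLabeling_glLabeling [CharZero K] (hn : 2 ≤ n) :
    (glLabeling K n).IsPartialLabeling where
  finite i := by
    cases i
    · exact inferInstanceAs (FiniteDimensional K K)
    · exact inferInstanceAs (FiniteDimensional K (Sl K n))
  irreducible i := by
    cases i
    · exact isIrreducible_trivial
    · exact isIrreducible_adRep hn
  eq_of_equiv i j := by
    have key (e : (trivRep K n).Equiv (adRep K n)) : False := by
      -- The image of 1 would be an invariant traceless matrix.
      have h : e (1 : K) = 0 := sl_eq_zero_of_invariant (by omega) fun g =>
        (LinearMap.congr_fun (e.isIntertwining' g) (1 : K)).symm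
      exact one_ne_zero ((EquivLike.injective e) (h.trans (map_zero e).symm))
    rintro ⟨e⟩
    cases i <;> cases j
    · rfl
    · exact (key e).elim
    · exact (key (Representation.Equiv.symm (ρ := adRep K n) (σ := trivRep K n) e)).elim
    · rfl
  linearIndependent i j k := by
    cases i <;> cases j <;> cases k
    · exact linearIndependent_of_eq_one rfl _ mTTT_ne_zero
    · exact linearIndependent_empty_type (ι := Fin 0)
    · exact linearIndependent_empty_type (ι := Fin 0)
    · exact linearIndependent_of_eq_one rfl _ (mTAA_ne_zero hn)
    · exact linearIndependent_empty_type (ι := Fin 0)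
    · exact linearIndependent_of_eq_one rfl _ (mATA_ne_zero hn)
    · exact linearIndependent_of_eq_one rfl _ (mAAT_ne_zero hn)
    · by_cases h2 : n = 2
      · exact linearIndependent_of_eq_one (if_pos h2) _ (mAAA₁_ne_zero hn)
      · exact linearIndependent_of_eq_two (if_neg h2) _ (mAAA_independent (by omega))
  span_eq_top i j k := by
    cases i <;> cases j <;> cases k
    · exact span_range_eq_top_of_eq_one rfl _ hom_triv_triv_triv
    · exact eq_top_iff.mpr fun φ _ => by
        rw [show φ = 0 from hom_triv_triv_ad hn φ]; exact Submodule.zero_mem _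
    · exact eq_top_iff.mpr fun φ _ => by
        rw [show φ = 0 from hom_triv_ad_triv hn φ]; exact Submodule.zero_mem _
    · exact span_range_eq_top_of_eq_one rfl _ (hom_triv_ad_ad hn)
    · exact eq_top_iff.mpr fun φ _ => by
        rw [show φ = 0 from hom_ad_triv_triv hn φ]; exact Submodule.zero_mem _
    · exact span_range_eq_top_of_eq_one rfl _ (hom_ad_triv_ad hn)
    · exact span_range_eq_top_of_eq_one rfl _ (hom_ad_ad_triv hn)
    · by_cases h2 : n = 2
      · subst h2
        exact span_range_eq_top_of_eq_one rfl _ hom_ad_ad_ad_two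
      · exact span_range_eq_top_of_eq_two (if_neg h2) _ (hom_ad_ad_ad (by omega))

end Labeling

/-! ### Grassmann algebras with six generators: bracket and differential -/

/-- Anticommuting generators `θ` of an algebra, with the odd derivations `D i` dual to the first six
of them and the parity involution `inv`. -/
structure GrassmannSystem (K : Type u) (C : Type v) [Field K] [Ring C] [Algebra K C] where
  /-- the generators -/
  θ : ℕ → C
  /-- the partial derivatives -/
  D : ℕ → C →ₗ[K] C
  /-- the parity involution -/
  inv : C →ₗ[K] C
  anticomm : ∀ i j, θ i * θ j = -(θ j * θ i)
  sq : ∀ i, θ i * θ i = 0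
  D_one : ∀ i, D i 1 = 0
  D_gen_mul : ∀ i j x, i < 6 → D i (θ j * x) = (if i = j then x else 0) - θ j * D i x
  /-- the constant term -/
  ε : C →ₗ[K] K
  gen_eq_zero : ∀ i, 6 ≤ i → θ i = 0
  inv_one : inv 1 = 1
  inv_gen_mul : ∀ j x, inv (θ j * x) = -(θ j * inv x)
  ε_one : ε 1 = 1
  ε_gen_mul : ∀ j x, ε (θ j * x) = 0
  induct : ∀ W : Submodule K C, 1 ∈ W → (∀ j, ∀ x ∈ W, θ j * x ∈ W) → W = ⊤

namespace GrassmannSystem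

variable {K : Type u} {C : Type v} [Field K] [Ring C] [Algebra K C] (G : GrassmannSystem K C)

section Algebra

/-- Induction on monomials by multiplication with generators from the left; every sign rule below is
proved in this way. -/
theorem ext_linear (G : GrassmannSystem K C) {M : Type*} [AddCommGroup M] [Module K M]
    {f g : C →ₗ[K] M} (h1 : f 1 = g 1)
    (h : ∀ j x, f x = g x → f (G.θ j * x) = g (G.θ j * x)) : f = g := by
  have := G.induct (LinearMap.eqLocus f g) h1 h
  exact LinearMap.ext fun x => (this ▸ Submodule.mem_top : x ∈ LinearMap.eqLocus f g)

theorem inv_mul (x y : C) : G.inv (x * y) = G.inv x * G.inv y := by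
  have := G.ext_linear (f := G.inv ∘ₗ (LinearMap.mul K C).flip y)
    (g := (LinearMap.mul K C).flip (G.inv y) ∘ₗ G.inv) (by simp [G.inv_one])
    (fun j x h => by
      simp only [LinearMap.comp_apply, LinearMap.flip_apply, LinearMap.mul_apply'] at h ⊢
      rw [mul_assoc, inv_gen_mul, h, inv_gen_mul, neg_mul, mul_assoc])
  exact LinearMap.congr_fun this x

theorem inv_inv (x : C) : G.inv (G.inv x) = x := by
  have := G.ext_linear (f := G.inv ∘ₗ G.inv) (g := LinearMap.id) (by simp [G.inv_one])
    (fun j x h => by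
      simp only [LinearMap.comp_apply, LinearMap.id_apply] at h ⊢
      rw [inv_gen_mul, map_neg, inv_gen_mul, h, neg_neg])
  exact LinearMap.congr_fun this x

theorem inv_gen (j : ℕ) : G.inv (G.θ j) = - G.θ j := by
  simpa [G.inv_one] using G.inv_gen_mul j 1

theorem D_gen {i : ℕ} (hi : i < 6) (j : ℕ) : G.D i (G.θ j) = if i = j then 1 else 0 := by
  simpa [G.D_one] using G.D_gen_mul i j 1 hi

theorem mul_gen (x : C) (j : ℕ) : x * G.θ j = G.θ j * G.inv x := by
  have := G.ext_linear (f := (LinearMap.mul K C).flip (G.θ j))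
    (g := LinearMap.mul K C (G.θ j) ∘ₗ G.inv) (by simp [G.inv_one])
    (fun i x h => by
      simp only [LinearMap.comp_apply, LinearMap.flip_apply, LinearMap.mul_apply'] at h ⊢
      rw [mul_assoc, h, inv_gen_mul, ← mul_assoc, G.anticomm i j, neg_mul, mul_neg, mul_assoc])
  exact LinearMap.congr_fun this x

theorem D_mul {i : ℕ} (hi : i < 6) (x y : C) :
    G.D i (x * y) = G.D i x * y + G.inv x * G.D i y := by
  have := G.ext_linear (f := G.D i ∘ₗ (LinearMap.mul K C).flip y)
    (g := (LinearMap.mul K C).flip y ∘ₗ G.D i + (LinearMap.mul K C).flip (G.D i y) ∘ₗ G.inv)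
    (by simp [G.inv_one, G.D_one])
    (fun j x h => by
      simp only [LinearMap.comp_apply, LinearMap.flip_apply, LinearMap.mul_apply',
        LinearMap.add_apply] at h ⊢
      rw [mul_assoc, G.D_gen_mul _ _ _ hi, h, G.D_gen_mul _ _ _ hi, inv_gen_mul]
      split_ifs <;> noncomm_ring)
  exact LinearMap.congr_fun this x

theorem D_inv {i : ℕ} (hi : i < 6) (x : C) : G.D i (G.inv x) = - G.inv (G.D i x) := by
  have := G.ext_linear (f := G.D i ∘ₗ G.inv) (g := -(G.inv ∘ₗ G.D i))
    (by simp [G.inv_one, G.D_one])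
    (fun j x h => by
      simp only [LinearMap.comp_apply, LinearMap.neg_apply] at h ⊢
      rw [inv_gen_mul, map_neg, G.D_gen_mul _ _ _ hi, G.D_gen_mul _ _ _ hi, h, map_sub, inv_gen_mul]
      split_ifs <;> simp)
  exact LinearMap.congr_fun this x

/-- The bracket `{a, b} = -∑_k (D_{k + 3} (inv a)) (D_k b)`, with indices modulo six. -/
def br (a b : C) : C := - ∑ k ∈ Finset.range 6, G.D ((k + 3) % 6) (G.inv a) * G.D k b

/-- The bracket as a bilinear map. -/
def brLin : C →ₗ[K] C →ₗ[K] C :=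
  - ∑ k ∈ Finset.range 6, (LinearMap.mul K C).compl₁₂ (G.D ((k + 3) % 6) ∘ₗ G.inv) (G.D k)

theorem brLin_apply (a b : C) : G.brLin a b = G.br a b := by
  simp [brLin, br, LinearMap.sum_apply]

theorem br_one (a : C) : G.br a 1 = 0 := by simp [br, G.D_one]

/-- Moving the generator to the left past $D_{k+3}(\mathrm{inv}\,a)$ applies the involution to that
factor. Since the derivations anticommute with the involution, this is absorbed, together with the
sign from $D_k(\theta_jx)$, in replacing $a$ by $\mathrm{inv}\,a$. -/
theorem br_gen_mul (a : C) (j : ℕ) (x : C) :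
    G.br a (G.θ j * x) = G.br a (G.θ j) * x + G.θ j * G.br (G.inv a) x := by
  simp only [br, neg_mul, mul_neg, Finset.sum_mul, Finset.mul_sum, ← neg_add,
    ← Finset.sum_add_distrib]
  congr 1
  refine Finset.sum_congr rfl fun k hk => ?_
  have hk' : k < 6 := Finset.mem_range.mp hk
  have h3 : (k + 3) % 6 < 6 := Nat.mod_lt _ (by norm_num)
  rw [G.D_gen_mul _ _ _ hk', G.D_gen hk', G.D_inv h3 (G.inv a), mul_sub, ← mul_assoc,
    G.mul_gen _ j]
  split_ifs <;> simp [mul_assoc, sub_eq_add_neg]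

theorem inv_br (a b : C) : G.inv (G.br a b) = G.br (G.inv a) (G.inv b) := by
  simp only [br, map_neg, map_sum]
  congr 1
  refine Finset.sum_congr rfl fun k hk => ?_
  rw [inv_mul, G.D_inv (Nat.mod_lt _ (by norm_num)) (G.inv a), G.D_inv (Finset.mem_range.mp hk),
    neg_mul_neg]

/-- The elements `x` with `{a, x y} = {a, x} y + x {a, y}`. -/
def IsEvenDer (x : C) : Prop := ∀ a y, G.br a (x * y) = G.br a x * y + x * G.br a y

theorem isEvenDer_gen_mul_gen (i j : ℕ) : G.IsEvenDer (G.θ i * G.θ j) := by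
  intro a y
  rw [mul_assoc, br_gen_mul, br_gen_mul, G.br_gen_mul a i (G.θ j), inv_inv]
  noncomm_ring

variable {G} in
theorem IsEvenDer.neg {x : C} (hx : G.IsEvenDer x) : G.IsEvenDer (-x) := by
  intro a y
  simp only [← brLin_apply, neg_mul, map_neg]
  rw [brLin_apply, hx, brLin_apply, neg_add, brLin_apply]

theorem isEvenDer_zero : G.IsEvenDer 0 := by
  intro a y
  simp [← brLin_apply]

end Algebra

section Differential

/-- The differential of the Heisenberg Lie algebra. -/
def d (x : C) : C := G.br (G.θ 0 * G.θ 1 * G.θ 5) x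

/-- The differential as a linear map. -/
def dLin : C →ₗ[K] C := G.brLin (G.θ 0 * G.θ 1 * G.θ 5)

theorem dLin_apply (x : C) : G.dLin x = G.d x := G.brLin_apply _ _

theorem d_gen_mul (j : ℕ) (x : C) : G.d (G.θ j * x) = G.d (G.θ j) * x - G.θ j * G.d x := by
  simp only [d, br_gen_mul, inv_mul, inv_gen, neg_mul_neg, sub_eq_add_neg]
  simp only [← brLin_apply, mul_neg, map_neg, LinearMap.neg_apply]

theorem d_one : G.d 1 = 0 := G.br_one _

theorem d_inv (x : C) : G.d (G.inv x) = - G.inv (G.d x) := by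
  rw [d, d, inv_br, inv_mul, inv_mul, inv_gen, inv_gen, inv_gen, neg_mul_neg, mul_neg]
  simp only [← brLin_apply, map_neg, LinearMap.neg_apply, neg_neg]

theorem d_mul (x y : C) : G.d (x * y) = G.d x * y + G.inv x * G.d y := by
  have := G.ext_linear (f := G.dLin ∘ₗ (LinearMap.mul K C).flip y)
    (g := (LinearMap.mul K C).flip y ∘ₗ G.dLin + (LinearMap.mul K C).flip (G.d y) ∘ₗ G.inv)
    (by simp [G.inv_one, dLin_apply, d_one])
    (fun j x h => by
      simp only [LinearMap.comp_apply, LinearMap.flip_apply, LinearMap.mul_apply',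
        LinearMap.add_apply, dLin_apply] at h ⊢
      rw [mul_assoc, d_gen_mul, h, d_gen_mul, inv_gen_mul]
      noncomm_ring)
  exact LinearMap.congr_fun this x

/-- The failure of the differential to derive the bracket. -/
def jacobiator (a b : C) : C := G.d (G.br a b) - G.br (G.d a) b - G.br (G.inv a) (G.d b)

/-- The failure of the differential to derive the bracket, as a linear map. -/
def jacobiatorLin (a : C) : C →ₗ[K] C :=
  G.dLin ∘ₗ G.brLin a - G.brLin (G.d a) - G.brLin (G.inv a) ∘ₗ G.dLin

theorem jacobiatorLin_apply (a b : C) : G.jacobiatorLin a b = G.jacobiator a b := by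
  simp [jacobiatorLin, jacobiator, brLin_apply, dLin_apply]

/-- The jacobiator is again a twisted derivation in its second argument, which reduces its vanishing
to generators. The hypothesis `he` is used to expand the bracket of $a$ with $d\theta_j\cdot x$; the
mixed terms then cancel. -/
theorem jacobiator_gen_mul (he : ∀ j, G.IsEvenDer (G.d (G.θ j))) (a : C) (j : ℕ) (x : C) :
    G.jacobiator a (G.θ j * x) =
      G.jacobiator a (G.θ j) * x - G.θ j * G.jacobiator (G.inv a) x := by
  have badd (a x y : C) : G.br a (x + y) = G.br a x + G.br a y := by
    simp only [← brLin_apply, map_add]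
  have bneg (a x : C) : G.br (-a) x = - G.br a x := by
    simp only [← brLin_apply, map_neg, LinearMap.neg_apply]
  have bneg' (a x : C) : G.br a (-x) = - G.br a x := by
    simp only [← brLin_apply, map_neg]
  have dadd (x y : C) : G.d (x + y) = G.d x + G.d y := badd _ _ _
  unfold jacobiator
  rw [br_gen_mul, dadd, d_mul, d_gen_mul, br_gen_mul, d_gen_mul, sub_eq_add_neg (G.d (G.θ j) * x),
    badd, bneg', he j, G.br_gen_mul (G.inv a) j (G.d x), inv_inv, inv_br, inv_gen, bneg', d_inv,
    bneg]
  noncomm_ring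

theorem jacobiator_eq_zero (he : ∀ j, G.IsEvenDer (G.d (G.θ j)))
    (h : ∀ a j, G.jacobiator a (G.θ j) = 0) (a b : C) : G.jacobiator a b = 0 := by
  -- All first arguments are treated at once, because the product rule replaces `a` by its parity
  -- twist.
  let W : Submodule K C := ⨅ a, LinearMap.ker (G.jacobiatorLin a)
  have hW : W = ⊤ := by
    refine G.induct W ?_ fun j x hx => ?_
    · simp only [W, Submodule.mem_iInf, LinearMap.mem_ker, jacobiatorLin_apply, jacobiator, br_one,
        d_one]
      simp [← dLin_apply, ← brLin_apply]
    · simp only [W, Submodule.mem_iInf, LinearMap.mem_ker, jacobiatorLin_apply] at hx ⊢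
      intro a
      rw [G.jacobiator_gen_mul he, h, hx, zero_mul, mul_zero, sub_zero]
  have hb : b ∈ W := hW ▸ Submodule.mem_top
  simp only [W, Submodule.mem_iInf, LinearMap.mem_ker, jacobiatorLin_apply] at hb
  exact hb a

end Differential

end GrassmannSystem

/-! ### Computable Grassmann algebra over the integers -/

/-- Elements of a Grassmann algebra over `ℤ` as binary trees: at level `k`, the tree `node a b`
stands for `a + b θ_k`, with `a` and `b` at level `k + 1`. -/
inductive GTree : Type
  | zero
  | leaf (c : ℤ)
  | node (a b : GTree)

namespace GTree

/-- Adding a constant. -/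
def addLeaf (c : ℤ) : GTree → GTree
  | zero => leaf c
  | leaf c' => leaf (c + c')
  | node a b => node (addLeaf c a) b

/-- Addition. -/
def add : GTree → GTree → GTree
  | zero, t => t
  | leaf c, t => addLeaf c t
  | node a b, zero => node a b
  | node a b, leaf c => node (addLeaf c a) b
  | node a b, node a' b' => node (add a a') (add b b')

/-- Multiplication by an integer. -/
def smul (c : ℤ) : GTree → GTree
  | zero => zero
  | leaf c' => leaf (c * c')
  | node a b => node (smul c a) (smul c b)

/-- Negation. -/
def neg : GTree → GTree
  | zero => zero
  | leaf c => leaf (-c)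
  | node a b => node (neg a) (neg b)

/-- The parity involution. -/
def inv : GTree → GTree
  | zero => zero
  | leaf c => leaf c
  | node a b => node (inv a) (neg (inv b))

/-- Multiplication. -/
def mul : GTree → GTree → GTree
  | zero, _ => zero
  | leaf c, t => smul c t
  | node _ _, zero => zero
  | node a b, leaf c => smul c (node a b)
  | node a b, node c d => node (mul a c) (add (mul a d) (mul b (inv c)))

/-- The derivative with respect to the `i`-th generator. -/
def der : ℕ → GTree → GTree
  | _, zero => zero
  | _, leaf _ => zero
  | 0, node _ b => node (inv b) zero
  | i + 1, node a b => node (der i a) (der i b)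

/-- The constant term. -/
def const : GTree → ℤ
  | zero => 0
  | leaf c => c
  | node a _ => const a

/-- All coefficients are zero. -/
def isZero : GTree → Bool
  | zero => true
  | leaf c => c == 0
  | node a b => isZero a && isZero b

/-- The `j`-th generator. -/
def gen : ℕ → GTree
  | 0 => node zero (leaf 1)
  | j + 1 => node (gen j) zero

/-- The tree involves only `n` generators. -/
def fits : ℕ → GTree → Bool
  | _, zero => true
  | _, leaf _ => true
  | 0, node _ _ => false
  | n + 1, node a b => fits n a && fits n b

/-- The products of distinct generators among the first `n`. -/
def blades : ℕ → List GTree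
  | 0 => [leaf 1]
  | n + 1 => (blades n).map (fun a => node a zero) ++ (blades n).map (fun b => node zero b)

/-- The bracket. -/
def br (a b : GTree) : GTree :=
  neg (add (mul (der 3 (inv a)) (der 0 b)) (add (mul (der 4 (inv a)) (der 1 b))
    (add (mul (der 5 (inv a)) (der 2 b)) (add (mul (der 0 (inv a)) (der 3 b))
      (add (mul (der 1 (inv a)) (der 4 b)) (mul (der 2 (inv a)) (der 5 b)))))))

/-- The differential. -/
def d (t : GTree) : GTree := br (mul (mul (gen 0) (gen 1)) (gen 5)) t

/-- The product of a list of generators. -/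
def word : List ℕ → GTree
  | [] => leaf 1
  | j :: l => mul (gen j) (word l)

/-- The coefficient at a product of distinct generators. -/
def coef : List ℕ → GTree → ℤ
  | [], t => const t
  | j :: l, t => coef l (der j t)

/-- The failure of the differential to derive the bracket. -/
def jacobiator (a b : GTree) : GTree :=
  add (d (br a b)) (neg (add (br (d a) b) (br (inv a) (d b))))

end GTree

/-! ### Evaluation of trees and compatibility of the differential with the bracket -/

namespace GrassmannSystem

variable {K : Type u} {C : Type v} [Field K] [Ring C] [Algebra K C] (G : GrassmannSystem K C)

/-- The element represented by a tree at level `k`. -/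
def eval : ℕ → GTree → C
  | _, .zero => 0
  | _, .leaf c => c
  | k, .node a b => eval (k + 1) a + eval (k + 1) b * G.θ k

theorem eval_addLeaf (c : ℤ) (t : GTree) (k : ℕ) :
    G.eval k (t.addLeaf c) = c + G.eval k t := by
  induction t generalizing k with
  | zero => simp [GTree.addLeaf, eval]
  | leaf c' => simp [GTree.addLeaf, eval]
  | node a b iha ihb => simp [GTree.addLeaf, eval, iha, add_assoc]

theorem eval_add (s t : GTree) (k : ℕ) : G.eval k (s.add t) = G.eval k s + G.eval k t := by
  induction s generalizing k t with
  | zero => simp [GTree.add, eval]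
  | leaf c => simp [GTree.add, eval, eval_addLeaf]
  | node a b iha ihb =>
    cases t with
    | zero => simp [GTree.add, eval]
    | leaf c => simp only [GTree.add, eval, eval_addLeaf]; abel
    | node a' b' => simp only [GTree.add, eval, iha, ihb, add_mul]; abel

theorem eval_smul (c : ℤ) (t : GTree) (k : ℕ) : G.eval k (t.smul c) = c * G.eval k t := by
  induction t generalizing k with
  | zero => simp [GTree.smul, eval]
  | leaf c' => simp [GTree.smul, eval]
  | node a b iha ihb => simp [GTree.smul, eval, iha, ihb, mul_add, mul_assoc]

theorem eval_neg (t : GTree) (k : ℕ) : G.eval k t.neg = - G.eval k t := by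
  induction t generalizing k with
  | zero => simp [GTree.neg, eval]
  | leaf c' => simp [GTree.neg, eval]
  | node a b iha ihb => simp only [GTree.neg, eval, iha, ihb, neg_mul, neg_add]

theorem inv_intCast (c : ℤ) : G.inv (c : C) = c := by
  rw [← mul_one (c : C), ← zsmul_eq_mul, map_zsmul, G.inv_one]

theorem D_intCast (i : ℕ) (c : ℤ) : G.D i (c : C) = 0 := by
  rw [← mul_one (c : C), ← zsmul_eq_mul, map_zsmul, G.D_one, smul_zero]

theorem eval_inv (t : GTree) (k : ℕ) : G.eval k t.inv = G.inv (G.eval k t) := by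
  induction t generalizing k with
  | zero => simp [GTree.inv, eval]
  | leaf c' => simp [GTree.inv, eval, inv_intCast]
  | node a b iha ihb => simp [GTree.inv, eval, iha, ihb, eval_neg, inv_mul, inv_gen]

theorem eval_mul (s t : GTree) (k : ℕ) : G.eval k (s.mul t) = G.eval k s * G.eval k t := by
  induction s generalizing k t with
  | zero => simp [GTree.mul, eval]
  | leaf c => simp [GTree.mul, eval, eval_smul]
  | node a b iha ihb =>
    cases t with
    | zero => simp [GTree.mul, eval]
    | leaf c => simp only [GTree.mul, eval, eval_smul]; exact Int.cast_commute _ _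
    | node c d =>
      -- Moving $\theta_k$ to the right past the coefficients explains the involution in
      -- `GTree.mul`; the term with $\theta_k$ twice vanishes.
      have h (x : C) : G.θ k * x = G.inv x * G.θ k := by rw [mul_gen, inv_inv]
      simp only [GTree.mul, eval, iha, ihb, eval_add, eval_inv, add_mul, mul_add, mul_assoc]
      rw [h, ← mul_assoc (G.θ k), h, mul_assoc, G.sq]
      simp only [mul_zero, add_zero]
      abel

theorem D_eval_of_lt {i : ℕ} (hi : i < 6) (t : GTree) {k : ℕ} (hk : i < k) :
    G.D i (G.eval k t) = 0 := by
  induction t generalizing k with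
  | zero => simp [eval]
  | leaf c => simp [eval, D_intCast]
  | node a b iha ihb =>
    simp [eval, D_mul G hi, iha (hk.trans (Nat.lt_succ_self k)),
      ihb (hk.trans (Nat.lt_succ_self k)), D_gen G hi, hk.ne]

theorem eval_der (i : ℕ) (t : GTree) {k : ℕ} (hi : k + i < 6) :
    G.eval k (t.der i) = G.D (k + i) (G.eval k t) := by
  induction t generalizing k i with
  | zero => simp [GTree.der, eval]
  | leaf c => simp [GTree.der, eval, D_intCast]
  | node a b iha ihb =>
    cases i with
    | zero =>
      rw [add_zero] at hi ⊢
      simp [GTree.der, eval, D_mul G hi, D_eval_of_lt G hi _ (Nat.lt_succ_self k), D_gen G hi,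
        eval_inv]
    | succ i =>
      have h : k + 1 + i = k + (i + 1) := by omega
      simp [GTree.der, eval, D_mul G hi, iha i (k := k + 1) (by omega), ihb i (k := k + 1) (by omega),
        h, D_gen G hi]

theorem ε_eval (t : GTree) (k : ℕ) : G.ε (G.eval k t) = t.const := by
  have h1 (c : ℤ) : G.ε (c : C) = c := by
    rw [← mul_one (c : C), ← zsmul_eq_mul, map_zsmul, G.ε_one, zsmul_eq_mul, mul_one]
  induction t generalizing k with
  | zero => simp [GTree.const, eval]
  | leaf c => simp [GTree.const, eval, h1]
  | node a b iha ihb => simp [GTree.const, eval, iha, mul_gen, G.ε_gen_mul]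

theorem eval_eq_zero {t : GTree} (h : t.isZero = true) (k : ℕ) : G.eval k t = 0 := by
  induction t generalizing k with
  | zero => rfl
  | leaf c => simp_all [GTree.isZero, eval]
  | node a b iha ihb => simp_all [GTree.isZero, eval]

theorem eval_gen (j k : ℕ) : G.eval k (GTree.gen j) = G.θ (k + j) := by
  induction j generalizing k with
  | zero => simp [GTree.gen, eval]
  | succ j ih => simp [GTree.gen, eval, ih, add_assoc, add_comm 1 j]

theorem eval_br (a b : GTree) : G.eval 0 (a.br b) = G.br (G.eval 0 a) (G.eval 0 b) := by
  simp only [GTree.br, br, eval_neg, eval_add, eval_mul, Finset.sum_range_succ,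
    Finset.sum_range_zero]
  simp [eval_der, eval_inv, add_assoc]

theorem eval_d (t : GTree) : G.eval 0 t.d = G.d (G.eval 0 t) := by
  simp [GTree.d, d, eval_br, eval_mul, eval_gen]

theorem eval_jacobiator (a b : GTree) :
    G.eval 0 (a.jacobiator b) = G.jacobiator (G.eval 0 a) (G.eval 0 b) := by
  simp only [GTree.jacobiator, jacobiator, eval_br, eval_add, eval_neg, eval_d, eval_inv]
  abel

/-- The coefficient at a product of distinct generators. -/
def coef : List ℕ → C →ₗ[K] K
  | [] => G.ε
  | j :: l => coef l ∘ₗ G.D j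

theorem coef_eval {l : List ℕ} (hl : ∀ j ∈ l, j < 6) (t : GTree) :
    G.coef l (G.eval 0 t) = t.coef l := by
  induction l generalizing t with
  | nil => exact G.ε_eval t 0
  | cons j l ih =>
    rw [List.forall_mem_cons] at hl
    have h := G.eval_der j t (k := 0) (by omega)
    rw [zero_add] at h
    rw [coef, GTree.coef, LinearMap.comp_apply, ← h, ih hl.2]

theorem one_mem_span_blades (n k : ℕ) :
    (1 : C) ∈ Submodule.span K {x | ∃ t ∈ GTree.blades n, G.eval k t = x} := by
  have (n k : ℕ) : ∃ t ∈ GTree.blades n, G.eval k t = 1 := by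
    induction n generalizing k with
    | zero => exact ⟨.leaf 1, by simp [GTree.blades], by simp [eval]⟩
    | succ n ih =>
      obtain ⟨t, ht, h⟩ := ih (k + 1)
      exact ⟨.node t .zero, by simp [GTree.blades, ht], by simp [eval, h]⟩
  exact Submodule.subset_span (this n k)

theorem eval_mem_span_blades {n : ℕ} {t : GTree} (h : t.fits n = true) (k : ℕ) :
    G.eval k t ∈ Submodule.span K {x | ∃ t ∈ GTree.blades n, G.eval k t = x} := by
  induction t generalizing n k with
  | zero => exact Submodule.zero_mem _
  | leaf c =>
    have := Submodule.smul_mem _ (c : K) (G.one_mem_span_blades n k)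
    rw [eval]
    convert this using 1
    rw [Algebra.smul_def, mul_one, map_intCast]
  | node a b iha ihb =>
    cases n with
    | zero => simp [GTree.fits] at h
    | succ n =>
      simp only [GTree.fits, Bool.and_eq_true] at h
      refine Submodule.add_mem _ (Submodule.span_mono ?_ (iha h.1 (k + 1))) ?_
      · rintro _ ⟨t, ht, rfl⟩
        exact ⟨.node t .zero, by simp [GTree.blades, ht], by simp [eval]⟩
      · have := Submodule.mem_map_of_mem (f := (LinearMap.mul K C).flip (G.θ k)) (ihb h.2 (k + 1))
        rw [Submodule.map_span] at this
        refine Submodule.span_mono ?_ this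
        rintro _ ⟨_, ⟨t, ht, rfl⟩, rfl⟩
        exact ⟨.node .zero t, by simp [GTree.blades, ht], by simp [eval]⟩

/-- The span contains 1 and is stable under each generator: a generator times a blade is a tree in
six generators, a finite check. This reduces every linear identity to 64 monomials. -/
theorem span_blades :
    Submodule.span K {x | ∃ t ∈ GTree.blades 6, G.eval 0 t = x} = ⊤ := by
  have hfit : ∀ t ∈ GTree.blades 6, ∀ j < 6, ((GTree.gen j).mul t).fits 6 = true := by decide +kernel
  refine G.induct _ (G.one_mem_span_blades 6 0) fun j x hx => ?_
  by_cases hj : 6 ≤ j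
  · rw [G.gen_eq_zero j hj, zero_mul]
    exact Submodule.zero_mem _
  · have := Submodule.mem_map_of_mem (f := LinearMap.mul K C (G.θ j)) hx
    rw [Submodule.map_span] at this
    refine Submodule.span_le.mpr ?_ this
    rintro _ ⟨_, ⟨t, ht, rfl⟩, rfl⟩
    have h := G.eval_mem_span_blades (hfit t ht j (by omega)) 0
    rwa [eval_mul, eval_gen, zero_add] at h

theorem ext_blades (G : GrassmannSystem K C) {M : Type*} [AddCommGroup M] [Module K M]
    {f g : C →ₗ[K] M}
    (h : ∀ t ∈ GTree.blades 6, f (G.eval 0 t) = g (G.eval 0 t)) : f = g := by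
  refine LinearMap.ext_on G.span_blades ?_
  rintro _ ⟨t, ht, rfl⟩
  exact h t ht

/-- Each $d\theta_j$ is zero or, up to sign, a product of two generators: $dz^*=x^*y^*$, $dx=y^*z$,
$dy=-x^*z$ in the Heisenberg case, and zero otherwise. -/
theorem isEvenDer_d_gen (j : ℕ) : G.IsEvenDer (G.d (G.θ j)) := by
  have hgen (j : ℕ) : G.d (G.θ j) = G.eval 0 (GTree.gen j).d := by rw [eval_d, eval_gen, zero_add]
  have h0 {j : ℕ} (hj : (GTree.gen j).d.isZero = true) : G.IsEvenDer (G.d (G.θ j)) := by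
    rw [hgen, G.eval_eq_zero hj]
    exact G.isEvenDer_zero
  -- The Boolean selects the sign: `false` means $d\theta_j=\theta_a\theta_b$, `true` means
  -- $d\theta_j=-\theta_a\theta_b$.
  have h1 {j a b : ℕ} (c : Bool)
      (hj : ((GTree.gen j).d.add
        (((GTree.gen a).mul (GTree.gen b)).smul (if c then 1 else -1))).isZero = true) :
      G.IsEvenDer (G.d (G.θ j)) := by
    have := G.eval_eq_zero hj 0
    rw [eval_add, eval_smul, eval_mul, eval_gen, eval_gen, ← hgen, add_eq_zero_iff_eq_neg] at this
    rw [this]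
    cases c
    · simpa using G.isEvenDer_gen_mul_gen a b
    · simpa using (G.isEvenDer_gen_mul_gen a b).neg
  by_cases hj : 6 ≤ j
  · rw [G.gen_eq_zero j hj, ← dLin_apply, map_zero]
    exact G.isEvenDer_zero
  · interval_cases j
    · exact h0 (by decide +kernel)
    · exact h0 (by decide +kernel)
    · exact h1 (a := 0) (b := 1) false (by decide +kernel)
    · exact h1 (a := 1) (b := 5) false (by decide +kernel)
    · exact h1 (a := 0) (b := 5) true (by decide +kernel)
    · exact h0 (by decide +kernel)

theorem jacobiator_gen (a : C) (j : ℕ) : G.jacobiator a (G.θ j) = 0 := by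
  by_cases hj : 6 ≤ j
  · rw [G.gen_eq_zero j hj, ← jacobiatorLin_apply, map_zero]
  · have hz : ∀ t ∈ GTree.blades 6, ∀ j < 6, (t.jacobiator (GTree.gen j)).isZero = true := by
      decide +kernel
    have := G.ext_blades (f := G.dLin ∘ₗ G.brLin.flip (G.θ j) - G.brLin.flip (G.θ j) ∘ₗ G.dLin -
      G.brLin.flip (G.d (G.θ j)) ∘ₗ G.inv) (g := 0) (fun t ht => by
        have h := G.eval_eq_zero (hz t ht j (by omega)) 0
        rw [eval_jacobiator, eval_gen, zero_add] at h
        simpa [jacobiator, dLin_apply, brLin_apply] using h)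
    simpa [jacobiator, dLin_apply, brLin_apply] using LinearMap.congr_fun this a

/-- This is the graded Jacobi identity for $\mu$ with two arbitrary elements. It makes the bracket
well defined on cohomology. -/
theorem d_br (a b : C) : G.d (G.br a b) = G.br (G.d a) b + G.br (G.inv a) (G.d b) := by
  have := G.jacobiator_eq_zero G.isEvenDer_d_gen G.jacobiator_gen a b
  rwa [jacobiator, sub_sub, sub_eq_zero] at this

end GrassmannSystem

/-! ### Integral model of the semidirect product for $n=3$ -/

/-- Pairs `(X, Y)` of integer matrices, which stand for the elements `(X, Y / 3)` of
`𝔤𝔩(3) ⋉ 𝔤𝔩(3)_ab`. -/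
abbrev IntPair : Type := Matrix (Fin 3) (Fin 3) ℤ × Matrix (Fin 3) (Fin 3) ℤ

namespace IntPair

/-- The product of two integer matrices. -/
def mm (X Y : Matrix (Fin 3) (Fin 3) ℤ) : Matrix (Fin 3) (Fin 3) ℤ :=
  fun i j => X i 0 * Y 0 j + X i 1 * Y 1 j + X i 2 * Y 2 j

/-- The trace of an integer matrix. -/
def tr (X : Matrix (Fin 3) (Fin 3) ℤ) : ℤ := X 0 0 + X 1 1 + X 2 2

/-- The integer matrix units. -/
def E (a b : Fin 3) (c : ℤ) : Matrix (Fin 3) (Fin 3) ℤ := fun i j => if i = a ∧ j = b then c else 0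

/-- The integer diagonal matrices. -/
def diag (a b c : ℤ) : Matrix (Fin 3) (Fin 3) ℤ :=
  fun i j => if i = j then (if i = 0 then a else if i = 1 then b else c) else 0

/-- Nine times the commutative product. -/
def mul (a b : IntPair) : IntPair :=
  (fun i j => 3 * tr a.1 * b.1 i j + 3 * tr b.1 * a.1 i j -
      if i = j then tr a.1 * tr b.1 else 0,
    fun i j => (if i = j then 9 * (tr (mm a.1 b.2) + tr (mm a.2 b.1)) - 18 * tr (mm a.1 b.1) -
        3 * (tr a.1 * tr b.2 + tr a.2 * tr b.1) + 12 * (tr a.1 * tr b.1) else 0) +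
      3 * tr a.1 * b.2 i j + 3 * tr b.1 * a.2 i j + 27 * (mm a.1 b.1 i j + mm b.1 a.1 i j) -
      18 * (tr a.1 * b.1 i j + tr b.1 * a.1 i j))

/-- The Lie bracket. -/
def br (a b : IntPair) : IntPair :=
  (fun i j => mm a.1 b.1 i j - mm b.1 a.1 i j,
    fun i j => mm a.1 b.2 i j - mm b.2 a.1 i j - (mm b.1 a.2 i j - mm a.2 b.1 i j))

/-- The basis of matrix units in the two factors. -/
def unit (s : Bool) (i j : Fin 3) : IntPair := if s then (0, E i j 3) else (E i j 1, 0)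

/-- Addition. -/
def add (a b : IntPair) : IntPair := (fun i j => a.1 i j + b.1 i j, fun i j => a.2 i j + b.2 i j)

/-- Multiplication by an integer. -/
def smul (c : ℤ) (a : IntPair) : IntPair := (fun i j => c * a.1 i j, fun i j => c * a.2 i j)

theorem add_fst (a b : IntPair) (i j : Fin 3) : (a.add b).1 i j = a.1 i j + b.1 i j := rfl

theorem add_snd (a b : IntPair) (i j : Fin 3) : (a.add b).2 i j = a.2 i j + b.2 i j := rfl

theorem smul_fst (c : ℤ) (a : IntPair) (i j : Fin 3) : (a.smul c).1 i j = c * a.1 i j := rfl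

theorem smul_snd (c : ℤ) (a : IntPair) (i j : Fin 3) : (a.smul c).2 i j = c * a.2 i j := rfl

theorem br_fst (a b : IntPair) (i j : Fin 3) :
    (a.br b).1 i j = mm a.1 b.1 i j - mm b.1 a.1 i j := rfl

theorem br_snd (a b : IntPair) (i j : Fin 3) : (a.br b).2 i j =
    mm a.1 b.2 i j - mm b.2 a.1 i j - (mm b.1 a.2 i j - mm a.2 b.1 i j) := rfl

theorem mul_fst (a b : IntPair) (i j : Fin 3) : (a.mul b).1 i j =
    3 * tr a.1 * b.1 i j + 3 * tr b.1 * a.1 i j - if i = j then tr a.1 * tr b.1 else 0 := rfl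

theorem mul_snd (a b : IntPair) (i j : Fin 3) : (a.mul b).2 i j =
    (if i = j then 9 * (tr (mm a.1 b.2) + tr (mm a.2 b.1)) - 18 * tr (mm a.1 b.1) -
        3 * (tr a.1 * tr b.2 + tr a.2 * tr b.1) + 12 * (tr a.1 * tr b.1) else 0) +
      3 * tr a.1 * b.2 i j + 3 * tr b.1 * a.2 i j + 27 * (mm a.1 b.1 i j + mm b.1 a.1 i j) -
      18 * (tr a.1 * b.1 i j + tr b.1 * a.1 i j) := rfl

/-- Equality of all entries. -/
def beq (a b : IntPair) : Bool :=
  [0, 1, 2].all fun i => [0, 1, 2].all fun j => a.1 i j == b.1 i j && a.2 i j == b.2 i j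

theorem eq_of_beq {a b : IntPair} (h : beq a b = true) : a = b := by
  simp only [beq, List.all_cons, List.all_nil, Bool.and_true, Bool.and_eq_true, beq_iff_eq] at h
  ext i j <;> fin_cases i <;> fin_cases j <;> simp [h]

variable (K : Type u) [Field K]

/-- The element `(X, Y / 3)` represented by a pair `(X, Y)`. -/
def toGl (a : IntPair) : GlSemi K 3 :=
  pair (a.1.map fun z : ℤ => (z : K)) ((3⁻¹ : K) • a.2.map fun z : ℤ => (z : K))

theorem toGl_add (a b : IntPair) : toGl K (a.add b) = toGl K a + toGl K b := by
  rw [toGl, toGl, toGl, ← pair_add]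
  congr 1
  · ext i j; simp [add_fst]
  · ext i j; simp [add_snd, mul_add]

theorem toGl_smul (c : ℤ) (a : IntPair) : toGl K (a.smul c) = (c : K) • toGl K a := by
  rw [toGl, toGl, ← pair_smul]
  congr 1
  · ext i j; simp [smul_fst]
  · ext i j; simp [smul_snd, mul_left_comm]

theorem toGl_br (a b : IntPair) : toGl K (a.br b) = ⁅toGl K a, toGl K b⁆ := by
  rw [toGl, toGl, toGl, lie_pair]
  congr 1
  · ext i j
    simp [br_fst, mm, Matrix.mul_apply, Fin.sum_univ_three]
  · ext i j
    simp [br_snd, mm, Matrix.mul_apply, Fin.sum_univ_three]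
    ring

theorem cast_mm (X Y : Matrix (Fin 3) (Fin 3) ℤ) (i j : Fin 3) :
    ((mm X Y i j : ℤ) : K) =
      ((X.map fun z : ℤ => (z : K)) * (Y.map fun z : ℤ => (z : K))) i j := by
  simp [mm, Matrix.mul_apply, Fin.sum_univ_three]

theorem cast_tr (X : Matrix (Fin 3) (Fin 3) ℤ) :
    ((tr X : ℤ) : K) = (X.map fun z : ℤ => (z : K)).trace := by
  simp [tr, Matrix.trace, Fin.sum_univ_three]

theorem map_mm (X Y : Matrix (Fin 3) (Fin 3) ℤ) : (mm X Y).map (fun z : ℤ => (z : K)) =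
    (X.map fun z : ℤ => (z : K)) * (Y.map fun z : ℤ => (z : K)) := by
  ext i j
  exact cast_mm K X Y i j

/-- The scalar parts are traces divided by 3 and occur at most quadratically, so a factor 9 makes
the product integral in these coordinates. -/
theorem toGl_mul [CharZero K] (a b : IntPair) :
    toGl K (a.mul b) = (9 : K) • glMul K 3 (toGl K a) (toGl K b) := by
  have h0 (X Y : Matrix (Fin 3) (Fin 3) K) : comp₀ (pair X Y) = X := rfl
  have h1 (X Y : Matrix (Fin 3) (Fin 3) K) : comp₁ (pair X Y) = Y := rfl
  rw [toGl, glMul_apply, glMulFun, prodFormula, ← pair_smul, toGl, toGl, h0, h0, h1, h1]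
  congr 1
  · ext i j
    rw [Matrix.map_apply, mul_fst]
    push_cast [cast_tr]
    rw [← Matrix.map_apply (M := a.1) (f := fun z : ℤ => (z : K)),
      ← Matrix.map_apply (M := b.1) (f := fun z : ℤ => (z : K))]
    generalize a.1.map (fun z : ℤ => (z : K)) = X
    generalize b.1.map (fun z : ℤ => (z : K)) = X'
    by_cases h : i = j <;> simp [slPart, scalarPart, h] <;> ring
  · ext i j
    rw [Matrix.smul_apply, Matrix.map_apply, mul_snd]
    push_cast [cast_tr, cast_mm, map_mm]
    rw [← Matrix.map_apply (M := a.1) (f := fun z : ℤ => (z : K)),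
      ← Matrix.map_apply (M := b.1) (f := fun z : ℤ => (z : K)),
      ← Matrix.map_apply (M := a.2) (f := fun z : ℤ => (z : K)),
      ← Matrix.map_apply (M := b.2) (f := fun z : ℤ => (z : K))]
    generalize a.1.map (fun z : ℤ => (z : K)) = X
    generalize b.1.map (fun z : ℤ => (z : K)) = X'
    generalize a.2.map (fun z : ℤ => (z : K)) = Y
    generalize b.2.map (fun z : ℤ => (z : K)) = Y'
    by_cases h : i = j <;> simp [slPart, scalarPart, h, sub_mul, mul_sub] <;> ring

theorem toGl_unit_false (i j : Fin 3) : toGl K (unit false i j) = pair (Matrix.single i j 1) 0 := by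
  rw [toGl]
  congr 1
  · ext a b; simp [unit, E, Matrix.single_apply, eq_comm]
  · ext a b; simp [unit]

theorem toGl_unit_true [CharZero K] (i j : Fin 3) : toGl K (unit true i j) = pair 0 (Matrix.single i j 1) := by
  rw [toGl]
  congr 1
  · ext a b; simp [unit]
  · ext a b
    by_cases h : a = i ∧ b = j
    · simp [unit, E, h]
    · have h' : ¬ (i = a ∧ j = b) := fun h' => h ⟨h'.1.symm, h'.2.symm⟩
      simp [unit, E, h, h']

variable {K}

theorem glSemi_linear_ext [CharZero K] {M : Type*} [AddCommGroup M] [Module K M] {f g : GlSemi K 3 →ₗ[K] M}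
    (h : ∀ s i j, f (toGl K (unit s i j)) = g (toGl K (unit s i j))) : f = g := by
  have hpair (f : GlSemi K 3 →ₗ[K] M) (X Y : Matrix (Fin 3) (Fin 3) K) : f (pair X Y) =
      ∑ i, ∑ j, (X i j • f (toGl K (unit false i j)) + Y i j • f (toGl K (unit true i j))) := by
    have : pair X Y = ∑ i, ∑ j,
        (X i j • toGl K (unit false i j) + Y i j • toGl K (unit true i j)) := by
      have hs (X Y : Fin 3 → Matrix (Fin 3) (Fin 3) K) :
          ∑ i, pair (X i) (Y i) = pair (∑ i, X i) (∑ i, Y i) := by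
        simp only [Fin.sum_univ_three, pair_add]
      simp only [toGl_unit_false, toGl_unit_true, ← pair_smul, ← pair_add, hs, smul_zero, zero_add,
        add_zero]
      congr 1
      · conv_lhs => rw [Matrix.matrix_eq_sum_single X]
        simp [Matrix.smul_single]
      · conv_lhs => rw [Matrix.matrix_eq_sum_single Y]
        simp [Matrix.smul_single]
    rw [this]
    simp only [map_sum, map_add, map_smul]
  ext x
  rw [← pair_comp x, hpair, hpair]
  simp only [h]

end IntPair

/-! ### Explicit tables for the projection, the representatives and the homotopy -/

namespace GTree

/-- Linear combinations of products of generators. -/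
def comb : List (ℤ × List ℕ) → GTree
  | [] => zero
  | (c, l) :: L => add (smul c (word l)) (comb L)

/-- The values of the projection of cochains to `𝔤𝔩(3) ⋉ 𝔤𝔩(3)_ab` on products of generators. -/
def projTable : List (List ℕ × IntPair) :=
  [([], (IntPair.diag 1 1 1, 0)), ([1, 3], (IntPair.E 0 1 (-1), 0)), ([3, 5], (IntPair.E 0 2 1, 0)),
    ([0, 4], (IntPair.E 1 0 (-1), 0)), ([4, 5], (IntPair.E 1 2 1, 0)),
    ([0, 2], (IntPair.E 2 0 (-1), 0)), ([1, 2], (IntPair.E 2 1 (-1), 0)),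
    ([0, 3], (IntPair.diag (-1) 0 1, 0)), ([1, 4], (IntPair.diag 0 (-1) 1, 0)),
    ([1, 2, 3, 5], (0, IntPair.E 0 1 (-3))), ([1, 3, 4, 5], (0, IntPair.E 0 2 (-3))),
    ([0, 2, 4, 5], (0, IntPair.E 1 0 (-3))), ([0, 3, 4, 5], (0, IntPair.E 1 2 3)),
    ([0, 1, 2, 4], (0, IntPair.E 2 0 3)), ([0, 1, 2, 3], (0, IntPair.E 2 1 (-3))),
    ([0, 2, 3, 5], (0, IntPair.diag (-1) 2 (-1))), ([1, 2, 4, 5], (0, IntPair.diag 2 (-1) (-1))),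
    ([0, 1, 3, 4], (0, IntPair.diag 1 1 (-2))),
    ([0, 1, 2, 3, 4, 5], (0, IntPair.diag (-3) (-3) (-3)))]

/-- The values of the contracting homotopy on products of generators. -/
def homTable : List (List ℕ × GTree) :=
  [([0, 1], comb [(1, [2])]), ([0, 5], comb [(-1, [4])]), ([1, 5], comb [(1, [3])]),
    ([0, 1, 3, 4], comb [(1, [2, 3, 4])]), ([0, 1, 3, 5], comb [(1, [2, 3, 5])]),
    ([0, 1, 4, 5], comb [(1, [2, 4, 5])]), ([0, 1, 2, 5], comb [(-1, [0, 2, 3])]),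
    ([0, 1, 5], comb [(1, [2, 5])]), ([0, 1, 3], comb [(1, [2, 3])]),
    ([0, 1, 4], comb [(1, [2, 4])]), ([0, 3, 5], comb [(-1, [3, 4])]),
    ([0, 1, 2, 4, 5], comb [(1, [0, 2, 3, 4])]), ([0, 1, 2, 3, 5], comb [(-1, [1, 2, 3, 4])]),
    ([0, 1, 3, 4, 5], comb [(1, [2, 3, 4, 5])])]

/-- Three times the representatives of the matrix units in the two factors. -/
def rep : Bool → Fin 3 → Fin 3 → GTree
  | false, 0, 0 => comb [(1, []), (-2, [0, 3]), (1, [1, 4]), (-1, [2, 5])]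
  | false, 0, 1 => comb [(-3, [1, 3])]
  | false, 0, 2 => comb [(3, [3, 5])]
  | false, 1, 0 => comb [(-3, [0, 4])]
  | false, 1, 1 => comb [(1, []), (1, [0, 3]), (-2, [1, 4]), (-1, [2, 5])]
  | false, 1, 2 => comb [(3, [4, 5])]
  | false, 2, 0 => comb [(-3, [0, 2])]
  | false, 2, 1 => comb [(-3, [1, 2])]
  | false, 2, 2 => comb [(1, []), (1, [0, 3]), (1, [1, 4]), (2, [2, 5])]
  | true, 0, 0 => comb [(-1, [0, 1, 2, 3, 4, 5]), (3, [1, 2, 4, 5])]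
  | true, 0, 1 => comb [(-3, [1, 2, 3, 5])]
  | true, 0, 2 => comb [(-3, [1, 3, 4, 5])]
  | true, 1, 0 => comb [(-3, [0, 2, 4, 5])]
  | true, 1, 1 => comb [(-1, [0, 1, 2, 3, 4, 5]), (3, [0, 2, 3, 5])]
  | true, 1, 2 => comb [(3, [0, 3, 4, 5])]
  | true, 2, 0 => comb [(3, [0, 1, 2, 4])]
  | true, 2, 1 => comb [(-3, [0, 1, 2, 3])]
  | true, 2, 2 => comb [(-1, [0, 1, 2, 3, 4, 5]), (-3, [0, 2, 3, 5]), (-3, [1, 2, 4, 5])]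

/-- The projection to `𝔤𝔩(3) ⋉ 𝔤𝔩(3)_ab`. -/
def proj (t : GTree) : IntPair :=
  projTable.foldr (fun r a => if t.coef r.1 = 0 then a else (r.2.smul (t.coef r.1)).add a) (0, 0)

/-- The contracting homotopy. -/
def hom (t : GTree) : GTree :=
  homTable.foldr (fun r a => if t.coef r.1 = 0 then a else (r.2.smul (t.coef r.1)).add a) zero

/-- Nine times the representative of an element of `𝔤𝔩(3) ⋉ 𝔤𝔩(3)_ab`. -/
def lift (a : IntPair) : GTree :=
  [0, 1, 2].foldr (fun i x => [0, 1, 2].foldr (fun j y =>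
    ((rep false i j).smul (3 * a.1 i j)).add (((rep true i j).smul (a.2 i j)).add y)) x) zero

theorem isZero_d_rep : ∀ s i j, (rep s i j).d.isZero = true := by decide +kernel

theorem isZero_inv_rep : ∀ s i j, ((rep s i j).inv.add (rep s i j).neg).isZero = true := by
  decide +kernel

theorem proj_rep : ∀ s i j, (rep s i j).proj.beq ((IntPair.unit s i j).smul 3) = true := by
  decide +kernel

theorem proj_d : ∀ t ∈ blades 6, (t.d.proj.beq (0, 0)) = true := by decide +kernel

/-- The homotopy formula $u=\mathrm{lift}\,\mathrm{proj}\,u+d\,\mathrm{hom}\,u+\mathrm{hom}\,d\,u$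
times 9, the factor already contained in the tree version of `lift`. Here $u$ is twice the even part
of a monomial. -/
theorem isZero_homotopy : ∀ t ∈ blades 6, (let u := t.add t.inv
    (u.smul (-9)).add ((lift u.proj).add ((u.hom.d.add u.d.hom).smul 9))).isZero = true := by
  decide +kernel

/-- Each representative carries a factor 3, so the product on the left carries 9, as does the
integral product on the right. The bracket of pairs has no such factor, so `proj_br` inserts it. -/
theorem proj_mul : ∀ s i j s' i' j', ((rep s i j).mul (rep s' i' j')).proj.beq
    ((IntPair.unit s i j).mul (IntPair.unit s' i' j')) = true := by decide +kernel

theorem proj_br : ∀ s i j s' i' j', ((rep s i j).br (rep s' i' j')).proj.beq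
    (((IntPair.unit s i j).br (IntPair.unit s' i' j')).smul 9) = true := by decide +kernel

end GTree

/-! ### Comparison of cocycles with the matrix algebra -/

namespace GrassmannSystem

variable {K : Type u} {C : Type v} [Field K] [Ring C] [Algebra K C] (G : GrassmannSystem K C)

/-- The linear map with given values on products of generators. -/
def ofTable {M R : Type*} [AddCommGroup M] [Module K M] (v : R → M) (L : List (List ℕ × R)) :
    C →ₗ[K] M :=
  L.foldr (fun r f => (G.coef r.1).smulRight (v r.2) + f) 0

/-- Lets a linear map given by a table be computed on trees; entries with coefficient zero are
skipped there, which does not change the value. -/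
theorem ofTable_eval {M R : Type*} [AddCommGroup M] [Module K M] (v : R → M) (add : R → R → R)
    (smul : ℤ → R → R) (zero : R) (hadd : ∀ a b, v (add a b) = v a + v b)
    (hsmul : ∀ c a, v (smul c a) = (c : K) • v a) (hzero : v zero = 0) (L : List (List ℕ × R))
    (hL : ∀ r ∈ L, ∀ j ∈ r.1, j < 6) (t : GTree) :
    G.ofTable v L (G.eval 0 t) = v (L.foldr
      (fun r a => if t.coef r.1 = 0 then a else add (smul (t.coef r.1) r.2) a) zero) := by
  induction L with
  | nil => simp [ofTable, hzero]
  | cons r L ih =>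
    rw [List.forall_mem_cons] at hL
    have h := ih hL.2
    rw [ofTable] at h ⊢
    rw [List.foldr_cons, List.foldr_cons, LinearMap.add_apply, LinearMap.smulRight_apply, h,
      G.coef_eval hL.1]
    split_ifs with h0
    · rw [h0, Int.cast_zero, zero_smul, zero_add]
    · rw [hadd, hsmul]

/-- The projection of cochains to `𝔤𝔩(3) ⋉ 𝔤𝔩(3)_ab`. -/
def proj : C →ₗ[K] GlSemi K 3 := G.ofTable (IntPair.toGl K) GTree.projTable

/-- The contracting homotopy. -/
def hom : C →ₗ[K] C := G.ofTable (G.eval 0) GTree.homTable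

theorem eval_smul' (c : ℤ) (t : GTree) : G.eval 0 (t.smul c) = (c : K) • G.eval 0 t := by
  rw [eval_smul, Algebra.smul_def, map_intCast]

theorem toGl_zero : IntPair.toGl K (0, 0) = 0 := by
  have := IntPair.toGl_smul K 0 (0, 0)
  rw [Int.cast_zero, zero_smul] at this
  rw [← this]
  rfl

theorem proj_eval (t : GTree) : G.proj (G.eval 0 t) = IntPair.toGl K t.proj :=
  G.ofTable_eval _ IntPair.add IntPair.smul (0, 0) (IntPair.toGl_add K) (IntPair.toGl_smul K)
    toGl_zero _ (by decide) t

theorem hom_eval (t : GTree) : G.hom (G.eval 0 t) = G.eval 0 t.hom :=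
  G.ofTable_eval _ GTree.add GTree.smul GTree.zero (fun a b => G.eval_add a b 0) G.eval_smul' rfl _
    (by decide) t

/-- The representative of an element of `𝔤𝔩(3) ⋉ 𝔤𝔩(3)_ab`. -/
def lift : GlSemi K 3 →ₗ[K] C where
  toFun x := (3⁻¹ : K) • ∑ i, ∑ j, (comp₀ x i j • G.eval 0 (GTree.rep false i j) +
    comp₁ x i j • G.eval 0 (GTree.rep true i j))
  map_add' x y := by
    have h0 (i j) : comp₀ (x + y) i j = comp₀ x i j + comp₀ y i j := rfl
    have h1 (i j) : comp₁ (x + y) i j = comp₁ x i j + comp₁ y i j := rfl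
    simp only [h0, h1, ← smul_add, ← Finset.sum_add_distrib]
    congr! 3
    module
  map_smul' c x := by
    have h0 (i j) : comp₀ (c • x) i j = c * comp₀ x i j := rfl
    have h1 (i j) : comp₁ (c • x) i j = c * comp₁ x i j := rfl
    simp only [h0, h1, Finset.smul_sum, RingHom.id_apply]
    congr! 2
    module

theorem proj_d (x : C) : G.proj (G.d x) = 0 := by
  have : G.proj ∘ₗ G.dLin = 0 := G.ext_blades fun t ht => by
    rw [LinearMap.comp_apply, dLin_apply, ← eval_d, proj_eval,
      IntPair.eq_of_beq (GTree.proj_d t ht), toGl_zero, LinearMap.zero_apply]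
  rw [← dLin_apply]
  exact LinearMap.congr_fun this x

variable [CharZero K]

theorem lift_unit (s : Bool) (i j : Fin 3) :
    G.lift (IntPair.toGl K (IntPair.unit s i j)) = (3⁻¹ : K) • G.eval 0 (GTree.rep s i j) := by
  have h0 (X Y : Matrix (Fin 3) (Fin 3) K) : comp₀ (pair X Y) = X := rfl
  have h1 (X Y : Matrix (Fin 3) (Fin 3) K) : comp₁ (pair X Y) = Y := rfl
  have hsum (f : Fin 3 → Fin 3 → C) :
      ∑ a, ∑ b, (Matrix.single i j (1 : K)) a b • f a b = f i j := by
    rw [Finset.sum_eq_single i (fun a _ ha => Finset.sum_eq_zero fun b _ => by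
        rw [Matrix.single_apply_of_row_ne ha.symm, zero_smul]) (by simp),
      Finset.sum_eq_single j (fun b _ hb => by
        rw [Matrix.single_apply_of_col_ne _ _ hb.symm, zero_smul]) (by simp),
      Matrix.single_apply_same, one_smul]
  cases s
  · rw [IntPair.toGl_unit_false]
    simp [lift, h0, h1, hsum]
  · rw [IntPair.toGl_unit_true]
    simp [lift, h0, h1, hsum]

theorem eval_lift (a : IntPair) : G.eval 0 (GTree.lift a) = (9 : K) • G.lift (IntPair.toGl K a) := by
  have h0 : comp₀ (IntPair.toGl K a) = a.1.map fun z : ℤ => (z : K) := rfl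
  have h1 : comp₁ (IntPair.toGl K a) = (3⁻¹ : K) • a.2.map fun z : ℤ => (z : K) := rfl
  simp only [GTree.lift, List.foldr_cons, List.foldr_nil, eval_add, eval_smul', lift,
    LinearMap.coe_mk, AddHom.coe_mk, h0, h1, Fin.sum_univ_three, Matrix.map_apply,
    Matrix.smul_apply, smul_eq_mul, Int.cast_mul, Int.cast_ofNat, eval]
  module

theorem d_lift (x : GlSemi K 3) : G.d (G.lift x) = 0 := by
  have : G.dLin ∘ₗ G.lift = 0 := IntPair.glSemi_linear_ext fun s i j => by
    rw [LinearMap.comp_apply, lift_unit, map_smul, dLin_apply, ← eval_d,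
      G.eval_eq_zero (GTree.isZero_d_rep s i j), smul_zero, LinearMap.zero_apply]
  rw [← dLin_apply]
  exact LinearMap.congr_fun this x

theorem inv_lift (x : GlSemi K 3) : G.inv (G.lift x) = G.lift x := by
  have : G.inv ∘ₗ G.lift = G.lift := IntPair.glSemi_linear_ext fun s i j => by
    have h := G.eval_eq_zero (GTree.isZero_inv_rep s i j) 0
    rw [eval_add, eval_neg, eval_inv, ← sub_eq_add_neg, sub_eq_zero] at h
    rw [LinearMap.comp_apply, lift_unit, map_smul, h]
  exact LinearMap.congr_fun this x

theorem proj_lift (x : GlSemi K 3) : G.proj (G.lift x) = x := by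
  have : G.proj ∘ₗ G.lift = LinearMap.id := IntPair.glSemi_linear_ext fun s i j => by
    rw [LinearMap.comp_apply, lift_unit, map_smul, proj_eval,
      IntPair.eq_of_beq (GTree.proj_rep s i j), IntPair.toGl_smul, LinearMap.id_apply]
    module
  exact LinearMap.congr_fun this x

theorem eq_of_inv_eq {x : C} (hx : G.inv x = x) :
    x = G.lift (G.proj x) + G.d (G.hom x) + G.hom (G.d x) := by
  have : (G.lift ∘ₗ G.proj + G.dLin ∘ₗ G.hom + G.hom ∘ₗ G.dLin) ∘ₗ (LinearMap.id + G.inv) =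
      LinearMap.id + G.inv := G.ext_blades fun t ht => by
    have h := G.eval_eq_zero (GTree.isZero_homotopy t ht) 0
    simp only [eval_add, eval_smul', eval_lift, eval_d, eval_inv, ← G.proj_eval,
      ← G.hom_eval] at h
    simp only [LinearMap.comp_apply, LinearMap.add_apply, LinearMap.id_apply, dLin_apply]
    generalize G.eval 0 t + G.inv (G.eval 0 t) = y at h ⊢
    have h9 : (9 : K) ≠ 0 := by norm_num
    rw [← sub_eq_zero, ← smul_eq_zero_iff_right h9, ← h]
    push_cast
    module
  have h := LinearMap.congr_fun this x
  -- The formula is known on $y+\mathrm{inv}\,y$; on a fixed point of the involution this is $2x$,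
  -- and 2 is invertible.
  have hx2 : (LinearMap.id + G.inv : C →ₗ[K] C) x = (2 : K) • x := by
    rw [LinearMap.add_apply, LinearMap.id_apply, hx, two_smul]
  rw [LinearMap.comp_apply, hx2, map_smul] at h
  have h2 : (2 : K) ≠ 0 := by norm_num
  simp only [LinearMap.comp_apply, LinearMap.add_apply, dLin_apply] at h
  exact (smul_right_injective C h2 h).symm

theorem proj_lift_mul_lift (x y : GlSemi K 3) : G.proj (G.lift x * G.lift y) = glMul K 3 x y := by
  have : ((LinearMap.mul K C).compl₁₂ G.lift G.lift).compr₂ G.proj = glMul K 3 :=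
    IntPair.glSemi_linear_ext fun s i j => IntPair.glSemi_linear_ext fun s' i' j' => by
      have h9 : (9 : K) ≠ 0 := by norm_num
      rw [LinearMap.compr₂_apply, LinearMap.compl₁₂_apply, LinearMap.mul_apply', lift_unit,
        lift_unit, smul_mul_smul_comm, ← eval_mul, map_smul, proj_eval,
        IntPair.eq_of_beq (GTree.proj_mul s i j s' i' j'), IntPair.toGl_mul, smul_smul]
      norm_num
  exact LinearMap.congr_fun₂ this x y

theorem proj_br_lift_lift (x y : GlSemi K 3) : G.proj (G.br (G.lift x) (G.lift y)) = ⁅x, y⁆ := by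
  have : (G.brLin.compl₁₂ G.lift G.lift).compr₂ G.proj = lieBilin K (GlSemi K 3) :=
    IntPair.glSemi_linear_ext fun s i j => IntPair.glSemi_linear_ext fun s' i' j' => by
      rw [LinearMap.compr₂_apply, LinearMap.compl₁₂_apply, lift_unit,
        lift_unit, LinearMap.map_smul₂, (G.brLin _).map_smul, brLin_apply, ← eval_br, map_smul,
        map_smul, proj_eval,
        IntPair.eq_of_beq (GTree.proj_br s i j s' i' j'), IntPair.toGl_smul, IntPair.toGl_br,
        smul_smul, smul_smul]
      norm_num
      rfl
  have h := LinearMap.congr_fun₂ this x y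
  rw [LinearMap.compr₂_apply, LinearMap.compl₁₂_apply, brLin_apply] at h
  exact h

theorem eq_of_cocycle {x : C} (hx : G.inv x = x) (hd : G.d x = 0) :
    x = G.lift (G.proj x) + G.d (G.hom x) := by
  have h := G.eq_of_inv_eq hx
  rwa [hd, map_zero, add_zero] at h

theorem eq_d_of_proj_eq_zero {x : C} (hx : G.inv x = x) (hd : G.d x = 0) (hp : G.proj x = 0) :
    x = G.d (G.hom x) := by
  have h := G.eq_of_cocycle hx hd
  rwa [hp, map_zero, zero_add] at h

/-- Each factor is its lift plus a coboundary. An even cocycle times a coboundary is a coboundary by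
`d_mul`, and `proj` kills it, so only the product of the two lifts matters. -/
theorem proj_mul {a b : C} (ha : G.inv a = a) (hb : G.inv b = b) (hda : G.d a = 0)
    (hdb : G.d b = 0) : G.proj (a * b) = glMul K 3 (G.proj a) (G.proj b) := by
  rw [← G.proj_lift_mul_lift]
  have h1 : a * b = G.lift (G.proj a) * b + G.d (G.hom a * b) := by
    rw [d_mul, hdb, mul_zero, add_zero, ← add_mul, ← G.eq_of_cocycle ha hda]
  have h2 : G.lift (G.proj a) * b =
      G.lift (G.proj a) * G.lift (G.proj b) + G.d (G.lift (G.proj a) * G.hom b) := by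
    rw [d_mul, d_lift, zero_mul, zero_add, inv_lift, ← mul_add, ← G.eq_of_cocycle hb hdb]
  rw [h1, h2, map_add, map_add, proj_d, proj_d, add_zero, add_zero]

/-- The same argument as for the product, with `d_br` in place of `d_mul`. -/
theorem proj_br {a b : C} (ha : G.inv a = a) (hb : G.inv b = b) (hda : G.d a = 0)
    (hdb : G.d b = 0) : G.proj (G.br a b) = ⁅G.proj a, G.proj b⁆ := by
  rw [← G.proj_br_lift_lift]
  have h1 : G.br a b = G.br (G.lift (G.proj a)) b + G.d (G.br (G.hom a) b) := by
    rw [d_br, hdb]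
    simp only [← brLin_apply, map_zero, add_zero]
    rw [← LinearMap.add_apply, ← map_add, ← G.eq_of_cocycle ha hda]
  have h2 : G.br (G.lift (G.proj a)) b = G.br (G.lift (G.proj a)) (G.lift (G.proj b)) +
      G.d (G.br (G.lift (G.proj a)) (G.hom b)) := by
    rw [d_br, d_lift, inv_lift]
    simp only [← brLin_apply, map_zero, LinearMap.zero_apply, zero_add]
    rw [← map_add, ← G.eq_of_cocycle hb hdb]
  rw [h1, h2, map_add, map_add, proj_d, proj_d, add_zero, add_zero]

end GrassmannSystem

/-! ### Contractions and parity in exterior algebras -/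

section Exterior

variable {K : Type u} [Field K] {M : Type v} [AddCommGroup M] [Module K M]

open CliffordAlgebra in
theorem contractLeft_mul (φ : Module.Dual K M) (x y : ExteriorAlgebra K M) :
    contractLeft φ (x * y) = contractLeft φ x * y + involute x * contractLeft φ y := by
  induction x using CliffordAlgebra.left_induction with
  | algebraMap r =>
    rw [contractLeft_algebraMap_mul, contractLeft_algebraMap, zero_mul, zero_add, AlgHom.commutes]
  | add a b ha hb => rw [add_mul, map_add, map_add, map_add, ha, hb]; noncomm_ring
  | ι_mul a m ha =>
    rw [mul_assoc, contractLeft_ι_mul, ha, contractLeft_ι_mul, map_mul, involute_ι]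
    noncomm_ring

open CliffordAlgebra in
theorem contractLeft_involute (φ : Module.Dual K M) (x : ExteriorAlgebra K M) :
    contractLeft φ (involute x) = - involute (contractLeft φ x) := by
  induction x using CliffordAlgebra.left_induction with
  | algebraMap r => simp
  | add a b ha hb => simp only [map_add, ha, hb, neg_add]
  | ι_mul a m ha =>
    rw [map_mul, involute_ι, neg_mul, map_neg, contractLeft_ι_mul, ha, contractLeft_ι_mul, map_sub,
      map_mul, involute_ι, map_smul]
    noncomm_ring

open CliffordAlgebra in
-- Turns the right contractions in the bracket into left ones, which are odd derivations; this
-- produces the sign and the involution in `GrassmannSystem.br`.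
theorem contractRight_eq_neg (φ : Module.Dual K M) (x : ExteriorAlgebra K M) :
    contractRight x φ = - contractLeft φ (involute x) := by
  induction x using CliffordAlgebra.right_induction with
  | algebraMap r => simp
  | add a b ha hb => simp only [map_add, LinearMap.add_apply, ha, hb, neg_add]
  | mul_ι m a ha =>
    rw [contractRight_mul_ι, ha, map_mul, involute_ι, contractLeft_mul, map_neg, contractLeft_ι,
      involute_involute, mul_neg, mul_neg, ← Algebra.commutes, ← Algebra.smul_def]
    noncomm_ring

open CliffordAlgebra in
theorem involute_of_mem {p : ℕ} {x : ExteriorAlgebra K M} (hx : x ∈ ⋀[K]^p M) :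
    involute x = (-1 : K) ^ p • x := by
  rw [← ExteriorAlgebra.ιMulti_span_fixedDegree] at hx
  induction hx using Submodule.span_induction with
  | mem x h =>
    obtain ⟨m, rfl⟩ := h
    rw [ExteriorAlgebra.ιMulti_apply]
    have h := involute_prod_map_ι (Q := (0 : QuadraticForm K M)) (List.ofFn m)
    rwa [List.map_ofFn, List.length_ofFn] at h
  | zero => simp
  | add x y _ _ hx hy => rw [map_add, hx, hy, smul_add]
  | smul c x _ hx => rw [map_smul, hx, smul_comm]

theorem algebraMapInv_ι (m : M) :
    ExteriorAlgebra.algebraMapInv (ExteriorAlgebra.ι K m) = (0 : K) := by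
  simp [ExteriorAlgebra.algebraMapInv]

theorem exterior_induction {P : ExteriorAlgebra K M → Prop} (h0 : P 0)
    (hadd : ∀ x y, P x → P y → P (x + y)) (h : ∀ p, ∀ x ∈ ⋀[K]^p M, P x) (x : ExteriorAlgebra K M) :
    P x := by
  induction x using DirectSum.Decomposition.inductionOn (fun p : ℕ => ⋀[K]^p M) with
  | zero => exact h0
  | homogeneous x => exact h _ _ x.2
  | add x y hx hy => exact hadd x y hx hy

end Exterior

/-! ### The space of cochains as a Grassmann algebra -/

section Cochain

variable {K : Type u} [Field K] {𝔤 : Type v} [LieRing 𝔤] [LieAlgebra K 𝔤]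

/-- Pure tensors in the space of cochains. -/
abbrev cten (a : ExteriorAlgebra K (Module.Dual K 𝔤)) (b : ExteriorAlgebra K 𝔤) : Cochain K 𝔤 :=
  a ᵍ⊗ₜ[K] b

theorem cten_add_left (a a' : ExteriorAlgebra K (Module.Dual K 𝔤)) (b : ExteriorAlgebra K 𝔤) :
    cten (a + a') b = cten a b + cten a' b := TensorProduct.add_tmul _ _ _

theorem cten_add_right (a : ExteriorAlgebra K (Module.Dual K 𝔤)) (b b' : ExteriorAlgebra K 𝔤) :
    cten a (b + b') = cten a b + cten a b' := TensorProduct.tmul_add _ _ _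

theorem cten_smul_left (c : K) (a : ExteriorAlgebra K (Module.Dual K 𝔤)) (b : ExteriorAlgebra K 𝔤) :
    cten (c • a) b = c • cten a b := (TensorProduct.smul_tmul' _ _ _).symm

theorem cten_smul_right (c : K) (a : ExteriorAlgebra K (Module.Dual K 𝔤))
    (b : ExteriorAlgebra K 𝔤) : cten a (c • b) = c • cten a b := TensorProduct.tmul_smul _ _ _

theorem cten_neg_left (a : ExteriorAlgebra K (Module.Dual K 𝔤)) (b : ExteriorAlgebra K 𝔤) :
    cten (-a) b = - cten a b := TensorProduct.neg_tmul _ _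

theorem cten_neg_right (a : ExteriorAlgebra K (Module.Dual K 𝔤)) (b : ExteriorAlgebra K 𝔤) :
    cten a (-b) = - cten a b := TensorProduct.tmul_neg _ _

theorem cten_zero_left (b : ExteriorAlgebra K 𝔤) :
    cten (0 : ExteriorAlgebra K (Module.Dual K 𝔤)) b = 0 := TensorProduct.zero_tmul _ _

theorem cten_zero_right (a : ExteriorAlgebra K (Module.Dual K 𝔤)) :
    cten a (0 : ExteriorAlgebra K 𝔤) = 0 := TensorProduct.tmul_zero _ _

theorem cochain_induction {P : Cochain K 𝔤 → Prop} (h0 : P 0)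
    (hadd : ∀ x y, P x → P y → P (x + y)) (h : ∀ a b, P (cten a b)) (x : Cochain K 𝔤) : P x :=
  TensorProduct.induction_on (motive := fun y => P y) x h0 h hadd

theorem cochainMap_cten
    (f : ExteriorAlgebra K (Module.Dual K 𝔤) →ₗ[K] ExteriorAlgebra K (Module.Dual K 𝔤))
    (g : ExteriorAlgebra K 𝔤 →ₗ[K] ExteriorAlgebra K 𝔤) (a : ExteriorAlgebra K (Module.Dual K 𝔤))
    (b : ExteriorAlgebra K 𝔤) : cochainMap f g (cten a b) = cten (f a) (g b) := rfl

theorem form_mul_cten (a a' : ExteriorAlgebra K (Module.Dual K 𝔤)) (b : ExteriorAlgebra K 𝔤) :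
    cten a 1 * cten a' b = cten (a * a') b := by
  rw [cten, cten, ← GradedTensorProduct.tmul_one_mul_one_tmul _ _ a' b, ← mul_assoc]
  have h := map_mul (GradedTensorProduct.includeLeft (R := K)
    (fun p : ℕ => ⋀[K]^p (Module.Dual K 𝔤)) (fun q : ℕ => ⋀[K]^q 𝔤)) a a'
  simp only [GradedTensorProduct.includeLeft_apply] at h
  rw [← h, GradedTensorProduct.tmul_one_mul_one_tmul]

/-- Moving the vector past a form of degree $p$ costs $(-1)^p$, which is what the involution does in
that degree. -/
theorem vec_mul_cten (v : 𝔤) (a : ExteriorAlgebra K (Module.Dual K 𝔤)) (b : ExteriorAlgebra K 𝔤) :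
    cten 1 (ExteriorAlgebra.ι K v) * cten a b =
      cten (CliffordAlgebra.involute a) (ExteriorAlgebra.ι K v * b) := by
  induction a using exterior_induction with
  | h0 => rw [cten_zero_left, map_zero, cten_zero_left, mul_zero]
  | hadd x y hx hy => rw [cten_add_left, mul_add, hx, hy, map_add, cten_add_left]
  | h p a ha =>
    have hv : ExteriorAlgebra.ι K v ∈ ⋀[K]^1 𝔤 := by
      rw [ExteriorAlgebra.exteriorPower, pow_one]
      exact LinearMap.mem_range_self _ v
    have h := GradedTensorProduct.tmul_coe_mul_coe_tmul (R := K)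
      (fun p : ℕ => ⋀[K]^p (Module.Dual K 𝔤)) (fun q : ℕ => ⋀[K]^q 𝔤) 1
      (⟨_, hv⟩ : ⋀[K]^1 𝔤) (⟨a, ha⟩ : ⋀[K]^p (Module.Dual K 𝔤)) b
    rw [involute_of_mem ha, cten_smul_left]
    refine h.trans ?_
    rw [one_mul, one_mul]
    rcases Nat.even_or_odd p with hp | hp
    · rw [hp.neg_one_pow, one_smul, hp.neg_one_pow, one_smul]
    · rw [hp.neg_one_pow, Units.neg_smul, one_smul, hp.neg_one_pow, neg_one_smul]

/-- The element of degree one given by a form and a vector. -/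
def degOne (u : Module.Dual K 𝔤 × 𝔤) : Cochain K 𝔤 :=
  cten (ExteriorAlgebra.ι K u.1) 1 + cten 1 (ExteriorAlgebra.ι K u.2)

/-- The interior product with an element of degree one. -/
def contract (u : Module.Dual K 𝔤 × 𝔤) : Cochain K 𝔤 →ₗ[K] Cochain K 𝔤 :=
  contractVec u.2 + contractForm u.1

variable (K 𝔤) in
/-- The parity involution of the space of cochains. -/
def parity : Cochain K 𝔤 →ₗ[K] Cochain K 𝔤 :=
  cochainMap CliffordAlgebra.involute.toLinearMap CliffordAlgebra.involute.toLinearMap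

variable (K 𝔤) in
/-- The constant term of a cochain. -/
def constTerm : Cochain K 𝔤 →ₗ[K] K :=
  LinearMap.mul' K K ∘ₗ TensorProduct.map ExteriorAlgebra.algebraMapInv.toLinearMap
    ExteriorAlgebra.algebraMapInv.toLinearMap ∘ₗ
    (GradedTensorProduct.of K (fun p : ℕ => ⋀[K]^p (Module.Dual K 𝔤))
      (fun q : ℕ => ⋀[K]^q 𝔤)).symm.toLinearMap

theorem constTerm_cten (a : ExteriorAlgebra K (Module.Dual K 𝔤)) (b : ExteriorAlgebra K 𝔤) :
    constTerm K 𝔤 (cten a b) =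
      ExteriorAlgebra.algebraMapInv a * ExteriorAlgebra.algebraMapInv b := rfl

theorem parity_cten (a : ExteriorAlgebra K (Module.Dual K 𝔤)) (b : ExteriorAlgebra K 𝔤) :
    parity K 𝔤 (cten a b) = cten (CliffordAlgebra.involute a) (CliffordAlgebra.involute b) := rfl

theorem cochain_one : (1 : Cochain K 𝔤) = cten 1 1 := rfl

theorem degOne_mul_cten (u : Module.Dual K 𝔤 × 𝔤) (a : ExteriorAlgebra K (Module.Dual K 𝔤))
    (b : ExteriorAlgebra K 𝔤) : degOne u * cten a b = cten (ExteriorAlgebra.ι K u.1 * a) b +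
      cten (CliffordAlgebra.involute a) (ExteriorAlgebra.ι K u.2 * b) := by
  rw [degOne, add_mul, form_mul_cten, vec_mul_cten]

theorem degOne_add (u w : Module.Dual K 𝔤 × 𝔤) : degOne (u + w) = degOne u + degOne w := by
  simp only [degOne, Prod.fst_add, Prod.snd_add, map_add, cten_add_left, cten_add_right]
  abel

theorem degOne_smul (c : K) (u : Module.Dual K 𝔤 × 𝔤) : degOne (c • u) = c • degOne u := by
  simp only [degOne, Prod.smul_fst, Prod.smul_snd, map_smul, cten_smul_left, cten_smul_right,
    smul_add]

theorem degOne_zero : degOne (0 : Module.Dual K 𝔤 × 𝔤) = 0 := by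
  simp only [degOne, Prod.fst_zero, Prod.snd_zero, map_zero, cten_zero_left, cten_zero_right,
    add_zero]

theorem degOne_anticomm (u w : Module.Dual K 𝔤 × 𝔤) :
    degOne u * degOne w = -(degOne w * degOne u) := by
  have h1 := ExteriorAlgebra.ι_add_mul_swap (R := K) u.1 w.1
  have h2 := ExteriorAlgebra.ι_add_mul_swap (R := K) u.2 w.2
  rw [add_eq_zero_iff_eq_neg] at h1 h2
  rw [degOne.eq_1 w, mul_add, degOne_mul_cten, degOne_mul_cten, degOne.eq_1 u, mul_add, ← degOne.eq_1,
    degOne_mul_cten, degOne_mul_cten, h1, h2]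
  simp only [CliffordAlgebra.involute_ι, cten_neg_left, cten_neg_right, map_one, mul_one,
    ExteriorAlgebra.ι]
  abel

theorem degOne_sq (u : Module.Dual K 𝔤 × 𝔤) : degOne u * degOne u = 0 := by
  rw [degOne.eq_1 u, mul_add, ← degOne.eq_1, degOne_mul_cten, degOne_mul_cten,
    ExteriorAlgebra.ι_sq_zero, ExteriorAlgebra.ι_sq_zero, cten_zero_left, cten_zero_right]
  simp only [CliffordAlgebra.involute_ι, cten_neg_left, mul_one, ExteriorAlgebra.ι]
  abel

theorem contract_one (u : Module.Dual K 𝔤 × 𝔤) : contract u (1 : Cochain K 𝔤) = 0 := by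
  rw [cochain_one, contract, LinearMap.add_apply, contractVec, contractForm, cochainMap_cten,
    cochainMap_cten, CliffordAlgebra.contractLeft_one, CliffordAlgebra.contractLeft_one,
    cten_zero_left, cten_zero_right, add_zero]

theorem contract_cten (u : Module.Dual K 𝔤 × 𝔤) (a : ExteriorAlgebra K (Module.Dual K 𝔤))
    (b : ExteriorAlgebra K 𝔤) : contract u (cten a b) =
      cten (CliffordAlgebra.contractLeft (Module.Dual.eval K 𝔤 u.2) a) b +
        cten (CliffordAlgebra.involute a) (CliffordAlgebra.contractLeft u.1 b) := rfl

/-- The contractions are odd derivations whose values on degree one elements are given by the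
symmetric pairing of $\mathfrak g^*\oplus\mathfrak g$ with itself. -/
theorem contract_degOne_mul (u w : Module.Dual K 𝔤 × 𝔤) (x : Cochain K 𝔤) :
    contract u (degOne w * x) = (w.1 u.2 + u.1 w.2) • x - degOne w * contract u x := by
  induction x using cochain_induction with
  | h0 => simp
  | hadd x y hx hy => rw [mul_add, map_add, hx, hy, map_add, mul_add, smul_add]; abel
  | h a b =>
    rw [degOne_mul_cten, map_add, contract_cten, contract_cten, contract_cten, mul_add,
      degOne_mul_cten, degOne_mul_cten, ExteriorAlgebra.ι, ExteriorAlgebra.ι,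
      CliffordAlgebra.contractLeft_ι_mul, CliffordAlgebra.contractLeft_ι_mul, map_mul,
      CliffordAlgebra.involute_ι, CliffordAlgebra.involute_involute, contractLeft_involute]
    simp only [sub_eq_add_neg, cten_add_left, cten_add_right, cten_neg_left, cten_neg_right,
      cten_smul_left, cten_smul_right, neg_mul, add_smul, Module.Dual.eval_apply]
    abel

theorem parity_one : parity K 𝔤 1 = 1 := by
  rw [cochain_one, parity_cten, map_one, map_one]

theorem parity_degOne_mul (u : Module.Dual K 𝔤 × 𝔤) (x : Cochain K 𝔤) :
    parity K 𝔤 (degOne u * x) = -(degOne u * parity K 𝔤 x) := by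
  induction x using cochain_induction with
  | h0 => simp
  | hadd x y hx hy => rw [mul_add, map_add, hx, hy, map_add, mul_add, neg_add]
  | h a b =>
    rw [degOne_mul_cten, map_add, parity_cten, parity_cten, parity_cten, degOne_mul_cten, map_mul,
      map_mul, ExteriorAlgebra.ι, ExteriorAlgebra.ι, CliffordAlgebra.involute_ι,
      CliffordAlgebra.involute_ι]
    simp only [cten_neg_left, cten_neg_right, neg_mul, neg_add]

theorem constTerm_degOne_mul (u : Module.Dual K 𝔤 × 𝔤) (x : Cochain K 𝔤) :
    constTerm K 𝔤 (degOne u * x) = 0 := by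
  induction x using cochain_induction with
  | h0 => simp
  | hadd x y hx hy => rw [mul_add, map_add, hx, hy, add_zero]
  | h a b =>
    rw [degOne_mul_cten, map_add, constTerm_cten, constTerm_cten, map_mul, map_mul,
      algebraMapInv_ι, algebraMapInv_ι]
    simp

theorem eq_top_of_degOne_mul_mem {W : Submodule K (Cochain K 𝔤)} (h1 : 1 ∈ W)
    (h : ∀ u, ∀ x ∈ W, degOne u * x ∈ W) : W = ⊤ := by
  have hb (b : ExteriorAlgebra K 𝔤) : cten (1 : ExteriorAlgebra K (Module.Dual K 𝔤)) b ∈ W := by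
    induction b using CliffordAlgebra.left_induction with
    | algebraMap r =>
      rw [Algebra.algebraMap_eq_smul_one, cten_smul_right]
      exact W.smul_mem r h1
    | add a b ha hb => rw [cten_add_right]; exact W.add_mem ha hb
    | ι_mul b v hb =>
      have := h (0, v) _ hb
      rwa [degOne_mul_cten, map_zero, zero_mul, cten_zero_left, zero_add, map_one] at this
  have ha (a : ExteriorAlgebra K (Module.Dual K 𝔤)) (b : ExteriorAlgebra K 𝔤) : cten a b ∈ W := by
    induction a using CliffordAlgebra.left_induction with
    | algebraMap r =>
      rw [Algebra.algebraMap_eq_smul_one, cten_smul_left]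
      exact W.smul_mem r (hb b)
    | add a b ha hb => rw [cten_add_left]; exact W.add_mem ha hb
    | ι_mul a φ ha =>
      have := h (φ, 0) _ ha
      rwa [degOne_mul_cten, map_zero, zero_mul, cten_zero_right, add_zero] at this
  refine eq_top_iff.mpr fun x _ => ?_
  induction x using cochain_induction with
  | h0 => exact W.zero_mem
  | hadd x y hx hy => exact W.add_mem (hx trivial) (hy trivial)
  | h a b => exact ha a b

theorem contractFormRight_eq (φ : Module.Dual K 𝔤) (x : Cochain K 𝔤) :
    contractFormRight φ x = - contractForm φ (parity K 𝔤 x) := by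
  induction x using cochain_induction with
  | h0 => simp
  | hadd x y hx hy => simp only [map_add, hx, hy, neg_add]
  | h a b =>
    rw [contractFormRight, contractForm, parity_cten, cochainMap_cten, cochainMap_cten,
      LinearMap.flip_apply, contractRight_eq_neg, cten_neg_right, LinearMap.id_apply,
      AlgHom.toLinearMap_apply, CliffordAlgebra.involute_involute]

theorem contractVecRight_eq (v : 𝔤) (x : Cochain K 𝔤) :
    contractVecRight v x = - contractVec v (parity K 𝔤 x) := by
  induction x using cochain_induction with
  | h0 => simp
  | hadd x y hx hy => simp only [map_add, hx, hy, neg_add]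
  | h a b =>
    rw [contractVecRight, contractVec, parity_cten, cochainMap_cten, cochainMap_cten,
      LinearMap.flip_apply, contractRight_eq_neg, cten_neg_left, LinearMap.id_apply,
      AlgHom.toLinearMap_apply]

theorem parity_of_mem {p q : ℕ} {x : Cochain K 𝔤} (hx : x ∈ cochainDeg K 𝔤 p q) :
    parity K 𝔤 x = (-1 : K) ^ (p + q) • x := by
  induction hx using Submodule.span_induction with
  | mem x h =>
    obtain ⟨a, ha, b, hb, rfl⟩ := h
    refine (parity_cten a b).trans ?_
    rw [involute_of_mem ha, involute_of_mem hb, cten_smul_left, cten_smul_right, smul_smul, pow_add]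
  | zero => simp
  | add x y _ _ hx hy => rw [map_add, hx, hy, smul_add]
  | smul c x _ hx => rw [map_smul, hx, smul_comm]

/-- The involution is $(-1)^{p+q}$ on $C^{p,q}$, so $x+\mathrm{parity}(x)$ is always even. For a
fixed point it equals $2x$, and 2 is invertible. -/
theorem mem_evenCochain_iff [CharZero K] {x : Cochain K 𝔤} :
    x ∈ evenCochain K 𝔤 ↔ parity K 𝔤 x = x := by
  constructor
  · intro hx
    have : evenCochain K 𝔤 ≤ LinearMap.eqLocus (parity K 𝔤) LinearMap.id := by
      refine iSup_le fun p => iSup_le fun q => iSup_le fun hpq => fun x hx => ?_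
      rw [LinearMap.mem_eqLocus, parity_of_mem hx, hpq.neg_one_pow, one_smul, LinearMap.id_apply]
    exact this hx
  · intro hx
    have key (x : Cochain K 𝔤) : x + parity K 𝔤 x ∈ evenCochain K 𝔤 := by
      induction x using cochain_induction with
      | h0 => simp
      | hadd x y hx hy =>
        rw [map_add, add_add_add_comm]
        exact Submodule.add_mem _ hx hy
      | h a b =>
        induction a using exterior_induction with
        | h0 => rw [cten_zero_left, map_zero, add_zero]; exact Submodule.zero_mem _
        | hadd x y hx hy =>
          rw [cten_add_left, map_add, add_add_add_comm]
          exact Submodule.add_mem _ hx hy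
        | h p a ha =>
          induction b using exterior_induction with
          | h0 => rw [cten_zero_right, map_zero, add_zero]; exact Submodule.zero_mem _
          | hadd x y hx hy =>
            rw [cten_add_right, map_add, add_add_add_comm]
            exact Submodule.add_mem _ hx hy
          | h q b hb =>
            have hab : cten a b ∈ cochainDeg K 𝔤 p q := Submodule.subset_span ⟨a, ha, b, hb, rfl⟩
            rw [parity_of_mem hab]
            rcases Nat.even_or_odd (p + q) with h | h
            · rw [h.neg_one_pow, one_smul]
              have : cten a b ∈ evenCochain K 𝔤 := Submodule.mem_iSup_of_mem p
                (Submodule.mem_iSup_of_mem q (Submodule.mem_iSup_of_mem h hab))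
              exact Submodule.add_mem _ this this
            · rw [h.neg_one_pow, neg_one_smul, add_neg_cancel]
              exact Submodule.zero_mem _
    have h := key x
    rw [hx, ← two_smul K] at h
    have h2 : (2 : K) ≠ 0 := by norm_num
    exact (Submodule.smul_mem_iff _ h2).mp h

end Cochain

/-! ### The even cohomology of the Heisenberg algebra -/

section Heisenberg

variable {K : Type u} [Field K] {𝔤 : Type v} [LieRing 𝔤] [LieAlgebra K 𝔤]
  (e : Module.Basis (Fin 3) K 𝔤)

/-- The dual basis followed by the basis. -/
def dualBasisPair : ℕ → Module.Dual K 𝔤 × 𝔤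
  | 0 => (e.coord 0, 0)
  | 1 => (e.coord 1, 0)
  | 2 => (e.coord 2, 0)
  | 3 => (0, e 0)
  | 4 => (0, e 1)
  | 5 => (0, e 2)
  | _ => 0

/-- Shifting an index by 3 modulo 6 exchanges a basis vector with its dual form, so the derivative
along $\theta_i$ is the contraction with the shifted generator. -/
theorem dualBasisPair_pairing {i : ℕ} (hi : i < 6) (j : ℕ) :
    (dualBasisPair e j).1 (dualBasisPair e ((i + 3) % 6)).2 +
      (dualBasisPair e ((i + 3) % 6)).1 (dualBasisPair e j).2 = if i = j then 1 else 0 := by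
  rcases lt_or_ge j 6 with hj | hj
  · interval_cases i <;> interval_cases j <;> simp [dualBasisPair]
  · obtain ⟨k, rfl⟩ := Nat.exists_eq_add_of_le' hj
    simp [dualBasisPair, show ¬ i = k + 6 by omega]

/-- The cochains of a three-dimensional Lie algebra as a Grassmann algebra. -/
def cochainSystem : GrassmannSystem K (Cochain K 𝔤) where
  θ j := degOne (dualBasisPair e j)
  D i := contract (dualBasisPair e ((i + 3) % 6))
  inv := parity K 𝔤
  anticomm i j := degOne_anticomm _ _
  sq i := degOne_sq _
  D_one i := contract_one _
  D_gen_mul i j x hi := by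
    rw [contract_degOne_mul, dualBasisPair_pairing e hi, ite_smul, one_smul, zero_smul]
  ε := constTerm K 𝔤
  gen_eq_zero i hi := by
    obtain ⟨k, rfl⟩ := Nat.exists_eq_add_of_le' hi
    exact degOne_zero
  inv_one := parity_one
  inv_gen_mul j x := parity_degOne_mul _ _
  ε_one := by
    rw [cochain_one, constTerm_cten, map_one, map_one, mul_one]
  ε_gen_mul j x := constTerm_degOne_mul _ _
  induct W h1 h := by
    refine eq_top_of_degOne_mul_mem h1 fun u x hx => ?_
    have hu : u = u.1 (e 0) • dualBasisPair e 0 + u.1 (e 1) • dualBasisPair e 1 +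
        u.1 (e 2) • dualBasisPair e 2 + e.coord 0 u.2 • dualBasisPair e 3 +
        e.coord 1 u.2 • dualBasisPair e 4 + e.coord 2 u.2 • dualBasisPair e 5 := by
      refine Prod.ext (e.ext fun i => ?_) ?_
      · fin_cases i <;> simp [dualBasisPair]
      · have := e.sum_repr u.2
        rw [Fin.sum_univ_three] at this
        simpa [dualBasisPair] using this.symm
    rw [hu]
    simp only [degOne_add, degOne_smul, add_mul, smul_mul_assoc]
    refine W.add_mem (W.add_mem (W.add_mem (W.add_mem (W.add_mem ?_ ?_) ?_) ?_) ?_) ?_ <;>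
      exact W.smul_mem _ (h _ x hx)

theorem bigBracket_apply (a b : Cochain K 𝔤) : bigBracket e a b = (cochainSystem e).br a b := by
  have hv (i : Fin 3) (x : Cochain K 𝔤) : contract (0, e i) x = contractVec (e i) x := by
    simp [contract, contractForm, cochainMap]
  have hf (i : Fin 3) (x : Cochain K 𝔤) : contract (e.coord i, 0) x = contractForm (e.coord i) x := by
    simp [contract, contractVec, cochainMap]
  simp only [bigBracket, GrassmannSystem.br, cochainSystem, Finset.sum_range_succ,
    Finset.sum_range_zero, Fin.sum_univ_three, LinearMap.add_apply, LinearMap.compl₁₂_apply, cup,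
    LinearMap.mul_apply', contractFormRight_eq, contractVecRight_eq, dualBasisPair, hv, hf,
    Nat.reduceAdd, Nat.reduceMod, zero_add, neg_mul]
  abel

variable {e}

theorem lieElement_eq (h01 : ⁅e 0, e 1⁆ = e 2) (h02 : ⁅e 0, e 2⁆ = 0) (h12 : ⁅e 1, e 2⁆ = 0) :
    lieElement e =
    (cochainSystem e).θ 0 * (cochainSystem e).θ 1 * (cochainSystem e).θ 5 := by
  have h0 : Finset.Ioi (0 : Fin 3) = {1, 2} := by decide
  have h1 : Finset.Ioi (1 : Fin 3) = {2} := by decide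
  have h2 : Finset.Ioi (2 : Fin 3) = ∅ := by decide
  have hz (a : ExteriorAlgebra K (Module.Dual K 𝔤)) :
      a ᵍ⊗ₜ[K] (0 : ExteriorAlgebra K 𝔤) = (0 : Cochain K 𝔤) := cten_zero_right a
  rw [lieElement, Fin.sum_univ_three, h0, h1, h2, Finset.sum_pair (by decide),
    Finset.sum_singleton, Finset.sum_empty, h01, h02, h12, map_zero, hz, hz, add_zero, add_zero,
    add_zero]
  change _ = degOne (e.coord 0, 0) * degOne (e.coord 1, 0) * degOne (0, e 2)
  simp only [degOne, map_zero, cten_zero_left, cten_zero_right, add_zero, zero_add]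
  rw [form_mul_cten, form_mul_cten, mul_one]

theorem ceDiff_apply (h01 : ⁅e 0, e 1⁆ = e 2) (h02 : ⁅e 0, e 2⁆ = 0) (h12 : ⁅e 1, e 2⁆ = 0)
    (x : Cochain K 𝔤) : ceDiff e x = (cochainSystem e).d x := by
  rw [ceDiff, lieElement_eq h01 h02 h12, bigBracket_apply, GrassmannSystem.d]

theorem mem_evenCocycles_iff [CharZero K] (h01 : ⁅e 0, e 1⁆ = e 2) (h02 : ⁅e 0, e 2⁆ = 0)
    (h12 : ⁅e 1, e 2⁆ = 0)
    {x : Cochain K 𝔤} : x ∈ evenCocycles e ↔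
    (cochainSystem e).d x = 0 ∧ (cochainSystem e).inv x = x := by
  rw [evenCocycles, Submodule.mem_inf, LinearMap.mem_ker, ceDiff_apply h01 h02 h12,
    mem_evenCochain_iff]
  rfl

theorem mul_mem_evenCocycles [CharZero K] (h01 : ⁅e 0, e 1⁆ = e 2) (h02 : ⁅e 0, e 2⁆ = 0)
    (h12 : ⁅e 1, e 2⁆ = 0)
    {a b : Cochain K 𝔤} (ha : a ∈ evenCocycles e)
    (hb : b ∈ evenCocycles e) : a * b ∈ evenCocycles e := by
  rw [mem_evenCocycles_iff h01 h02 h12] at ha hb ⊢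
  rw [GrassmannSystem.d_mul, GrassmannSystem.inv_mul, ha.1, ha.2, hb.1, hb.2]
  simp

theorem br_mem_evenCocycles [CharZero K] (h01 : ⁅e 0, e 1⁆ = e 2) (h02 : ⁅e 0, e 2⁆ = 0)
    (h12 : ⁅e 1, e 2⁆ = 0)
    {a b : Cochain K 𝔤} (ha : a ∈ evenCocycles e)
    (hb : b ∈ evenCocycles e) : (cochainSystem e).br a b ∈ evenCocycles e := by
  rw [mem_evenCocycles_iff h01 h02 h12] at ha hb ⊢
  rw [GrassmannSystem.d_br, GrassmannSystem.inv_br, ha.1, ha.2, hb.1, hb.2]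
  simp [← GrassmannSystem.brLin_apply]

attribute [local irreducible] GrassmannSystem.proj

theorem coboundaries_le_ker [CharZero K] (h01 : ⁅e 0, e 1⁆ = e 2) (h02 : ⁅e 0, e 2⁆ = 0)
    (h12 : ⁅e 1, e 2⁆ = 0) :
    (LinearMap.range (ceDiff e)).comap (evenCocycles e).subtype ≤
      LinearMap.ker ((cochainSystem e).proj ∘ₗ (evenCocycles e).subtype) := by
  rintro x ⟨y, hy⟩
  rw [LinearMap.mem_ker, LinearMap.comp_apply, ← hy,
    ceDiff_apply h01 h02 h12, GrassmannSystem.proj_d]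

/-- For an even cocycle killed by `proj`, the homotopy formula reduces to $x=d(\mathrm{hom}\,x)$. -/
theorem ker_le_coboundaries [CharZero K] (h01 : ⁅e 0, e 1⁆ = e 2) (h02 : ⁅e 0, e 2⁆ = 0)
    (h12 : ⁅e 1, e 2⁆ = 0) :
    LinearMap.ker ((cochainSystem e).proj ∘ₗ (evenCocycles e).subtype) ≤
      (LinearMap.range (ceDiff e)).comap (evenCocycles e).subtype := by
  intro x h
  rw [LinearMap.mem_ker, LinearMap.comp_apply] at h
  have hx := (mem_evenCocycles_iff h01 h02 h12).mp x.2
  exact ⟨_, (ceDiff_apply h01 h02 h12 _).trans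
    ((cochainSystem e).eq_d_of_proj_eq_zero hx.2 hx.1 h).symm⟩

theorem proj_surjective [CharZero K] (h01 : ⁅e 0, e 1⁆ = e 2) (h02 : ⁅e 0, e 2⁆ = 0)
    (h12 : ⁅e 1, e 2⁆ = 0) :
    Function.Surjective ((cochainSystem e).proj ∘ₗ (evenCocycles e).subtype) := by
  intro x
  have hx : (cochainSystem e).lift x ∈ evenCocycles e :=
    (mem_evenCocycles_iff h01 h02 h12).mpr
      ⟨(cochainSystem e).d_lift x, (cochainSystem e).inv_lift x⟩
  refine ⟨⟨_, hx⟩, ?_⟩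
  rw [LinearMap.comp_apply, Submodule.subtype_apply, GrassmannSystem.proj_lift]

theorem exists_cohomology_equiv [CharZero K] (h01 : ⁅e 0, e 1⁆ = e 2) (h02 : ⁅e 0, e 2⁆ = 0)
    (h12 : ⁅e 1, e 2⁆ = 0) :
    ∃ F : EvenCohomology e ≃ₗ[K] GlSemi K 3,
    ∀ a : evenCocycles e, F (cohomClass e a) = (cochainSystem e).proj a := by
  have hker := (coboundaries_le_ker h01 h02 h12).antisymm (ker_le_coboundaries h01 h02 h12)
  refine ⟨(Submodule.quotEquivOfEq _ _ hker).trans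
    (LinearMap.quotKerEquivOfSurjective _ (proj_surjective h01 h02 h12)), fun a => ?_⟩
  rw [LinearEquiv.trans_apply, Submodule.quotEquivOfEq_mk,
    LinearMap.quotKerEquivOfSurjective_apply_mk, LinearMap.comp_apply, Submodule.subtype_apply]

end Heisenberg

/-! ### Transport of the Poisson structure and the isomorphism -/

section Transport

variable {K : Type u} [Field K] {A : Type v} {B : Type w} [AddCommGroup A] [Module K A]
  [AddCommGroup B] [Module K B]

/-- Transport of a bilinear operation along a linear equivalence. -/
def transport (F : B ≃ₗ[K] A) (op : A →ₗ[K] A →ₗ[K] A) : B →ₗ[K] B →ₗ[K] B :=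
  (op.compl₁₂ F.toLinearMap F.toLinearMap).compr₂ F.symm.toLinearMap

theorem transport_apply (F : B ≃ₗ[K] A) (op : A →ₗ[K] A →ₗ[K] A) (x y : B) :
    transport F op x y = F.symm (op (F x) (F y)) := rfl

theorem IsPoissonAlgebra.transport {mul br : A →ₗ[K] A →ₗ[K] A} (h : IsPoissonAlgebra K mul br)
    (F : B ≃ₗ[K] A) : IsPoissonAlgebra K (GTables.transport F mul) (GTables.transport F br) where
  mul_comm a b := by simp only [transport_apply, h.mul_comm (F a)]
  mul_assoc a b c := by simp only [transport_apply, LinearEquiv.apply_symm_apply, h.mul_assoc]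
  br_self a := by simp only [transport_apply, h.br_self, map_zero]
  jacobi a b c := by
    simp only [transport_apply, LinearEquiv.apply_symm_apply, ← map_add]
    rw [h.jacobi]
  leibniz a b c := by
    simp only [transport_apply, LinearEquiv.apply_symm_apply, ← map_add]
    rw [h.leibniz]

end Transport

/-- The operations on cohomology are defined by transport from the matrix algebra, so the Poisson
axioms come for free. That they are the inherited ones is the multiplicativity of `proj` on even
cocycles, for the product and for the bracket. -/
theorem heisenberg_cohomology (K : Type u) [Field K] [CharZero K] (𝔥 : Type v) [LieRing 𝔥]
    [LieAlgebra K 𝔥] (e : Module.Basis (Fin 3) K 𝔥) (h01 : ⁅e 0, e 1⁆ = e 2)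
    (h02 : ⁅e 0, e 2⁆ = 0) (h12 : ⁅e 1, e 2⁆ = 0) :
    ∃ mulH brH : EvenCohomology e →ₗ[K] EvenCohomology e →ₗ[K] EvenCohomology e,
      IsInherited e (cup K 𝔥) mulH ∧ IsInherited e (bigBracket e) brH ∧
      IsPoissonAlgebra K mulH brH ∧
      ∃ F : GlSemi K 3 ≃ₗ[K] EvenCohomology e,
        (∀ x y, F (glMul K 3 x y) = mulH (F x) (F y)) ∧
        (∀ x y : GlSemi K 3, F ⁅x, y⁆ = brH (F x) (F y)) := by
  obtain ⟨F, hF⟩ := exists_cohomology_equiv h01 h02 h12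
  refine ⟨transport F (glMul K 3), transport F (lieBilin K (GlSemi K 3)), fun a b => ?_,
    fun a b => ?_, isPoissonAlgebra_glMul.transport F, F.symm, fun x y => ?_, fun x y => ?_⟩
  · have ha := (mem_evenCocycles_iff h01 h02 h12).mp a.2
    have hb := (mem_evenCocycles_iff h01 h02 h12).mp b.2
    refine ⟨⟨_, mul_mem_evenCocycles h01 h02 h12 a.2 b.2⟩, rfl, ?_⟩
    rw [transport_apply, LinearEquiv.symm_apply_eq, hF, hF, hF,
      (cochainSystem e).proj_mul ha.2 hb.2 ha.1 hb.1]
  · have ha := (mem_evenCocycles_iff h01 h02 h12).mp a.2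
    have hb := (mem_evenCocycles_iff h01 h02 h12).mp b.2
    refine ⟨⟨_, br_mem_evenCocycles h01 h02 h12 a.2 b.2⟩, (bigBracket_apply e _ _).symm, ?_⟩
    rw [transport_apply, LinearEquiv.symm_apply_eq, hF, hF, hF,
      (cochainSystem e).proj_br ha.2 hb.2 ha.1 hb.1]
    rfl
  · rw [transport_apply, F.apply_symm_apply, F.apply_symm_apply]
  · rw [transport_apply, F.apply_symm_apply, F.apply_symm_apply]
    rfl

end GTables

end

theorem mainTheorem2 (K : Type u) [Field K] [CharZero K] :
    -- the product on `𝔤𝔩(n) ⋉ 𝔤𝔩(n)_ab` is given by the explicit formula, and it is Poisson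
    (∀ n : ℕ,
      (∀ (a₀ a₁ b₀ b₁ : K) (A₀ A₁ B₀ B₁ : Matrix (Fin n) (Fin n) K),
        A₀.trace = 0 → A₁.trace = 0 → B₀.trace = 0 → B₁.trace = 0 →
        GTables.glMul K n (GTables.pair (a₀ • 1 + A₀) (a₁ • 1 + A₁))
            (GTables.pair (b₀ • 1 + B₀) (b₁ • 1 + B₁)) =
          GTables.pair ((a₀ * b₀) • 1 + a₀ • B₀ + b₀ • A₀)
            ((a₀ * b₁ + a₁ * b₀ + (A₀ * B₁ + A₁ * B₀).trace
                - 2 / (n : K) * (A₀ * B₀).trace) • 1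
              + a₀ • B₁ + b₀ • A₁ + A₀ * B₀ + B₀ * A₀)) ∧
      GTables.IsPoissonAlgebra K (GTables.glMul K n)
        (GTables.lieBilin K (GTables.GlSemi K n))) ∧
    -- for `n = 3` it is isomorphic to the even cohomology of the Heisenberg Lie algebra
    (∀ (𝔥 : Type v) [LieRing 𝔥] [LieAlgebra K 𝔥] (e : Module.Basis (Fin 3) K 𝔥),
      ⁅e 0, e 1⁆ = e 2 → ⁅e 0, e 2⁆ = 0 → ⁅e 1, e 2⁆ = 0 →
      ∃ mulH brH : GTables.EvenCohomology e →ₗ[K] GTables.EvenCohomology e →ₗ[K]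
          GTables.EvenCohomology e,
        GTables.IsInherited e (GTables.cup K 𝔥) mulH ∧
        GTables.IsInherited e (GTables.bigBracket e) brH ∧
        GTables.IsPoissonAlgebra K mulH brH ∧
        ∃ F : GTables.GlSemi K 3 ≃ₗ[K] GTables.EvenCohomology e,
          (∀ x y, F (GTables.glMul K 3 x y) = mulH (F x) (F y)) ∧
          (∀ x y : GTables.GlSemi K 3, F ⁅x, y⁆ = brH (F x) (F y))) ∧
    -- the trivial and the adjoint representation, with the chosen morphisms, label `Rep(GL(n))`
    (∀ n : ℕ, 2 ≤ n → (GTables.glLabeling K n).IsPartialLabeling) ∧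
    -- the tables of the product and of the bracket
    (∀ n : ℕ, 1 ≤ n →
      GTables.IsGTable (GTables.glLabeling K n) (GTables.semiRep K n) (GTables.glMul K n)
        GTables.pieceType (GTables.pieceMap K n) (GTables.mulTable K n) ∧
      GTables.IsGTable (GTables.glLabeling K n) (GTables.semiRep K n)
        (GTables.lieBilin K (GTables.GlSemi K n))
        GTables.pieceType (GTables.pieceMap K n) (GTables.brTable K n)) := by
  exact ⟨fun n => ⟨GTables.glMul_pair, GTables.isPoissonAlgebra_glMul⟩,
    fun 𝔥 _ _ e => GTables.heisenberg_cohomology K 𝔥 e,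
    fun n hn => GTables.isPartialLabeling_glLabeling hn,
    fun n hn => ⟨GTables.isGTable_glMul (by omega), GTables.isGTable_lieBilin (by omega)⟩⟩
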